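/- Let $M=G/H$ be a Hermitian symmetric space of non-negative sectional curvature (for instance of compact type), i.e. a connected complex manifold with a smooth Hermitian metric such that every point is the isolated fixed point of an involutive holomorphic isometry whose differential there is $-1$. Let $I$ denote its complex structure (and that of $T^*M$), $(\cdot,\cdot)$ its metric, $\omega(X,Y)=(IX,Y)$ its Kähler form, and $R(X,Y)=\nabla_{[X,Y]}-[\nabla_X,\nabla_Y]$ its curvature tensor. Put $d^c u=-du\circ I$, so that $dd^c=2i\partial\bar\partial$. Let $p:T^*M\to M$ be the holomorphic cotangent bundle; a complex linear functional $v$ is identified with the real covector $\operatorname{Re} v$, and, by the metric, with a tangent vector. The circle acts on $T^*M$ by $v\mapsto e^{i\theta}v$, with generating vector field $X$. Let $$f(u)=\frac1u\Big(\sqrt{1+u}-1-\log\frac{1+\sqrt{1+u}}2\Big),\qquad g(u)=-\frac1u\log\frac{1+\sqrt{1+u}}2,$$ with $f(0)=\tfrac14$, $g(0)=-\tfrac14$, and let $$\omega_1=p^*\omega+dd^ch,\qquad h(v)=\big(f(IR(Iv,v))v,v\big),$$ be the $I$-Kähler form of the Biquard–Gauduchon hyperkähler metric on $T^*M$ (for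 which $\omega_2+i\omega_3$ is the canonical symplectic form). Then: 1. For every $v\in T^*M$ the transformation $IR(Iv,v)$ is complex linear, self-adjoint and non-negative, and $h(v)$ and $k(v)=\big(g(IR(Iv,v))v,v\big)$ are smooth functions on $T^*M$. 2. The function $\mu(v)=-2\big((uf(u))'\,v,v\big)$, where $u=IR(Iv,v)$, is smooth and is a moment map for the circle action: $i_X\omega_1=d\mu$. 3. For every smooth $\mu$ with $i_X\omega_1=d\mu$ (in particular the one in 2), $$F:=\omega_1+dd^c\mu=p^*\omega+dd^ck .$$ Consequently, if $L$ is a Hermitian holomorphic line bundle on $T^*M$ with curvature $\omega_1$ (locally $\omega_1=\tfrac12dd^c\log\|s\|^2$ for non-vanishing holomorphic sections $s$), then $L$ with the metric multiplied by $e^{2\mu}$ — the hyperholomorphic line bundle — has curvature $p^*\omega+dd^ck$. 4. $F$ is hyperholomorphic: for every hyperkähler structure $(I,J,K)$ on $T^*M$ whose Kähler forms are $\omega_1$ and $\omega_2,\omega_3$ with $\omega_2+i\omega_3$ the canonical symplectic form, $F$ is of type $(1,1)$ with respect to $I$, $J$ and $K$. -/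

import Mathlib

open Set Filter Topology Bundle
open scoped Manifold ContDiff

noncomputable section

namespace HyperHol

/-! ### Differential forms on (complex) manifolds -/

section Forms

variable {V : Type*} [NormedAddCommGroup V] [NormedSpace ℝ V] [NormedSpace ℂ V]
  [IsScalarTower ℝ ℂ V] {V' : Type*} [NormedAddCommGroup V'] [NormedSpace ℝ V']
  {H : Type*} [TopologicalSpace H] {H' : Type*} [TopologicalSpace H']

/-- Multiplication by `i`, as a real linear map. -/
def mulI (V : Type*) [NormedAddCommGroup V] [NormedSpace ℝ V] [NormedSpace ℂ V]
    [IsScalarTower ℝ ℂ V] : V →L[ℝ] V :=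
  (Complex.I • ContinuousLinearMap.id ℂ V).restrictScalars ℝ

/-- The (almost) complex structure `I` of a complex manifold: multiplication by `i` on
the tangent space (which is the complex model space). -/
def cxI (J : ModelWithCorners ℝ V H) {N : Type*} [TopologicalSpace N] [ChartedSpace H N] (x : N) :
    TangentSpace J x →L[ℝ] TangentSpace J x :=
  mulI V

/-- The differential of the inverse of the preferred chart at `x`, at the point `y` of its target.
-/
def chartFrame (J : ModelWithCorners ℝ V' H) {N : Type*} [TopologicalSpace N] [ChartedSpace H N]
    (x : N) (y : V') : V' →L[ℝ] TangentSpace J ((extChartAt J x).symm y) :=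
  mfderiv 𝓘(ℝ, V') J (extChartAt J x).symm y

/-- A differential `n`-form with values in `F` on the manifold `N`. -/
abbrev Form (J : ModelWithCorners ℝ V' H) (N : Type*) [TopologicalSpace N] [ChartedSpace H N]
    (n : ℕ) (F : Type*) [NormedAddCommGroup F] [NormedSpace ℝ F] : Type _ :=
  (x : N) → TangentSpace J x [⋀^Fin n]→L[ℝ] F

/-- Exterior derivative on a manifold without boundary: at `x`, the exterior derivative of the
coordinate expression of the form in the preferred chart at `x` (the tangent space at `x`
is the model space through that chart). -/
def dForm {J : ModelWithCorners ℝ V' H} {N : Type*} [TopologicalSpace N] [ChartedSpace H N]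
    {n : ℕ} {F : Type*} [NormedAddCommGroup F] [NormedSpace ℝ F] (η : Form J N n F) :
    Form J N (n + 1) F := fun x =>
  (extDeriv (fun y : V' => (η ((extChartAt J x).symm y)).compContinuousLinearMap
    (chartFrame J x y)) (extChartAt J x x) : V' [⋀^Fin (n + 1)]→L[ℝ] F)

/-- A field of linear forms, seen as a differential `1`-form. -/
def oneForm {J : ModelWithCorners ℝ V' H} {N : Type*} [TopologicalSpace N] [ChartedSpace H N]
    {F : Type*} [NormedAddCommGroup F] [NormedSpace ℝ F]
    (α : (x : N) → TangentSpace J x →L[ℝ] F) : Form J N 1 F := fun x =>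
  ContinuousAlternatingMap.ofSubsingleton ℝ (TangentSpace J x) F (0 : Fin 1) (α x)

/-- The differential `du` of a real function, as a field of linear forms. -/
def dFun (J : ModelWithCorners ℝ V' H) {N : Type*} [TopologicalSpace N] [ChartedSpace H N]
    (u : N → ℝ) (x : N) : TangentSpace J x →L[ℝ] ℝ :=
  mfderiv J 𝓘(ℝ, ℝ) u x

/-- `d^c u = - du ∘ I`, so that `dd^c = 2 i ∂ ∂bar`. -/
def dcFun (J : ModelWithCorners ℝ V H) {N : Type*} [TopologicalSpace N] [ChartedSpace H N]
    (u : N → ℝ) (x : N) : TangentSpace J x →L[ℝ] ℝ :=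
  -(dFun J u x ∘L cxI J x)

/-- The real `2`-form `dd^c u`. -/
def ddc (J : ModelWithCorners ℝ V H) {N : Type*} [TopologicalSpace N] [ChartedSpace H N]
    (u : N → ℝ) : Form J N 2 ℝ :=
  dForm (oneForm (dcFun J u))

/-- Pull-back of a differential form by a map. -/
def pullForm (J : ModelWithCorners ℝ V H) (J' : ModelWithCorners ℝ V' H')
    {N : Type*} [TopologicalSpace N] [ChartedSpace H N]
    {N' : Type*} [TopologicalSpace N'] [ChartedSpace H' N'] {n : ℕ}
    {F : Type*} [NormedAddCommGroup F] [NormedSpace ℝ F]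
    (p : N → N') (η : Form J' N' n F) : Form J N n F := fun x =>
  (η (p x)).compContinuousLinearMap (mfderiv J J' p x)

/-- The alternation `(X, Y) ↦ (b(X, Y) - b(Y, X)) / 2` of a bilinear form, as a `2`-form. -/
def altBilin (b : V' →L[ℝ] V' →L[ℝ] ℝ) : V' [⋀^Fin 2]→L[ℝ] ℝ :=
  (1 / 2 : ℝ) • ContinuousAlternatingMap.alternatizeUncurryFin
    (((ContinuousAlternatingMap.ofSubsingletonLIE (𝕜 := ℝ) (E := V') (F := ℝ)
      (0 : Fin 1)).toContinuousLinearEquiv : (V' →L[ℝ] ℝ) →L[ℝ] (V' [⋀^Fin 1]→L[ℝ] ℝ)) ∘L b)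

theorem altBilin_apply (b : V' →L[ℝ] V' →L[ℝ] ℝ) (X Y : V') :
    altBilin b ![X, Y] = (b X Y - b Y X) / 2 := by
  simp [altBilin, ContinuousAlternatingMap.alternatizeUncurryFin_apply, Fin.sum_univ_two,
    Fin.removeNth]
  ring

end Forms

/-! ### Hermitian symmetric spaces -/

section Hermitian

variable {E : Type*} [NormedAddCommGroup E] [NormedSpace ℂ E]
  {M : Type*} [TopologicalSpace M] [ChartedSpace E M]

instance realManifold [IsManifold 𝓘(ℂ, E) ω M] : IsManifold 𝓘(ℝ, E) ∞ M := by
  apply isManifold_of_contDiffOn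
  intro e e' he he'
  have h := (contDiffGroupoid ω 𝓘(ℂ, E)).compatible he he'
  rw [contDiffGroupoid, mem_groupoid_of_pregroupoid] at h
  have h2 : ContDiffOn ℂ ω (𝓘(ℂ, E) ∘ (e.symm.trans e') ∘ 𝓘(ℂ, E).symm)
      (𝓘(ℂ, E).symm ⁻¹' (e.symm.trans e').source ∩ range 𝓘(ℂ, E)) := h.1
  exact (h2.restrict_scalars ℝ).of_le le_top

variable (E M) in
/-- A (smooth) Hermitian metric on a complex manifold, given as a Riemannian metric for which the
complex structure is orthogonal. -/
structure HermitianMetric [IsManifold 𝓘(ℂ, E) ω M] extends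
    ContMDiffRiemannianMetric 𝓘(ℝ, E) ∞ E (fun x : M => TangentSpace 𝓘(ℝ, E) x) where
  hermitian : ∀ (x : M) (X Y : TangentSpace 𝓘(ℝ, E) x),
    inner x (cxI 𝓘(ℝ, E) x X) (cxI 𝓘(ℝ, E) x Y) = inner x X Y

variable [IsManifold 𝓘(ℂ, E) ω M] (g : HermitianMetric E M)

namespace HermitianMetric

/-- The bilinear form `(X, Y) ↦ g (I X, Y)`. -/
def kahlerBilin (x : M) : TangentSpace 𝓘(ℝ, E) x →L[ℝ] TangentSpace 𝓘(ℝ, E) x →L[ℝ] ℝ :=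
  g.inner x ∘L cxI 𝓘(ℝ, E) x

/-- The Kähler form `ω (X, Y) = g (I X, Y)`. It is written as the alternation
`(g (I X, Y) - g (I Y, X)) / 2`; see `kahlerForm_apply`. -/
def kahlerForm : Form 𝓘(ℝ, E) M 2 ℝ := fun x =>
  altBilin (V' := E) (g.kahlerBilin x)

theorem kahlerForm_apply (x : M) (X Y : TangentSpace 𝓘(ℝ, E) x) :
    g.kahlerForm x ![X, Y] = g.inner x (cxI 𝓘(ℝ, E) x X) Y := by
  have hI : ∀ Z : TangentSpace 𝓘(ℝ, E) x,
      cxI 𝓘(ℝ, E) x (cxI 𝓘(ℝ, E) x Z) = -Z := fun Z => by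
    change Complex.I • Complex.I • (show E from Z) = -(show E from Z)
    rw [smul_smul, Complex.I_mul_I, neg_one_smul]
  have h : g.inner x (cxI 𝓘(ℝ, E) x Y) X = -g.inner x (cxI 𝓘(ℝ, E) x X) Y := by
    rw [← g.hermitian x (cxI 𝓘(ℝ, E) x Y) X, hI, g.symm]
    simp
  have h2 : g.kahlerForm x ![X, Y] =
      (g.inner x (cxI 𝓘(ℝ, E) x X) Y - g.inner x (cxI 𝓘(ℝ, E) x Y) X) / 2 :=
    altBilin_apply (V' := E) (g.kahlerBilin x) X Y
  rw [h2, h]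
  ring

/-- The matrix of the metric in the preferred chart at `x`, as a function on that chart. -/
def coeff (x : M) (y : E) : E →L[ℝ] E →L[ℝ] ℝ :=
  let G : E →L[ℝ] E →L[ℝ] ℝ := g.inner ((extChartAt 𝓘(ℝ, E) x).symm y)
  let A : E →L[ℝ] E := chartFrame 𝓘(ℝ, E) x y
  G.bilinearComp A A

/-- The Christoffel symbols of the Levi-Civita connection in the preferred chart at `x`:
`G (Γ(X) Y, Z) = (D_X G (Y, Z) + D_Y G (X, Z) - D_Z G (X, Y)) / 2`, where `G` is the metric. -/
def christoffel (x : M) (y : E) (X : E) : E →L[ℝ] E :=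
  (g.coeff x y).inverse ∘L ((1 / 2 : ℝ) • (fderiv ℝ (g.coeff x) y X +
    (fderiv ℝ (g.coeff x) y).flip X - ((fderiv ℝ (g.coeff x) y).flip X).flip))

/-- The Riemann curvature tensor of the Levi-Civita connection, with the sign convention
`R(X, Y) = ∇_[X,Y] - [∇_X, ∇_Y]` (so that `g (R(X, Y) X, Y)` is non-negative on a round sphere),
computed at `x` in the preferred chart at `x`. -/
def curvature (x : M) (X Y : TangentSpace 𝓘(ℝ, E) x) :
    TangentSpace 𝓘(ℝ, E) x →L[ℝ] TangentSpace 𝓘(ℝ, E) x :=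
  let c : E := extChartAt 𝓘(ℝ, E) x x
  let X' : E := X
  let Y' : E := Y
  (fderiv ℝ (fun y => g.christoffel x y X') c Y' - fderiv ℝ (fun y => g.christoffel x y Y') c X' +
    g.christoffel x c Y' ∘L g.christoffel x c X' - g.christoffel x c X' ∘L g.christoffel x c Y' :
    E →L[ℝ] E)

/-- Non-negative sectional curvature. -/
def NonnegCurvature : Prop :=
  ∀ (x : M) (X Y : TangentSpace 𝓘(ℝ, E) x), 0 ≤ g.inner x (g.curvature x X Y X) Y

/-- A Hermitian symmetric space: every point `p` is the isolated fixed point of an involutive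
holomorphic isometry, whose differential at `p` is `-1`. -/
structure IsHermitianSymmetric : Prop where
  exists_symmetry : ∀ p : M, ∃ s : M → M, Function.Involutive s ∧
    ContMDiff 𝓘(ℂ, E) 𝓘(ℂ, E) ω s ∧
    (∀ (q : M) (X Y : TangentSpace 𝓘(ℝ, E) q),
      g.inner (s q) (mfderiv 𝓘(ℝ, E) 𝓘(ℝ, E) s q X) (mfderiv 𝓘(ℝ, E) 𝓘(ℝ, E) s q Y) =
        g.inner q X Y) ∧
    s p = p ∧ (∀ᶠ q in 𝓝[≠] p, s q ≠ q) ∧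
    ∀ X : E, (mfderiv 𝓘(ℝ, E) 𝓘(ℝ, E) s p : E →L[ℝ] E) X = -X

end HermitianMetric

/-! ### The cotangent bundle -/

variable (E M) in
/-- The total space of the holomorphic cotangent bundle `T*M`. A real covector `α` is
identified with the complex linear functional `v` such that `α = Re v`. -/
abbrev Cotangent : Type _ :=
  TotalSpace (E →L[ℂ] ℂ) (fun x : M => TangentSpace 𝓘(ℂ, E) x →L[ℂ] Bundle.Trivial M ℂ x)

instance dualTower : IsScalarTower ℝ ℂ (E →L[ℂ] ℂ) :=
  ⟨fun a b f => by ext; simp [mul_assoc]⟩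

instance cotTower : IsScalarTower ℝ ℂ (E × (E →L[ℂ] ℂ)) := Prod.isScalarTower

variable (E) in
/-- The model of `T*M` as a complex manifold. -/
abbrev cotC : ModelWithCorners ℂ (E × (E →L[ℂ] ℂ)) (ModelProd E (E →L[ℂ] ℂ)) :=
  𝓘(ℂ, E).prod 𝓘(ℂ, E →L[ℂ] ℂ)

variable (E) in
/-- The model of `T*M` as a real manifold. -/
abbrev cotR : ModelWithCorners ℝ (E × (E →L[ℂ] ℂ)) (ModelProd E (E →L[ℂ] ℂ)) :=
  𝓘(ℝ, E).prod 𝓘(ℝ, E →L[ℂ] ℂ)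

/-- The projection `p : T*M → M`. -/
def proj (v : Cotangent E M) : M := v.1

/-- The action of the circle by scalar multiplication in the fibres: `v ↦ e^{iθ} v`. -/
def rotate (θ : ℝ) (v : Cotangent E M) : Cotangent E M :=
  ⟨v.1, Complex.exp (θ * Complex.I) • v.2⟩

/-- The vector field `X` on `T*M` generated by the circle action. -/
def circleField (v : Cotangent E M) : TangentSpace (cotR E) v :=
  (mfderiv 𝓘(ℝ, ℝ) (cotR E) (fun θ : ℝ => rotate θ v) 0 : ℝ →L[ℝ] E × (E →L[ℂ] ℂ)) 1

/-- The complex functional `v`, as a real linear map. -/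
def covector (v : Cotangent E M) : TangentSpace 𝓘(ℝ, E) (proj v) →L[ℝ] ℂ :=
  ((v.2 : E →L[ℂ] ℂ).restrictScalars ℝ : E →L[ℝ] ℂ)

/-- The tautological complex `1`-form `θ` of `T*M`: `θ_v(ξ) = v(dp ξ)`. -/
def tautForm : Form (cotR E) (Cotangent E M) 1 ℂ :=
  oneForm fun v => covector v ∘L mfderiv (cotR E) 𝓘(ℝ, E) (proj (E := E) (M := M)) v

/-- The canonical holomorphic symplectic form `-dθ = ∑ dz_j ∧ dw_j` of `T*M`. -/
def canonicalForm : Form (cotR E) (Cotangent E M) 2 ℂ := fun v => -dForm tautForm v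

/-! ### The Biquard-Gauduchon potential -/

/-- For an endomorphism `A` of a finite-dimensional real vector space that is diagonalizable
(e.g. self-adjoint for some scalar product), `φ(A)`, i.e. `p(A)` for the polynomial `p`
interpolating `φ` at the eigenvalues of `A`. -/
def funCalc {W : Type*} [AddCommGroup W] [Module ℝ W] (φ : ℝ → ℝ) (A : W →ₗ[ℝ] W) : W →ₗ[ℝ] W :=
  Polynomial.aeval A (Lagrange.interpolate (minpoly ℝ A).roots.toFinset id φ)

/-- `φ(A)` acts as `φ(l)` on the `l`-eigenspace. -/
theorem funCalc_apply {W : Type*} [AddCommGroup W] [Module ℝ W] [FiniteDimensional ℝ W]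
    (φ : ℝ → ℝ) (A : W →ₗ[ℝ] W) (l : ℝ) (w : W) (hw : A w = l • w) :
    funCalc φ A w = φ l • w := by
  by_cases h0 : w = 0
  · simp [h0]
  have hev : Module.End.HasEigenvector A l w :=
    ⟨Module.End.mem_eigenspace_iff.2 hw, h0⟩
  have hroot : l ∈ (minpoly ℝ A).roots.toFinset := by
    rw [Multiset.mem_toFinset,
      Polynomial.mem_roots (minpoly.ne_zero (Algebra.IsIntegral.isIntegral A))]
    exact Module.End.isRoot_of_hasEigenvalue (Module.End.hasEigenvalue_of_hasEigenvector hev)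
  rw [funCalc, Module.End.aeval_apply_of_hasEigenvector hev,
    show l = id l from rfl, Lagrange.eval_interpolate_at_node φ (Function.injective_id.injOn) hroot]
  rfl

namespace HermitianMetric

/-- The tangent vector metrically dual to the real covector `Re v`. -/
def sharp (v : Cotangent E M) : TangentSpace 𝓘(ℝ, E) (proj v) :=
  (g.inner (proj v)).inverse (Complex.reCLM ∘L covector v)

/-- The endomorphism `I R(I v, v)`, for a cotangent vector `v` (identified with a tangent vector
by the metric). -/
def curvOp (v : Cotangent E M) :
    TangentSpace 𝓘(ℝ, E) (proj v) →L[ℝ] TangentSpace 𝓘(ℝ, E) (proj v) :=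
  cxI 𝓘(ℝ, E) (proj v) ∘L
    g.curvature (proj v) (cxI 𝓘(ℝ, E) (proj v) (g.sharp v)) (g.sharp v)

/-- The function `v ↦ (φ(I R(I v, v)) v, v)` on `T*M`. -/
def quad (φ : ℝ → ℝ) (v : Cotangent E M) : ℝ :=
  g.inner (proj v) (funCalc φ (g.curvOp v).toLinearMap (g.sharp v)) (g.sharp v)

end HermitianMetric

/-- The function `f(u) = (√(1+u) - 1 - log ((1+√(1+u))/2)) / u`, extended analytically by
`f(0) = 1/4`. -/
def bgF (u : ℝ) : ℝ :=
  if u = 0 then 1 / 4 else 1 / u * (√(1 + u) - 1 - Real.log ((1 + √(1 + u)) / 2))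

/-- The function `g(u) = - log ((1+√(1+u))/2) / u`, extended analytically by `g(0) = -1/4`. -/
def bgG (u : ℝ) : ℝ :=
  if u = 0 then -1 / 4 else -(1 / u) * Real.log ((1 + √(1 + u)) / 2)

namespace HermitianMetric

/-- The potential `h(v) = (f(I R(I v, v)) v, v)`. -/
def potential : Cotangent E M → ℝ := g.quad bgF

/-- The Kähler form `ω₁ = p^*ω + dd^c h` of the Biquard-Gauduchon metric. -/
def bgForm : Form (cotR E) (Cotangent E M) 2 ℝ := fun v =>
  pullForm (cotR E) 𝓘(ℝ, E) proj g.kahlerForm v + ddc (cotR E) g.potential v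

/-- The function `μ(v) = -2 ((u f(u))' v, v)`, `u = I R(I v, v)`. -/
def mu (v : Cotangent E M) : ℝ := -2 * g.quad (deriv fun u => u * bgF u) v

/-- The function `k(v) = (g(I R(I v, v)) v, v)`. -/
def hypPotential : Cotangent E M → ℝ := g.quad bgG

/-- The explicit `2`-form `p^*ω + dd^c k`. -/
def explicitCurvature : Form (cotR E) (Cotangent E M) 2 ℝ := fun v =>
  pullForm (cotR E) 𝓘(ℝ, E) proj g.kahlerForm v + ddc (cotR E) g.hypPotential v

/-- `μ` is a moment map, `i_X ω₁ = dμ`, for the circle action on `(T*M, ω₁)`. -/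
structure IsMomentMap (μ : Cotangent E M → ℝ) : Prop where
  smooth : ContMDiff (cotR E) 𝓘(ℝ, ℝ) ∞ μ
  contract : ∀ (v : Cotangent E M) (ξ : TangentSpace (cotR E) v),
    g.bgForm v ![circleField v, ξ] = dFun (cotR E) μ v ξ

/-- A hyperkähler structure on `T*M` whose first complex structure is the given one `I`, whose
first Kähler form is `ω₁` and for which `ω₂ + i ω₃` is the canonical symplectic form: an
almost complex structure `J` anticommuting with `I` such that, with `K = I J` and
`G(ξ, ζ) = ω₁(ξ, I ζ)`, `G` is a metric for which `I, J, K` are orthogonal, and the Kähler forms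
`G(I ξ, ζ), G(J ξ, ζ), G(K ξ, ζ)` are `ω₁, ω₂, ω₃`. (As the three forms are closed,
`J` and `K` are integrable and `G` is hyperkähler.) -/
structure IsHyperkahler
    (J : (v : Cotangent E M) → TangentSpace (cotR E) v →L[ℝ] TangentSpace (cotR E) v) : Prop where
  sq : ∀ v ξ, J v (J v ξ) = -ξ
  anticomm : ∀ v ξ, J v (cxI (cotR E) v ξ) = -cxI (cotR E) v (J v ξ)
  symm : ∀ v (ξ ζ : TangentSpace (cotR E) v),
    g.bgForm v ![ξ, cxI (cotR E) v ζ] = g.bgForm v ![ζ, cxI (cotR E) v ξ]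
  pos : ∀ v (ξ : TangentSpace (cotR E) v), ξ ≠ 0 → 0 < g.bgForm v ![ξ, cxI (cotR E) v ξ]
  orthogonal_I : ∀ v (ξ ζ : TangentSpace (cotR E) v),
    g.bgForm v ![cxI (cotR E) v ξ, cxI (cotR E) v ζ] = g.bgForm v ![ξ, ζ]
  orthogonal_J : ∀ v (ξ ζ : TangentSpace (cotR E) v),
    g.bgForm v ![J v ξ, cxI (cotR E) v (J v ζ)] = g.bgForm v ![ξ, cxI (cotR E) v ζ]
  omega_two : ∀ v (ξ ζ : TangentSpace (cotR E) v),
    (canonicalForm v ![ξ, ζ]).re = g.bgForm v ![J v ξ, cxI (cotR E) v ζ]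
  omega_three : ∀ v (ξ ζ : TangentSpace (cotR E) v),
    (canonicalForm v ![ξ, ζ]).im = g.bgForm v ![cxI (cotR E) v (J v ξ), cxI (cotR E) v ζ]
  closed_one : ∀ v, dForm g.bgForm v = 0
  closed_two_three : ∀ v, dForm (canonicalForm (E := E) (M := M)) v = 0

end HermitianMetric

/-- A real `2`-form `F` on `T*M` is of type `(1,1)` for the almost complex structure `J`. -/
def IsType11 (J : (v : Cotangent E M) → TangentSpace (cotR E) v →L[ℝ] TangentSpace (cotR E) v)
    (F : Form (cotR E) (Cotangent E M) 2 ℝ) : Prop :=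
  ∀ v (ξ ζ : TangentSpace (cotR E) v), F v ![J v ξ, J v ζ] = F v ![ξ, ζ]

/-! ### Holomorphic line bundles on `T*M` -/

section LineBundle

variable (L : Cotangent E M → Type*)
  [∀ v, AddCommGroup (L v)] [∀ v, Module ℂ (L v)] [∀ v, TopologicalSpace (L v)]
  [TopologicalSpace (TotalSpace ℂ L)] [FiberBundle ℂ L]

/-- A smooth Hermitian metric on a line bundle over `T*M`, given by the function `‖e‖²`. -/
structure LineMetric where
  normSq : (v : Cotangent E M) → L v → ℝ
  normSq_smul : ∀ v (c : ℂ) (e : L v), normSq v (c • e) = ‖c‖ ^ 2 * normSq v e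
  normSq_pos : ∀ v (e : L v), e ≠ 0 → 0 < normSq v e
  smooth : ContMDiff ((cotR E).prod 𝓘(ℝ, ℂ)) 𝓘(ℝ, ℝ) ∞
    (fun e : TotalSpace ℂ L => normSq e.1 e.2)

variable {L}

/-- The metric `e^{2 μ} ‖e‖²`. -/
def LineMetric.rescale (m : LineMetric L) (μ : Cotangent E M → ℝ)
    (hμ : ContMDiff (cotR E) 𝓘(ℝ, ℝ) ∞ μ) : LineMetric L where
  normSq v e := Real.exp (2 * μ v) * m.normSq v e
  normSq_smul v c e := by rw [m.normSq_smul]; ring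
  normSq_pos v e he := mul_pos (Real.exp_pos _) (m.normSq_pos v e he)
  smooth := by
    have h1 : ContMDiff ((cotR E).prod 𝓘(ℝ, ℂ)) 𝓘(ℝ, ℝ) ∞
        (fun e : TotalSpace ℂ L => μ e.1) := hμ.comp (contMDiff_proj L)
    have h2 : ContDiff ℝ ∞ fun t : ℝ => Real.exp (2 * t) :=
      Real.contDiff_exp.comp (contDiff_const.mul contDiff_id)
    exact (h2.contMDiff.comp h1).mul m.smooth

/-- The Hermitian connection of a Hermitian holomorphic line bundle has curvature `F`:
`F = dd^c log ‖s‖² / 2` for every non-vanishing holomorphic local section `s`. -/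
def LineMetric.HasCurvature (m : LineMetric L) (F : Form (cotR E) (Cotangent E M) 2 ℝ) : Prop :=
  ∀ (U : Set (Cotangent E M)) (s : (v : Cotangent E M) → L v), IsOpen U →
    ContMDiffOn (cotC E) ((cotC E).prod 𝓘(ℂ, ℂ)) ω (fun v => TotalSpace.mk' ℂ v (s v)) U →
    (∀ v ∈ U, s v ≠ 0) →
    ∀ v ∈ U, F v = (1 / 2 : ℝ) • ddc (cotR E) (fun y => Real.log (m.normSq y (s y))) v

end LineBundle

end Hermitian

end HyperHol

end

open HyperHol

noncomputable section

set_option maxSynthPendingDepth 3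
set_option synthInstance.maxHeartbeats 100000

namespace HyperHol


/-! ### Riemannian geometry on an open subset of a vector space -/

/-! Geometry of `u = I R(I v, v)`. Let `σ` be the symmetry at a point, read in a holomorphic chart.
It is a holomorphic isometry with differential `-1` there, so the transformation law of the
Christoffel symbols gives `D²σ = -2Γ`. Hence `Γ` is complex bilinear and the metric is Kähler
(`IsHermitianSymmetric.christoffel_mulI`). The curvature then commutes with `I`, and the Bianchi
identity writes `(u X, X)` as a sum of two terms `(R(Z,Y)Z, Y)`, which are non-negative
(`IsKahlerOn.curvOp_isNonneg`).

Spectral functions. Decompose the vector dual to `v` into orthogonal eigenvectors of `u`. Then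
`(φ(u)v, v) = ∑ φ(lᵢ) aᵢ`, with the same `lᵢ ≥ 0` and `aᵢ` for every `φ`. Scaling `v` by a real `t`
scales `u` by `t²`, and rotating `v` leaves `u` unchanged, so relations between `h`, `μ`, `k` reduce
to calculus in one variable. The derivative of `t² f(t² l)` at `1` is `2 (u f)'(l)`, so the radial
derivative of `h` is `-μ`. The identity `f - 2 (u f)' = g` on `u ≥ 0` says `h + μ = k`. For
smoothness, `f` and `g` extend holomorphically to `re z > -1`, and a power series centred at `c =
‖u‖` (operator norm for the metric) converges on a neighbourhood of `u`.

Moment map. The generator `X` is `I` times the Euler field. It is vertical, so it kills `p^*ω`. As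
`h` is invariant, contracting `dd^c h` with `X` gives minus the differential of the radial
derivative of `h`, that is `dμ` (`ddc_circleVec`). Two moment maps have the same differential, hence
the same `dd^c`.

Hyperholomorphy. Put `γ = Im θ`, so that `dγ = -ω₃` and `i_X ω₂ = γ`. Then `dμ(Iζ) = ω₁(X, Iζ) =
ω₂(X, Jζ) = γ(Jζ)`, so `d^c μ = -γ ∘ J` and `F = ω₁ - d(γ ∘ J)`. Invariance under `J` is a
computation at one point (`sub_fderiv_comp_invariant`). It uses `dω₁ = 0`, `J² = -1`, and that
`ω₁(J·,·) = ω₃` is constant in canonical coordinates. Invariance under `I` is automatic, and `K = I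
J`.

Curvature and exterior derivative are defined at each point through the chart preferred by that
point; naturality under isometries and pull-backs brings them to one fixed chart. -/

section Local

variable {E : Type*} [NormedAddCommGroup E] [NormedSpace ℝ E]

/-- The Christoffel symbols of a metric `G` on an open subset of `E`, as a bilinear map. -/
def localChristoffel (G : E → E →L[ℝ] E →L[ℝ] ℝ) (y : E) : E →L[ℝ] E →L[ℝ] E :=
  (ContinuousLinearMap.compL ℝ E (E →L[ℝ] ℝ) E (G y).inverse) ∘L
    ((1 / 2 : ℝ) • (fderiv ℝ G y + (fderiv ℝ G y).flip -
      ((ContinuousLinearMap.flipₗᵢ ℝ E E ℝ).toContinuousLinearEquiv :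
        (E →L[ℝ] E →L[ℝ] ℝ) →L[ℝ] E →L[ℝ] E →L[ℝ] ℝ) ∘L (fderiv ℝ G y).flip))

/-- The curvature `∇_[X,Y] - [∇_X, ∇_Y]` of a metric `G` on an open subset of `E`. -/
def localCurvature (G : E → E →L[ℝ] E →L[ℝ] ℝ) (y X Y : E) : E →L[ℝ] E :=
  fderiv ℝ (localChristoffel G) y Y X - fderiv ℝ (localChristoffel G) y X Y +
    localChristoffel G y Y ∘L localChristoffel G y X -
    localChristoffel G y X ∘L localChristoffel G y Y

/-- `G` is a smooth Riemannian metric on the open set `U`. -/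
structure IsMetricOn (G : E → E →L[ℝ] E →L[ℝ] ℝ) (U : Set E) : Prop where
  isOpen : IsOpen U
  contDiffOn : ContDiffOn ℝ ∞ G U
  symm : ∀ y ∈ U, ∀ X Y, G y X Y = G y Y X
  pos : ∀ y ∈ U, ∀ X, X ≠ 0 → 0 < G y X X

/-- `ψ` is a smooth local isometry from `U` to `U'`. -/
structure IsIsometryOn (G G' : E → E →L[ℝ] E →L[ℝ] ℝ) (U U' : Set E) (ψ : E → E) : Prop where
  contDiffOn : ContDiffOn ℝ ∞ ψ U
  mapsTo : MapsTo ψ U U'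
  surjective : ∀ y ∈ U, Function.Surjective (fderiv ℝ ψ y)
  map_metric : ∀ y ∈ U, ∀ X Y, G' (ψ y) (fderiv ℝ ψ y X) (fderiv ℝ ψ y Y) = G y X Y

theorem minSmoothness_two_le_infty : minSmoothness ℝ 2 ≤ ∞ := by
  rw [minSmoothness_of_isRCLikeNormedField]
  exact WithTop.coe_le_coe.2 le_top

theorem fderiv_clm_apply_const {W F : Type*} [NormedAddCommGroup W] [NormedSpace ℝ W]
    [NormedAddCommGroup F] [NormedSpace ℝ F] {A : E → W →L[ℝ] F} {y : E}
    (hA : DifferentiableAt ℝ A y) (w : W) (X : E) :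
    fderiv ℝ (fun z => A z w) y X = fderiv ℝ A y X w := by
  have h := hA.hasFDerivAt.clm_apply (hasFDerivAt_const w y)
  rw [h.fderiv]
  simp

/-- A complex structure that commutes with a family of operators commutes with its derivative. -/
theorem fderiv_commute {F F' : Type*} [NormedAddCommGroup F] [NormedSpace ℝ F]
    [NormedAddCommGroup F'] [NormedSpace ℝ F'] {A : E → F →L[ℝ] F'} {y : E}
    (hA : DifferentiableAt ℝ A y) (I : F →L[ℝ] F) (I' : F' →L[ℝ] F')
    (h : ∀ᶠ z in 𝓝 y, ∀ w, A z (I w) = I' (A z w)) (X : E) (w : F) :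
    fderiv ℝ A y X (I w) = I' (fderiv ℝ A y X w) := by
  rw [← fderiv_clm_apply_const hA, ← fderiv_clm_apply_const hA]
  have h1 : (fun z => A z (I w)) =ᶠ[𝓝 y] fun z => I' (A z w) := h.mono fun z hz => hz w
  rw [h1.fderiv_eq]
  have h2 : DifferentiableAt ℝ (fun z => A z w) y := hA.clm_apply (differentiableAt_const w)
  have := (I'.hasFDerivAt.comp y h2.hasFDerivAt)
  rw [show (fun z => I' (A z w)) = I' ∘ fun z => A z w from rfl, this.fderiv]
  rfl

/-! ### Levi-Civita connection and symmetries of the curvature tensor -/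

section Metric

variable {G : E → E →L[ℝ] E →L[ℝ] ℝ} {U : Set E} {y : E}

theorem IsMetricOn.contDiffAt (hG : IsMetricOn G U) (hy : y ∈ U) : ContDiffAt ℝ ∞ G y :=
  hG.contDiffOn.contDiffAt (hG.isOpen.mem_nhds hy)

theorem IsMetricOn.differentiableAt (hG : IsMetricOn G U) (hy : y ∈ U) :
    DifferentiableAt ℝ G y :=
  (hG.contDiffAt hy).differentiableAt (by simp)

theorem contDiffAt_fderiv_infty {F : Type*} [NormedAddCommGroup F] [NormedSpace ℝ F] {f : E → F}
    (hf : ContDiffAt ℝ ∞ f y) : ContDiffAt ℝ ∞ (fderiv ℝ f) y :=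
  hf.fderiv_right (m := ∞) (by simp)

variable [FiniteDimensional ℝ E]

theorem isInvertible_of_pos {B : E →L[ℝ] E →L[ℝ] ℝ} (hB : ∀ X, X ≠ 0 → 0 < B X X) :
    B.IsInvertible := by
  have hinj : Function.Injective B := by
    rw [injective_iff_map_eq_zero]
    intro X hX
    by_contra hne
    have := hB X hne
    simp [hX] at this
  have hfr : Module.finrank ℝ E = Module.finrank ℝ (E →L[ℝ] ℝ) := by
    rw [← LinearEquiv.finrank_eq (LinearMap.toContinuousLinearMap (𝕜 := ℝ) (E := E) (F' := ℝ))]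
    exact (Subspace.dual_finrank_eq (K := ℝ) (V := E)).symm
  have : FiniteDimensional ℝ (E →L[ℝ] ℝ) := inferInstance
  refine ⟨(LinearEquiv.ofInjectiveOfFinrankEq B.toLinearMap hinj hfr).toContinuousLinearEquiv, ?_⟩
  ext X Y
  rfl

theorem apply_inverse_of_pos {B : E →L[ℝ] E →L[ℝ] ℝ} (hB : ∀ X, X ≠ 0 → 0 < B X X)
    (α : E →L[ℝ] ℝ) : B (B.inverse α) = α := by
  obtain ⟨e, rfl⟩ := isInvertible_of_pos hB
  simp

theorem inverse_apply_of_pos {B : E →L[ℝ] E →L[ℝ] ℝ} (hB : ∀ X, X ≠ 0 → 0 < B X X)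
    (X : E) : B.inverse (B X) = X := by
  obtain ⟨e, rfl⟩ := isInvertible_of_pos hB
  simp

theorem eq_of_forall_apply_eq {B : E →L[ℝ] E →L[ℝ] ℝ} (hB : ∀ X, X ≠ 0 → 0 < B X X)
    {X Y : E} (h : ∀ Z, B X Z = B Y Z) : X = Y := by
  have : B X = B Y := by ext Z; exact h Z
  rw [← inverse_apply_of_pos hB X, this, inverse_apply_of_pos hB]

theorem contDiffAt_clm_inverse {F F' : Type*} [NormedAddCommGroup F] [NormedSpace ℝ F]
    [CompleteSpace F] [NormedAddCommGroup F'] [NormedSpace ℝ F'] {W : Type*}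
    [NormedAddCommGroup W] [NormedSpace ℝ W] {A : W → F →L[ℝ] F'} {x : W}
    (hA : ContDiffAt ℝ ∞ A x) (hi : (A x).IsInvertible) :
    ContDiffAt ℝ ∞ (fun z => (A z).inverse) x := by
  obtain ⟨e, he⟩ := hi
  have h := contDiffAt_map_inverse (𝕜 := ℝ) (n := ∞) e
  rw [he] at h
  exact h.comp x hA

namespace IsMetricOn

variable (hG : IsMetricOn G U) (hy : y ∈ U)
include hG hy

/-- The Koszul formula. It turns every identity for the Christoffel symbols into one for the first
derivatives of the metric. -/
theorem apply_christoffel (X Y Z : E) :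
    G y (localChristoffel G y X Y) Z =
      (fderiv ℝ G y X Y Z + fderiv ℝ G y Y X Z - fderiv ℝ G y Z X Y) / 2 := by
  have h := apply_inverse_of_pos (hG.pos y hy)
  simp only [localChristoffel, ContinuousLinearMap.comp_apply, ContinuousLinearMap.compL_apply, h]
  simp
  ring

omit [FiniteDimensional ℝ E] in
theorem fderiv_symm (X Y Z : E) : fderiv ℝ G y X Y Z = fderiv ℝ G y X Z Y := by
  have hd := hG.differentiableAt hy
  have h1 : DifferentiableAt ℝ (fun z => G z Y) y := hd.clm_apply (differentiableAt_const _)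
  have h2 : DifferentiableAt ℝ (fun z => G z Z) y := hd.clm_apply (differentiableAt_const _)
  rw [← fderiv_clm_apply_const hd, ← fderiv_clm_apply_const h1,
    ← fderiv_clm_apply_const hd, ← fderiv_clm_apply_const h2]
  have : (fun z => G z Y Z) =ᶠ[𝓝 y] fun z => G z Z Y :=
    Filter.mem_of_superset (hG.isOpen.mem_nhds hy) fun z hz => hG.symm z hz Y Z
  rw [this.fderiv_eq]

theorem christoffel_symm (X Y : E) :
    localChristoffel G y X Y = localChristoffel G y Y X := by
  refine eq_of_forall_apply_eq (hG.pos y hy) fun Z => ?_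
  rw [hG.apply_christoffel hy, hG.apply_christoffel hy, hG.fderiv_symm hy Z X Y]
  ring

/-- The metric is parallel: in the sum of two Koszul formulas with `Y`, `Z` exchanged, only the
`X`-derivative survives. -/
theorem fderiv_eq_christoffel (X Y Z : E) :
    fderiv ℝ G y X Y Z =
      G y (localChristoffel G y X Y) Z + G y Y (localChristoffel G y X Z) := by
  rw [hG.symm y hy Y, hG.apply_christoffel hy, hG.apply_christoffel hy,
    hG.fderiv_symm hy X Z Y]
  ring

theorem contDiffAt_christoffel : ContDiffAt ℝ ∞ (localChristoffel G) y := by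
  have h1 : ContDiffAt ℝ ∞ (fun z => (G z).inverse) y :=
    contDiffAt_clm_inverse (hG.contDiffAt hy) (isInvertible_of_pos (hG.pos y hy))
  have h2 : ContDiffAt ℝ ∞ (fderiv ℝ G) y := contDiffAt_fderiv_infty (hG.contDiffAt hy)
  have h3 : ContDiffAt ℝ ∞ (fun z => (fderiv ℝ G z).flip) y :=
    (ContinuousLinearMap.flipₗᵢ ℝ E E (E →L[ℝ] ℝ)).toContinuousLinearEquiv.contDiff.contDiffAt.comp
      y h2
  have h4 : ContDiffAt ℝ ∞ (fun z =>
      (ContinuousLinearMap.compL ℝ E (E →L[ℝ] ℝ) E (G z).inverse)) y :=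
    (ContinuousLinearMap.compL ℝ E (E →L[ℝ] ℝ) E).contDiff.contDiffAt.comp y h1
  exact h4.clm_comp (((h2.add h3).sub (contDiffAt_const.clm_comp h3)).const_smul _)

theorem differentiableAt_christoffel : DifferentiableAt ℝ (localChristoffel G) y :=
  (hG.contDiffAt_christoffel hy).differentiableAt (by simp)

theorem contDiffAt_curvature :
    ContDiffAt ℝ ∞ (fun z => fderiv ℝ (localChristoffel G) z) y :=
  contDiffAt_fderiv_infty (hG.contDiffAt_christoffel hy)

theorem fderiv_christoffel_symm (W X Y : E) :
    fderiv ℝ (localChristoffel G) y W X Y = fderiv ℝ (localChristoffel G) y W Y X := by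
  have hd := hG.differentiableAt_christoffel hy
  have h1 (Y) : DifferentiableAt ℝ (fun z => localChristoffel G z Y) y :=
    hd.clm_apply (differentiableAt_const _)
  rw [← fderiv_clm_apply_const hd, ← fderiv_clm_apply_const (h1 X),
    ← fderiv_clm_apply_const hd, ← fderiv_clm_apply_const (h1 Y)]
  have : (fun z => localChristoffel G z X Y) =ᶠ[𝓝 y] fun z => localChristoffel G z Y X :=
    Filter.mem_of_superset (hG.isOpen.mem_nhds hy) fun z hz => hG.christoffel_symm hz X Y
  rw [this.fderiv_eq]

/-- Absence of torsion: `Γ` and its derivative are symmetric in their two vector arguments, so the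
cyclic sum cancels in pairs. -/
theorem curvature_bianchi (X Y Z : E) :
    localCurvature G y X Y Z + localCurvature G y Y Z X + localCurvature G y Z X Y = 0 := by
  simp only [localCurvature, sub_apply, add_apply,
    ContinuousLinearMap.comp_apply]
  rw [hG.fderiv_christoffel_symm hy Y X Z, hG.fderiv_christoffel_symm hy Z Y X,
    hG.fderiv_christoffel_symm hy X Z Y, hG.christoffel_symm hy X Z, hG.christoffel_symm hy Y Z,
    hG.christoffel_symm hy X Y]
  abel

/-- Differentiate once more the statement that the metric is parallel, and antisymmetrise in `X`,
`Y`: the second derivatives of `G` drop out because they commute. -/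
theorem curvature_skew (X Y Z W : E) :
    G y (localCurvature G y X Y Z) W = -G y Z (localCurvature G y X Y W) := by
  have hGd := (hG.differentiableAt hy).hasFDerivAt
  have hΓ := (hG.differentiableAt_christoffel hy).hasFDerivAt
  have hD : DifferentiableAt ℝ (fderiv ℝ G) y :=
    (contDiffAt_fderiv_infty (hG.contDiffAt hy)).differentiableAt (by simp)
  have key : ∀ X Y : E, fderiv ℝ (fderiv ℝ G) y Y X Z W =
      fderiv ℝ G y Y (localChristoffel G y X Z) W +
      G y (fderiv ℝ (localChristoffel G) y Y X Z) W +
      (fderiv ℝ G y Y Z (localChristoffel G y X W) +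
      G y Z (fderiv ℝ (localChristoffel G) y Y X W)) := by
    intro X Y
    have h1 : HasFDerivAt (fun z => fderiv ℝ G z X Z W) _ y :=
      ((hD.hasFDerivAt.clm_apply (hasFDerivAt_const X y)).clm_apply
        (hasFDerivAt_const Z y)).clm_apply (hasFDerivAt_const W y)
    have h2 : HasFDerivAt (fun z => G z (localChristoffel G z X Z) W +
        G z Z (localChristoffel G z X W)) _ y :=
      ((hGd.clm_apply ((hΓ.clm_apply (hasFDerivAt_const X y)).clm_apply
        (hasFDerivAt_const Z y))).clm_apply (hasFDerivAt_const W y)).add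
      ((hGd.clm_apply (hasFDerivAt_const Z y)).clm_apply
        ((hΓ.clm_apply (hasFDerivAt_const X y)).clm_apply (hasFDerivAt_const W y)))
    have h3 : (fun z => fderiv ℝ G z X Z W) =ᶠ[𝓝 y] fun z =>
        G z (localChristoffel G z X Z) W + G z Z (localChristoffel G z X W) :=
      Filter.mem_of_superset (hG.isOpen.mem_nhds hy) fun z hz => hG.fderiv_eq_christoffel hz X Z W
    have h4 := congrArg (fun A : E →L[ℝ] ℝ => A Y) (h1.unique (h2.congr_of_eventuallyEq h3))
    simp at h4
    linarith
  have hs : fderiv ℝ (fderiv ℝ G) y Y X = fderiv ℝ (fderiv ℝ G) y X Y :=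
    ((hG.contDiffAt hy).isSymmSndFDerivAt minSmoothness_two_le_infty).eq Y X
  have k1 := key X Y
  have k2 := key Y X
  rw [hs] at k1
  rw [hG.fderiv_eq_christoffel hy, hG.fderiv_eq_christoffel hy] at k1 k2
  simp only [localCurvature, sub_apply, add_apply,
    ContinuousLinearMap.comp_apply, map_sub, map_add]
  linarith

omit [FiniteDimensional ℝ E] hG hy in
theorem curvature_antisymm (X Y Z : E) :
    localCurvature G y X Y Z = -localCurvature G y Y X Z := by
  simp only [localCurvature, sub_apply, add_apply,
    ContinuousLinearMap.comp_apply]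
  abel

/-- The classical octahedron argument: four Bianchi identities combined with the two skew
symmetries. -/
theorem curvature_pair_symm (X Y Z W : E) :
    G y (localCurvature G y X Y Z) W = G y (localCurvature G y Z W X) Y := by
  have b (X Y Z W : E) : G y (localCurvature G y X Y Z) W + G y (localCurvature G y Y Z X) W +
      G y (localCurvature G y Z X Y) W = 0 := by
    have := congrArg (fun V => G y V W) (hG.curvature_bianchi hy X Y Z)
    simpa using this
  have s (X Y Z W : E) : G y (localCurvature G y X Y Z) W = -G y (localCurvature G y X Y W) Z := by
    rw [hG.curvature_skew hy, hG.symm y hy]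
  have a (X Y Z W : E) : G y (localCurvature G y X Y Z) W = -G y (localCurvature G y Y X Z) W := by
    rw [curvature_antisymm]
    simp
  have b1 := b X Y Z W
  have b2 := b Y Z W X
  have b3 := b Z W X Y
  have b4 := b W X Y Z
  linarith [s X Y Z W, s Y Z X W, s Z X Y W, s Y Z W X, s Z W Y X, s W Y Z X, s Z W X Y,
    s W X Z Y, s X Z W Y, s W X Y Z, s X Y W Z, s Y W X Z, a X Y Z W, a Z X Y W, a X Z Y W,
    a W Y Z X, a Y W Z X, a X Z W Y, a Y W X Z, a W Y X Z, a Z X W Y]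

end IsMetricOn

end Metric

/-! ### Naturality of the connection and of the curvature under local isometries -/

section Isometry

variable {G G' : E → E →L[ℝ] E →L[ℝ] ℝ} {U U' : Set E} {ψ : E → E} {y : E}
  [FiniteDimensional ℝ E]

namespace IsIsometryOn

variable (hψ : IsIsometryOn G G' U U' ψ) (hG : IsMetricOn G U) (hG' : IsMetricOn G' U') (hy : y ∈ U)
include hψ hG hG' hy

/-- Differentiate the isometry relation and form the Koszul combination; symmetry of `D²ψ` leaves a
single second-order term. Surjectivity of `dψ` makes vectors `dψ Z` sufficient for testing. -/
theorem map_christoffel (X Y : E) :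
    fderiv ℝ ψ y (localChristoffel G y X Y) =
      localChristoffel G' (ψ y) (fderiv ℝ ψ y X) (fderiv ℝ ψ y Y) +
        fderiv ℝ (fderiv ℝ ψ) y X Y := by
  have hU := hG.isOpen.mem_nhds hy
  have hψc := hψ.contDiffOn.contDiffAt hU
  have hψ1 : HasFDerivAt ψ _ y := (hψc.differentiableAt (by simp)).hasFDerivAt
  have hψ2 : HasFDerivAt (fderiv ℝ ψ) _ y :=
    ((contDiffAt_fderiv_infty hψc).differentiableAt (by simp)).hasFDerivAt
  have hy' := hψ.mapsTo hy
  have hGd' := ((hG'.differentiableAt hy').hasFDerivAt).comp y hψ1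
  have hs (X Y : E) : fderiv ℝ (fderiv ℝ ψ) y Y X = fderiv ℝ (fderiv ℝ ψ) y X Y :=
    (hψc.isSymmSndFDerivAt minSmoothness_two_le_infty).eq Y X
  have key : ∀ X Y Z : E, fderiv ℝ G y X Y Z =
      fderiv ℝ G' (ψ y) (fderiv ℝ ψ y X) (fderiv ℝ ψ y Y) (fderiv ℝ ψ y Z) +
      G' (ψ y) (fderiv ℝ (fderiv ℝ ψ) y X Y) (fderiv ℝ ψ y Z) +
      G' (ψ y) (fderiv ℝ ψ y Y) (fderiv ℝ (fderiv ℝ ψ) y X Z) := by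
    intro X Y Z
    have h1 : HasFDerivAt (fun z => G z Y Z) _ y :=
      (((hG.differentiableAt hy).hasFDerivAt).clm_apply (hasFDerivAt_const Y y)).clm_apply
        (hasFDerivAt_const Z y)
    have h2 : HasFDerivAt (fun z => G' (ψ z) (fderiv ℝ ψ z Y) (fderiv ℝ ψ z Z)) _ y :=
      (hGd'.clm_apply (hψ2.clm_apply (hasFDerivAt_const Y y))).clm_apply
        (hψ2.clm_apply (hasFDerivAt_const Z y))
    have h3 : (fun z => G z Y Z) =ᶠ[𝓝 y] fun z => G' (ψ z) (fderiv ℝ ψ z Y) (fderiv ℝ ψ z Z) :=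
      Filter.mem_of_superset hU fun z hz => (hψ.map_metric z hz Y Z).symm
    have h4 := congrArg (fun A : E →L[ℝ] ℝ => A X) (h1.unique (h2.congr_of_eventuallyEq h3))
    simp at h4
    linarith
  refine eq_of_forall_apply_eq (hG'.pos _ hy') fun Z' => ?_
  obtain ⟨Z, rfl⟩ := hψ.surjective y hy Z'
  rw [hψ.map_metric y hy, hG.apply_christoffel hy, map_add, add_apply,
    hG'.apply_christoffel hy', key, key, key, hs X Y, hs X Z, hs Y Z,
    hG'.symm _ hy' (fderiv ℝ ψ y X) (fderiv ℝ (fderiv ℝ ψ) y Y Z),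
    hG'.symm _ hy' (fderiv ℝ ψ y Y) (fderiv ℝ (fderiv ℝ ψ) y X Z)]
  ring

/-- The derivative of `map_christoffel`, antisymmetrised in `X`, `Y`: the third derivatives of `ψ`
cancel by symmetry, and the second derivatives are absorbed by the quadratic terms. -/
theorem map_curvature (X Y Z : E) :
    fderiv ℝ ψ y (localCurvature G y X Y Z) =
      localCurvature G' (ψ y) (fderiv ℝ ψ y X) (fderiv ℝ ψ y Y) (fderiv ℝ ψ y Z) := by
  have hU := hG.isOpen.mem_nhds hy
  have hψc := hψ.contDiffOn.contDiffAt hU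
  have hψ1 : HasFDerivAt ψ _ y := (hψc.differentiableAt (by simp)).hasFDerivAt
  have hψ2 : HasFDerivAt (fderiv ℝ ψ) _ y :=
    ((contDiffAt_fderiv_infty hψc).differentiableAt (by simp)).hasFDerivAt
  have hψ3 : HasFDerivAt (fderiv ℝ (fderiv ℝ ψ)) _ y :=
    ((contDiffAt_fderiv_infty (contDiffAt_fderiv_infty hψc)).differentiableAt
      (by simp)).hasFDerivAt
  have hy' := hψ.mapsTo hy
  have hΓ := (hG.differentiableAt_christoffel hy).hasFDerivAt
  have hΓ' := ((hG'.differentiableAt_christoffel hy').hasFDerivAt).comp y hψ1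
  have hs (X Y : E) : fderiv ℝ (fderiv ℝ ψ) y Y X = fderiv ℝ (fderiv ℝ ψ) y X Y :=
    (hψc.isSymmSndFDerivAt minSmoothness_two_le_infty).eq Y X
  have hs3 : fderiv ℝ (fderiv ℝ (fderiv ℝ ψ)) y Y X = fderiv ℝ (fderiv ℝ (fderiv ℝ ψ)) y X Y :=
    ((contDiffAt_fderiv_infty hψc).isSymmSndFDerivAt minSmoothness_two_le_infty).eq Y X
  have key : ∀ X Y : E, fderiv ℝ (fderiv ℝ ψ) y Y (localChristoffel G y X Z) +
      fderiv ℝ ψ y (fderiv ℝ (localChristoffel G) y Y X Z) =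
      fderiv ℝ (localChristoffel G') (ψ y) (fderiv ℝ ψ y Y) (fderiv ℝ ψ y X) (fderiv ℝ ψ y Z) +
      localChristoffel G' (ψ y) (fderiv ℝ (fderiv ℝ ψ) y Y X) (fderiv ℝ ψ y Z) +
      localChristoffel G' (ψ y) (fderiv ℝ ψ y X) (fderiv ℝ (fderiv ℝ ψ) y Y Z) +
      fderiv ℝ (fderiv ℝ (fderiv ℝ ψ)) y Y X Z := by
    intro X Y
    have h1 : HasFDerivAt (fun z => fderiv ℝ ψ z (localChristoffel G z X Z)) _ y :=
      hψ2.clm_apply ((hΓ.clm_apply (hasFDerivAt_const X y)).clm_apply (hasFDerivAt_const Z y))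
    have h2 : HasFDerivAt (fun z => localChristoffel G' (ψ z) (fderiv ℝ ψ z X) (fderiv ℝ ψ z Z) +
        fderiv ℝ (fderiv ℝ ψ) z X Z) _ y :=
      ((hΓ'.clm_apply (hψ2.clm_apply (hasFDerivAt_const X y))).clm_apply
        (hψ2.clm_apply (hasFDerivAt_const Z y))).add
      ((hψ3.clm_apply (hasFDerivAt_const X y)).clm_apply (hasFDerivAt_const Z y))
    have h3 : (fun z => fderiv ℝ ψ z (localChristoffel G z X Z)) =ᶠ[𝓝 y] fun z =>
        localChristoffel G' (ψ z) (fderiv ℝ ψ z X) (fderiv ℝ ψ z Z) +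
          fderiv ℝ (fderiv ℝ ψ) z X Z :=
      Filter.mem_of_superset hU fun z hz => hψ.map_christoffel hG hG' hz X Z
    have h4 := congrArg (fun A : E →L[ℝ] E => A Y) (h1.unique (h2.congr_of_eventuallyEq h3))
    simp at h4
    rw [add_comm, h4]
    abel
  have k1 := eq_sub_of_add_eq' (key X Y)
  have k2 := eq_sub_of_add_eq' (key Y X)
  rw [hs3] at k1
  have m := hψ.map_christoffel hG hG' hy
  simp only [localCurvature, sub_apply, add_apply,
    ContinuousLinearMap.comp_apply, map_sub, map_add, k1, k2, m]
  rw [hs X Y]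
  abel

end IsIsometryOn

end Isometry

end Local

/-! ### Functional calculus -/

section Calculus

open scoped NNReal InnerProductSpace

/-- Moves an arbitrary scalar product to Euclidean space, where the spectral theorem and operator
norms adapted to it can be used. The given norm of `W` plays no part. -/
theorem exists_linearEquiv_inner {W : Type*} [AddCommGroup W] [Module ℝ W] [FiniteDimensional ℝ W]
    (B : W → W →ₗ[ℝ] ℝ) (hs : ∀ x y, B x y = B y x) (hp : ∀ x, x ≠ 0 → 0 < B x x) :
    ∃ T : W ≃ₗ[ℝ] EuclideanSpace ℝ (Fin (Module.finrank ℝ W)),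
      ∀ x y, B x y = ⟪T x, T y⟫_ℝ := by
  let c : InnerProductSpace.Core ℝ W :=
    { inner := fun x y => B x y
      conj_inner_symm := fun x y => by simpa using hs y x
      re_inner_nonneg := fun x => by
        by_cases h : x = 0
        · simp [h]
        · simpa using (hp x h).le
      add_left := fun x y z => by rw [hs, map_add, hs z x, hs z y]
      smul_left := fun x y r => by rw [hs, map_smul, hs y x]; simp
      definite := fun x hx => by
        by_contra h
        exact (hp x h).ne' hx }
  let _ : NormedAddCommGroup W := c.toNormedAddCommGroup
  let _ : InnerProductSpace ℝ W := InnerProductSpace.ofCore c.toCore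
  exact ⟨(stdOrthonormalBasis ℝ W).repr.toLinearEquiv,
    fun x y => ((stdOrthonormalBasis ℝ W).repr.inner_map_map x y).symm⟩

variable {W : Type*} [NormedAddCommGroup W] [NormedSpace ℝ W] [FiniteDimensional ℝ W]

/-- `A` is self-adjoint and non-negative for the scalar product `B`. -/
structure IsNonneg (B : W →L[ℝ] W →L[ℝ] ℝ) (A : W →L[ℝ] W) : Prop where
  symm : ∀ x y, B x y = B y x
  pos : ∀ x, x ≠ 0 → 0 < B x x
  selfAdjoint : ∀ x y, B (A x) y = B x (A y)
  nonneg : ∀ x, 0 ≤ B (A x) x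

namespace IsNonneg

variable {B : W →L[ℝ] W →L[ℝ] ℝ} {A : W →L[ℝ] W}

theorem exists_equiv (h : IsNonneg B A) :
    ∃ T : W ≃L[ℝ] EuclideanSpace ℝ (Fin (Module.finrank ℝ W)),
      ∀ x y, B x y = ⟪T x, T y⟫_ℝ := by
  obtain ⟨T, hT⟩ := exists_linearEquiv_inner (fun x => (B x).toLinearMap) h.symm h.pos
  exact ⟨T.toContinuousLinearEquiv, hT⟩

/-- A vector is a sum of orthogonal eigenvectors. -/
theorem exists_decomposition (h : IsNonneg B A) (v : W) :
    ∃ (n : ℕ) (w : Fin n → W) (l : Fin n → ℝ), ∑ i, w i = v ∧ (∀ i, A (w i) = l i • w i) ∧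
      (∀ i, 0 ≤ l i) ∧ ∀ i j, i ≠ j → B (w i) (w j) = 0 := by
  obtain ⟨T, hT⟩ := h.exists_equiv
  let S : EuclideanSpace ℝ (Fin (Module.finrank ℝ W)) →ₗ[ℝ]
      EuclideanSpace ℝ (Fin (Module.finrank ℝ W)) :=
    (T.toContinuousLinearMap ∘L A ∘L T.symm.toContinuousLinearMap).toLinearMap
  have hS : ∀ x, S (T x) = T (A x) := fun x => by simp [S]
  have hsym : S.IsSymmetric := by
    intro x y
    obtain ⟨x, rfl⟩ := T.surjective x
    obtain ⟨y, rfl⟩ := T.surjective y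
    rw [hS, hS, ← hT, ← hT, h.selfAdjoint]
  let b := hsym.eigenvectorBasis finrank_euclideanSpace_fin
  have hev : ∀ i, S (b i) = hsym.eigenvalues finrank_euclideanSpace_fin i • b i :=
    fun i => hsym.apply_eigenvectorBasis finrank_euclideanSpace_fin i
  have hA : ∀ i, A (T.symm (b i)) =
      hsym.eigenvalues finrank_euclideanSpace_fin i • T.symm (b i) := fun i => by
    apply T.injective
    rw [← hS, map_smul, T.apply_symm_apply, hev]
  refine ⟨_, fun i => b.repr (T v) i • T.symm (b i),
    hsym.eigenvalues finrank_euclideanSpace_fin, ?_, ?_, ?_, ?_⟩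
  · apply T.injective
    rw [map_sum]
    simp only [map_smul, T.apply_symm_apply]
    exact b.sum_repr (T v)
  · intro i
    rw [map_smul, hA, smul_comm]
  · intro i
    have := h.nonneg (T.symm (b i))
    rw [hA, map_smul, smul_apply, hT, T.apply_symm_apply,
      real_inner_self_eq_norm_sq, b.norm_eq_one] at this
    simpa using this
  · intro i j hij
    simp only [map_smul, smul_apply, hT, T.apply_symm_apply]
    rw [b.inner_eq_zero hij]
    simp

/-- Eigenvectors with non-negative eigenvalues span. This is the way `funCalc`, which is defined by
interpolation, is compared with other operators. -/
theorem eq_of_eigenvectors (h : IsNonneg B A) {F : Type*} [AddCommGroup F] [Module ℝ F]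
    {S S' : W →ₗ[ℝ] F} (hSS : ∀ l : ℝ, 0 ≤ l → ∀ w, A w = l • w → S w = S' w) : S = S' := by
  ext v
  obtain ⟨n, w, l, rfl, hw, hl, -⟩ := h.exists_decomposition v
  rw [map_sum, map_sum]
  exact Finset.sum_congr rfl fun i _ => hSS (l i) (hl i) (w i) (hw i)

/-- The eigenvalues and weights are chosen before `φ` and `s`: one decomposition serves every
function and every multiple of `A`. Identities between functions and derivatives in `s` can then be
taken term by term. -/
theorem exists_funCalc_eq_sum (h : IsNonneg B A) (v : W) :
    ∃ (n : ℕ) (l a : Fin n → ℝ), (∀ i, 0 ≤ l i) ∧ ∀ (φ : ℝ → ℝ) (s : ℝ),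
      B (funCalc φ (s • A).toLinearMap v) v = ∑ i, φ (s * l i) * a i := by
  obtain ⟨n, w, l, hv, hw, hl, ho⟩ := h.exists_decomposition v
  refine ⟨n, l, fun i => B (w i) (w i), hl, fun φ s => ?_⟩
  have h1 : funCalc φ (s • A).toLinearMap v = ∑ i, φ (s * l i) • w i := by
    rw [← hv, map_sum]
    refine Finset.sum_congr rfl fun i _ => funCalc_apply φ _ _ _ ?_
    simp [hw, smul_smul]
  have h2 : ∀ i, B (w i) v = B (w i) (w i) := fun i => by
    rw [← hv, map_sum]
    exact Finset.sum_eq_single i (fun j _ hj => ho i j hj.symm) (by simp)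
  rw [h1, map_sum, sum_apply]
  exact Finset.sum_congr rfl fun i _ => by simp [h2]

end IsNonneg

/-- `φ` extends to a holomorphic function on the half plane `re z > -1`. -/
def HasHolomorphicExtension (φ : ℝ → ℝ) : Prop :=
  ∃ Φ : ℂ → ℂ, DifferentiableOn ℂ Φ {z | -1 < z.re} ∧ ∀ u : ℝ, 0 ≤ u → Φ u = φ u

theorem HasHolomorphicExtension.exists_powerSeries {φ : ℝ → ℝ} (hφ : HasHolomorphicExtension φ)
    {c : ℝ} (hc : 0 ≤ c) : ∃ (b : ℕ → ℝ) (C : ℝ), (∀ n, |b n| * (c + 1 / 4) ^ n ≤ C) ∧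
      ∀ u : ℝ, 0 ≤ u → |u - c| < c + 1 / 4 → HasSum (fun n => b n * (u - c) ^ n) (φ u) := by
  obtain ⟨Φ, hΦ, hu⟩ := hφ
  -- For `c ≥ 0` the closed disc of radius `c + 1/2` about `c` stays in `re z > -1`. The smaller
  -- radius `c + 1/4` below gives geometric bounds and still exceeds `c`, so the whole interval `[0,
  -- 2c]` is inside.
  let R : ℝ≥0 := ⟨c + 1 / 2, by positivity⟩
  have hsub : Metric.closedBall (c : ℂ) R ⊆ {z | -1 < z.re} := by
    intro z hz
    rw [Metric.mem_closedBall, dist_eq_norm] at hz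
    have h1 := Complex.abs_re_le_norm (z - c)
    have h2 : |z.re - c| ≤ c + 1 / 2 := by
      rw [Complex.sub_re, Complex.ofReal_re] at h1
      exact h1.trans hz
    have := (abs_le.1 h2).1
    simp only [mem_ofPred_eq]
    linarith
  have hps := (hΦ.mono hsub).hasFPowerSeriesOnBall (by change (0 : ℝ) < c + 1 / 2; positivity)
  set p := cauchyPowerSeries Φ (c : ℂ) R
  let r : ℝ≥0 := ⟨c + 1 / 4, by positivity⟩
  have hrR : r < R := by change c + 1 / 4 < c + 1 / 2; linarith
  have hr : (r : ENNReal) < p.radius := lt_of_lt_of_le (by exact_mod_cast hrR) hps.r_le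
  obtain ⟨C, -, hC⟩ := p.norm_mul_pow_le_of_lt_radius hr
  -- Since `φ` is real and `u - c` is real, taking real parts of the Taylor coefficients does not
  -- change the sum.
  refine ⟨fun n => (p.coeff n).re, C, fun n => ?_, fun u hu0 huc => ?_⟩
  · refine le_trans ?_ (hC n)
    refine mul_le_mul_of_nonneg_right ?_ (by positivity)
    rw [p.norm_apply_eq_norm_coef]
    exact Complex.abs_re_le_norm _
  · have hmem : ((u - c : ℝ) : ℂ) ∈ Metric.eball (0 : ℂ) R := by
      rw [Metric.eball_coe, mem_ball_zero_iff, Complex.norm_real]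
      exact huc.trans hrR
    have h := hps.hasSum hmem
    have h2 := Complex.hasSum_re h
    rw [show (c : ℂ) + ((u - c : ℝ) : ℂ) = (u : ℂ) by push_cast; ring, hu u hu0,
      Complex.ofReal_re] at h2
    convert h2 using 2 with n
    rw [p.apply_eq_pow_smul_coeff, ← Complex.ofReal_pow, smul_eq_mul, Complex.re_ofReal_mul,
      mul_comm]

/-- The Taylor series of `φ` at `c` is summed in the Banach algebra of operators at `A - c`. It
converges when `‖A - c‖ < c + 1/4`, an open condition satisfied by `A₀`; an eigenvalue `l` of such
an `A` has `|l - c| ≤ ‖A - c‖`, so the scalar series converges as well. -/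
theorem exists_contDiffAt_calculus_of_norm_sub_le {φ : ℝ → ℝ} (hφ : HasHolomorphicExtension φ)
    {A₀ : W →L[ℝ] W} {c : ℝ} (hc : 0 ≤ c) (hA₀ : ‖A₀ - c • ContinuousLinearMap.id ℝ W‖ ≤ c) :
    ∃ Ψ : (W →L[ℝ] W) → (W →L[ℝ] W), ContDiffAt ℝ ∞ Ψ A₀ ∧ ∀ᶠ A in 𝓝 A₀,
      ∀ l : ℝ, 0 ≤ l → ∀ w, A w = l • w → Ψ A w = φ l • w := by
  obtain ⟨b, C, hb, hsum⟩ := hφ.exists_powerSeries hc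
  let q := FormalMultilinearSeries.ofScalars (W →L[ℝ] W) b
  let r : ℝ≥0 := ⟨c + 1 / 4, by positivity⟩
  have hr : (r : ENNReal) ≤ q.radius := by
    -- The term of degree zero is bounded by itself, since the norm estimate used for the others
    -- concerns positive degrees.
    refine q.le_radius_of_bound (max C (‖q 0‖)) fun n => ?_
    rcases Nat.eq_zero_or_pos n with rfl | hn
    · simp
    · refine le_trans ?_ ((hb n).trans (le_max_left _ _))
      exact mul_le_mul_of_nonneg_right (FormalMultilinearSeries.ofScalars_norm_le _ _ n hn)
        (by positivity)
  have hr0 : 0 < r := by change 0 < c + 1 / 4; positivity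
  have hq := q.hasFPowerSeriesOnBall (lt_of_lt_of_le (by exact_mod_cast hr0) hr)
  have hmem : ∀ D : W →L[ℝ] W, ‖D‖ < c + 1 / 4 → D ∈ Metric.eball (0 : W →L[ℝ] W) q.radius := by
    intro D hD
    refine Metric.eball_subset_eball hr ?_
    rw [Metric.eball_coe, mem_ball_zero_iff]
    exact hD
  refine ⟨fun A => q.sum (A - c • ContinuousLinearMap.id ℝ W), ?_, ?_⟩
  · have h1 : ContDiffAt ℝ ∞ q.sum (A₀ - c • ContinuousLinearMap.id ℝ W) :=
      (hq.analyticAt_of_mem (hmem _ (by linarith))).contDiffAt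
    exact h1.comp A₀ (contDiffAt_id.sub contDiffAt_const)
  · have hcont : Continuous fun A : W →L[ℝ] W => ‖A - c • ContinuousLinearMap.id ℝ W‖ := by
      fun_prop
    filter_upwards [hcont.continuousAt.eventually_lt_const (show _ < c + 1 / 4 by linarith)]
      with A hA l hl w hw
    by_cases hw0 : w = 0
    · simp [hw0]
    have hD : ∀ n : ℕ, ((A - c • ContinuousLinearMap.id ℝ W) ^ n) w = (l - c) ^ n • w := by
      intro n
      induction n with
      | zero => simp
      | succ n ih =>
        rw [pow_succ', mul_apply_eq_comp, ih, map_smul, sub_apply, hw, smul_apply,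
          ContinuousLinearMap.id_apply, ← sub_smul, smul_smul, pow_succ]
    have hlt : |l - c| < c + 1 / 4 := by
      have h1 := (A - c • ContinuousLinearMap.id ℝ W).le_opNorm w
      have h2 := hD 1
      rw [pow_one, pow_one] at h2
      rw [h2, norm_smul, Real.norm_eq_abs] at h1
      exact (le_of_mul_le_mul_right h1 (norm_pos_iff.2 hw0)).trans_lt hA
    have hs := hq.hasSum (hmem _ hA)
    rw [zero_add] at hs
    have hs2 := hs.mapL (ContinuousLinearMap.apply ℝ W w)
    have hs3 := (hsum l hl hlt).smul_const w
    refine hs2.unique ?_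
    convert hs3 using 2 with n
    rw [ContinuousLinearMap.apply_apply, FormalMultilinearSeries.ofScalars_apply_eq, smul_apply,
      hD, smul_smul]

/-- The spectrum lies in `[0, ‖S‖]`, so its distance to the point `‖S‖` is at most `‖S‖`. The direct
proof expands `‖S x - ‖S‖ x‖²` and uses `‖S x‖² ≤ ‖S‖ ⟪S x, x⟫`. -/
theorem norm_sub_le_of_inner_nonneg {F : Type*} [NormedAddCommGroup F] [InnerProductSpace ℝ F]
    {S : F →L[ℝ] F} (hs : ∀ x y, ⟪S x, y⟫_ℝ = ⟪x, S y⟫_ℝ) (hn : ∀ x, 0 ≤ ⟪S x, x⟫_ℝ) :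
    ‖S - ‖S‖ • ContinuousLinearMap.id ℝ F‖ ≤ ‖S‖ := by
  refine ContinuousLinearMap.opNorm_le_bound _ (norm_nonneg _) fun x => ?_
  have h1 : ‖S x‖ ^ 2 ≤ ‖S‖ * ⟪S x, x⟫_ℝ := by
    rcases (norm_nonneg S).eq_or_lt with h0 | h0
    · have : S = 0 := norm_eq_zero.1 h0.symm
      simp [this]
    -- Non-negativity at this vector, together with `⟪S (S x), S x⟫ ≤ ‖S‖ ‖S x‖²`, is the required
    -- inequality multiplied by `‖S‖`.
    have ha := hn (‖S‖ • x - S x)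
    have hb : ⟪S (S x), S x⟫_ℝ ≤ ‖S‖ * ‖S x‖ ^ 2 :=
      (real_inner_le_norm _ _).trans (by nlinarith [S.le_opNorm (S x), norm_nonneg (S x)])
    rw [map_sub, map_smul, inner_sub_left, inner_sub_right, inner_sub_right, inner_smul_left,
      inner_smul_left, inner_smul_right, inner_smul_right, hs (S x) x,
      real_inner_self_eq_norm_sq] at ha
    simp only [conj_trivial] at ha
    have hc : 0 ≤ ‖S‖ * (‖S‖ * ⟪S x, x⟫_ℝ - ‖S x‖ ^ 2) := by linarith
    linarith [nonneg_of_mul_nonneg_right hc h0]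
  have h2 : ‖(S - ‖S‖ • ContinuousLinearMap.id ℝ F) x‖ ^ 2 ≤ (‖S‖ * ‖x‖) ^ 2 := by
    have : (S - ‖S‖ • ContinuousLinearMap.id ℝ F) x = S x - ‖S‖ • x := rfl
    rw [this, norm_sub_sq_real, inner_smul_right, norm_smul, norm_norm]
    nlinarith [hn x, norm_nonneg S]
  exact abs_le_of_sq_le_sq' h2 (by positivity) |>.2

/-- In Euclidean coordinates for `B` the centre `c = ‖A₀‖` is admissible. Nearby operators need not
be self-adjoint for `B`: only their eigenvectors are mentioned, which matters because the metric
varies with the base point. -/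
theorem IsNonneg.exists_contDiffAt_calculus {φ : ℝ → ℝ} (hφ : HasHolomorphicExtension φ)
    {B : W →L[ℝ] W →L[ℝ] ℝ} {A₀ : W →L[ℝ] W} (h : IsNonneg B A₀) :
    ∃ Ψ : (W →L[ℝ] W) → (W →L[ℝ] W), ContDiffAt ℝ ∞ Ψ A₀ ∧ ∀ᶠ A in 𝓝 A₀,
      ∀ l : ℝ, 0 ≤ l → ∀ w, A w = l • w → Ψ A w = φ l • w := by
  obtain ⟨T, hT⟩ := h.exists_equiv
  let F := EuclideanSpace ℝ (Fin (Module.finrank ℝ W))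
  let P : (W →L[ℝ] W) → (F →L[ℝ] F) := fun A =>
    T.toContinuousLinearMap ∘L A ∘L T.symm.toContinuousLinearMap
  have hP : ContDiff ℝ ∞ P := contDiff_const.clm_comp (contDiff_id.clm_comp contDiff_const)
  have hPT : ∀ A x, P A (T x) = T (A x) := fun A x => by simp [P]
  have hn : ‖P A₀ - ‖P A₀‖ • ContinuousLinearMap.id ℝ F‖ ≤ ‖P A₀‖ := by
    apply norm_sub_le_of_inner_nonneg
    · intro x y
      obtain ⟨x, rfl⟩ := T.surjective x
      obtain ⟨y, rfl⟩ := T.surjective y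
      rw [hPT, hPT, ← hT, ← hT, h.selfAdjoint]
    · intro x
      obtain ⟨x, rfl⟩ := T.surjective x
      rw [hPT, ← hT]
      exact h.nonneg x
  obtain ⟨Ψ, hΨ, hev⟩ := exists_contDiffAt_calculus_of_norm_sub_le hφ (norm_nonneg _) hn
  refine ⟨fun A => T.symm.toContinuousLinearMap ∘L Ψ (P A) ∘L T.toContinuousLinearMap,
    contDiffAt_const.clm_comp ((hΨ.comp A₀ hP.contDiffAt).clm_comp contDiffAt_const), ?_⟩
  filter_upwards [hP.continuous.continuousAt.eventually hev] with A hA l hl w hw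
  have := hA l hl (T w) (by rw [hPT, hw, map_smul])
  simp [this]

/-! ### The functions `f` and `g` -/

theorem one_add_mem_slitPlane {z : ℂ} (hz : -1 < z.re) : 1 + z ∈ Complex.slitPlane := by
  refine Or.inl ?_
  simp
  linarith

theorem cpow_half_re_nonneg (z : ℂ) : 0 ≤ (z ^ (1 / 2 : ℂ)).re := by
  by_cases h : z = 0
  · simp [h]
  rw [Complex.cpow_def_of_ne_zero h, Complex.exp_re]
  refine mul_nonneg (Real.exp_pos _).le (Real.cos_nonneg_of_mem_Icc ?_)
  have h1 := Complex.neg_pi_lt_arg z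
  have h2 := Complex.arg_le_pi z
  have : (Complex.log z * (1 / 2)).im = z.arg / 2 := by
    rw [show (1 / 2 : ℂ) = ((1 / 2 : ℝ) : ℂ) by norm_num, Complex.im_mul_ofReal, Complex.log_im]
    ring
  rw [this]
  constructor <;> linarith

theorem half_one_add_cpow_mem_slitPlane (z : ℂ) :
    (1 + z ^ (1 / 2 : ℂ)) / 2 ∈ Complex.slitPlane := by
  refine Or.inl ?_
  have := cpow_half_re_nonneg z
  have h2 : ((1 + z ^ (1 / 2 : ℂ)) / 2).re = (1 + (z ^ (1 / 2 : ℂ)).re) / 2 := by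
    rw [show (2 : ℂ) = ((2 : ℝ) : ℂ) by norm_num, Complex.div_ofReal_re]
    simp
  rw [h2]
  positivity

theorem hasDerivAt_cpow_half {z : ℂ} (hz : -1 < z.re) :
    HasDerivAt (fun z : ℂ => (1 + z) ^ (1 / 2 : ℂ)) (1 / 2 * (1 + z) ^ (-1 / 2 : ℂ)) z := by
  have h := ((hasDerivAt_id z).const_add 1).cpow_const (c := 1 / 2) (one_add_mem_slitPlane hz)
  refine h.congr_deriv ?_
  norm_num

theorem hasDerivAt_log_half {z : ℂ} (hz : -1 < z.re) :
    HasDerivAt (fun z : ℂ => Complex.log ((1 + (1 + z) ^ (1 / 2 : ℂ)) / 2))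
      ((1 / 2 * (1 + z) ^ (-1 / 2 : ℂ)) / 2 / ((1 + (1 + z) ^ (1 / 2 : ℂ)) / 2)) z :=
  (((hasDerivAt_cpow_half hz).const_add 1).div_const 2).clog
    (half_one_add_cpow_mem_slitPlane _)

theorem ofReal_one_add_cpow_half {u : ℝ} (hu : 0 ≤ u) :
    (1 + (u : ℂ)) ^ (1 / 2 : ℂ) = (√(1 + u) : ℝ) := by
  rw [Real.sqrt_eq_rpow, Complex.ofReal_cpow (by linarith)]
  norm_num

theorem ofReal_log_half {u : ℝ} (hu : 0 ≤ u) :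
    Complex.log ((1 + (1 + (u : ℂ)) ^ (1 / 2 : ℂ)) / 2) = (Real.log ((1 + √(1 + u)) / 2) : ℝ) := by
  rw [ofReal_one_add_cpow_half hu, Complex.ofReal_log (by positivity)]
  norm_num

theorem halfPlane_mem_nhds : {z : ℂ | -1 < z.re} ∈ 𝓝 (0 : ℂ) :=
  (isOpen_lt continuous_const Complex.continuous_re).mem_nhds (by simp)

/-- Both functions are of the form `F(z)/z` with `F(0) = 0`, so the singularity at `0` is removable,
with value `F'(0)`. -/
theorem hasHolomorphicExtension_dslope {φ : ℝ → ℝ} {F F' : ℂ → ℂ}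
    (hF : ∀ z : ℂ, -1 < z.re → HasDerivAt F (F' z) z) (h0 : F 0 = 0) (h1 : F' 0 = φ 0)
    (h : ∀ u : ℝ, 0 < u → F u = (u * φ u : ℝ)) : HasHolomorphicExtension φ := by
  refine ⟨dslope F 0, (Complex.differentiableOn_dslope halfPlane_mem_nhds).2
    fun z hz => (hF z hz).differentiableAt.differentiableWithinAt, fun u hu => ?_⟩
  rcases hu.eq_or_lt with rfl | hu
  · rw [Complex.ofReal_zero, dslope_same, (hF 0 (by simp)).deriv, h1]
  · have hne : (u : ℂ) ≠ 0 := by exact_mod_cast hu.ne'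
    rw [dslope_of_ne _ hne, slope_def_field, h0, h u hu]
    push_cast
    rw [sub_zero, sub_zero, mul_div_cancel_left₀ _ hne]

theorem hasHolomorphicExtension_bgG : HasHolomorphicExtension bgG := by
  refine hasHolomorphicExtension_dslope (fun z hz => (hasDerivAt_log_half hz).neg) ?_ ?_ ?_
  · simp
  · norm_num [bgG]
  · intro u hu
    rw [Pi.neg_apply, ofReal_log_half hu.le, bgG, if_neg hu.ne']
    push_cast
    have hne : (u : ℂ) ≠ 0 := by exact_mod_cast hu.ne'
    field_simp

theorem hasHolomorphicExtension_bgF : HasHolomorphicExtension bgF := by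
  refine hasHolomorphicExtension_dslope (fun z hz =>
    ((hasDerivAt_cpow_half hz).sub_const 1).sub (hasDerivAt_log_half hz)) ?_ ?_ ?_
  · simp
  · norm_num [bgF]
  · intro u hu
    simp only [Pi.sub_apply]
    rw [ofReal_log_half hu.le, ofReal_one_add_cpow_half hu.le, bgF, if_neg hu.ne']
    push_cast
    have hne : (u : ℂ) ≠ 0 := by exact_mod_cast hu.ne'
    field_simp

theorem mul_bgF (u : ℝ) : u * bgF u = √(1 + u) - 1 - Real.log ((1 + √(1 + u)) / 2) := by
  rw [bgF]
  split_ifs with h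
  · simp [h]
  · field_simp

theorem hasDerivAt_mul_bgF {u : ℝ} (hu : 0 ≤ u) :
    HasDerivAt (fun u => u * bgF u) (1 / (2 * (1 + √(1 + u)))) u := by
  have hpos : 0 < 1 + u := by linarith
  have hs : HasDerivAt (fun u : ℝ => √(1 + u)) (1 / (2 * √(1 + u))) u :=
    ((hasDerivAt_id u).const_add 1).sqrt hpos.ne'
  have hsp : 0 < √(1 + u) := Real.sqrt_pos.2 hpos
  have hl := ((hs.const_add 1).div_const 2).log (by positivity)
  have h := (hs.sub_const 1).sub hl
  rw [show (fun u => u * bgF u) = fun u => √(1 + u) - 1 - Real.log ((1 + √(1 + u)) / 2) from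
    funext mul_bgF]
  refine h.congr_deriv ?_
  field_simp
  ring

/-- As `2 (u f)' = 1/(1 + √(1+u)) = (√(1+u) - 1)/u`, subtracting it from `f` leaves exactly the
logarithmic term. This is the relation behind `h + μ = k`. -/
theorem bgF_sub_deriv {u : ℝ} (hu : 0 ≤ u) :
    bgF u - 2 * deriv (fun u => u * bgF u) u = bgG u := by
  rw [(hasDerivAt_mul_bgF hu).deriv]
  rcases hu.eq_or_lt with rfl | hu
  · norm_num [bgF, bgG]
  · have hpos : 0 < 1 + u := by linarith
    have hsp : 0 < √(1 + u) := Real.sqrt_pos.2 hpos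
    have hsq := Real.sq_sqrt hpos.le
    rw [bgF, bgG, if_neg hu.ne', if_neg hu.ne']
    field_simp
    nlinarith

/-- For `l > 0` the function is `(u f)(t² l)/l`, to which the chain rule applies. For `l = 0` it is
`t²/4`, and `(u f)'(0) = 1/4`. -/
theorem hasDerivAt_sq_mul_bgF {l : ℝ} (hl : 0 ≤ l) :
    HasDerivAt (fun t : ℝ => t ^ 2 * bgF (t ^ 2 * l))
      (2 * deriv (fun u => u * bgF u) l) 1 := by
  have hsq : HasDerivAt (fun t : ℝ => t ^ 2) 2 1 := by
    simpa using hasDerivAt_pow 2 (1 : ℝ)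
  rcases hl.eq_or_lt with rfl | hl
  · rw [(hasDerivAt_mul_bgF le_rfl).deriv]
    simp only [mul_zero]
    refine (hsq.mul_const (bgF 0)).congr_deriv ?_
    norm_num [bgF]
  · have h1 : HasDerivAt (fun u => u * bgF u) (deriv (fun u => u * bgF u) l) (1 ^ 2 * l) := by
      rw [one_pow, one_mul]
      exact (hasDerivAt_mul_bgF hl.le).differentiableAt.hasDerivAt
    have h2 := (h1.comp (1 : ℝ) (hsq.mul_const l)).div_const l
    refine (h2.congr_deriv ?_).congr_of_eventuallyEq (Eventually.of_forall fun t => ?_)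
    · field_simp
    · simp only [Function.comp_apply]
      field_simp

end Calculus

/-! ### Coordinate expressions on a manifold without boundary -/

section Frames

variable {V : Type*} [NormedAddCommGroup V] [NormedSpace ℝ V]
  {H : Type*} [TopologicalSpace H] (J : ModelWithCorners ℝ V H)
  {N : Type*} [TopologicalSpace N] [ChartedSpace H N]

/-- The differential of the inverse of the preferred chart at `x₀`, as an endomorphism of the model
space (each tangent space being the model space). -/
def frame (x₀ : N) (y : V) : V →L[ℝ] V := chartFrame J x₀ y

/-- The change of coordinates between the preferred charts at `x₀` and `x₁`. -/
def transition (x₀ x₁ : N) : V → V := extChartAt J x₁ ∘ (extChartAt J x₀).symm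

variable {J} {x₀ x₁ : N} {y : V}

theorem transition_apply : transition J x₀ x₁ y = extChartAt J x₁ ((extChartAt J x₀).symm y) := rfl

theorem transition_eventuallyEq_id (hx : (extChartAt J x₀).target ∈ 𝓝 y) :
    transition J x₀ x₀ =ᶠ[𝓝 y] id :=
  Filter.mem_of_superset hx fun _ hz => (extChartAt J x₀).right_inv hz

variable [J.Boundaryless] [IsManifold J ∞ N]

omit [J.Boundaryless] [IsManifold J ∞ N] in
theorem symm_transition (h : (extChartAt J x₀).symm y ∈ (extChartAt J x₁).source) :
    (extChartAt J x₁).symm (transition J x₀ x₁ y) = (extChartAt J x₀).symm y :=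
  (extChartAt J x₁).left_inv h

omit [J.Boundaryless] [IsManifold J ∞ N] in
theorem transition_mem_target (h : (extChartAt J x₀).symm y ∈ (extChartAt J x₁).source) :
    transition J x₀ x₁ y ∈ (extChartAt J x₁).target :=
  (extChartAt J x₁).map_source h

omit [IsManifold J ∞ N] in
theorem target_mem_nhds (hy : y ∈ (extChartAt J x₀).target) : (extChartAt J x₀).target ∈ 𝓝 y :=
  (isOpen_extChartAt_target x₀).mem_nhds hy

omit [IsManifold J ∞ N] in
theorem eventually_mem_source (hy : y ∈ (extChartAt J x₀).target)
    (h : (extChartAt J x₀).symm y ∈ (extChartAt J x₁).source) :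
    ∀ᶠ z in 𝓝 y, z ∈ (extChartAt J x₀).target ∧
      (extChartAt J x₀).symm z ∈ (extChartAt J x₁).source :=
  (Filter.eventually_mem_set.2 (target_mem_nhds hy)).and
    (((continuousOn_extChartAt_symm x₀).continuousAt (target_mem_nhds hy)).eventually_mem
      ((isOpen_extChartAt_source x₁).mem_nhds h))

theorem contDiffAt_transition (hy : y ∈ (extChartAt J x₀).target)
    (h : (extChartAt J x₀).symm y ∈ (extChartAt J x₁).source) :
    ContDiffAt ℝ ∞ (transition J x₀ x₁) y := by
  refine (contDiffOn_ext_coord_change (I := J) (n := ∞) x₁ x₀).contDiffAt ?_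
  filter_upwards [eventually_mem_source hy h] with z hz
  rw [PartialEquiv.trans_source, PartialEquiv.symm_source]
  exact hz

theorem differentiableAt_transition (hy : y ∈ (extChartAt J x₀).target)
    (h : (extChartAt J x₀).symm y ∈ (extChartAt J x₁).source) :
    DifferentiableAt ℝ (transition J x₀ x₁) y :=
  (contDiffAt_transition hy h).differentiableAt (by simp)

theorem mdifferentiableAt_chart_symm (hy : y ∈ (extChartAt J x₀).target) :
    MDifferentiableAt 𝓘(ℝ, V) J (extChartAt J x₀).symm y :=
  ((contMDiffOn_extChartAt_symm (I := J) (n := ∞) x₀).contMDiffAt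
    (target_mem_nhds hy)).mdifferentiableAt (by simp)

/-- The tangent space at a point is the model space through the chart preferred by that point, so
this differential is that of a change of charts whose target chart depends on `y`. -/
theorem frame_eq_fderiv (hy : y ∈ (extChartAt J x₀).target) :
    frame J x₀ y = fderiv ℝ (transition J x₀ ((extChartAt J x₀).symm y)) y := by
  have h : HasFDerivWithinAt (transition J x₀ ((extChartAt J x₀).symm y)) (frame J x₀ y)
      (range id) y := (mdifferentiableAt_chart_symm hy).hasMFDerivAt.2
  rw [range_id, hasFDerivWithinAt_univ] at h
  exact h.fderiv.symm

theorem frame_self : frame J x₀ (extChartAt J x₀ x₀) = ContinuousLinearMap.id ℝ V := by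
  have hy : extChartAt J x₀ x₀ ∈ (extChartAt J x₀).target := mem_extChartAt_target x₀
  rw [frame_eq_fderiv hy, extChartAt_to_inv,
    (transition_eventuallyEq_id (target_mem_nhds hy)).fderiv_eq,
    fderiv_id]

omit [IsManifold J ∞ N] in
theorem transition_comp_eventuallyEq {x₂ : N} (hy : y ∈ (extChartAt J x₀).target)
    (h : (extChartAt J x₀).symm y ∈ (extChartAt J x₁).source) :
    transition J x₁ x₂ ∘ transition J x₀ x₁ =ᶠ[𝓝 y] transition J x₀ x₂ := by
  filter_upwards [eventually_mem_source hy h] with z hz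
  rw [Function.comp_apply, transition_apply, symm_transition hz.2]
  rfl

theorem fderiv_transition_comp {x₂ : N} (hy : y ∈ (extChartAt J x₀).target)
    (h : (extChartAt J x₀).symm y ∈ (extChartAt J x₁).source)
    (h₂ : (extChartAt J x₀).symm y ∈ (extChartAt J x₂).source) :
    fderiv ℝ (transition J x₀ x₂) y =
      fderiv ℝ (transition J x₁ x₂) (transition J x₀ x₁ y) ∘L fderiv ℝ (transition J x₀ x₁) y := by
  rw [← (transition_comp_eventuallyEq hy h).fderiv_eq]
  refine fderiv_comp y (differentiableAt_transition (transition_mem_target h) ?_)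
    (differentiableAt_transition hy h)
  rwa [symm_transition h]

theorem frame_transition (hy : y ∈ (extChartAt J x₀).target)
    (h : (extChartAt J x₀).symm y ∈ (extChartAt J x₁).source) :
    frame J x₀ y = frame J x₁ (transition J x₀ x₁ y) ∘L fderiv ℝ (transition J x₀ x₁) y := by
  rw [frame_eq_fderiv hy, frame_eq_fderiv (transition_mem_target h), symm_transition h]
  exact fderiv_transition_comp hy h (mem_extChartAt_source _)

theorem fderiv_transition_surjective (hy : y ∈ (extChartAt J x₀).target)
    (h : (extChartAt J x₀).symm y ∈ (extChartAt J x₁).source) :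
    Function.Surjective (fderiv ℝ (transition J x₀ x₁) y) := by
  have h0 : (extChartAt J x₁).symm (transition J x₀ x₁ y) ∈ (extChartAt J x₀).source := by
    rw [symm_transition h]
    exact (extChartAt J x₀).map_target hy
  have h1 := fderiv_transition_comp (transition_mem_target h) h0
    (x₂ := x₁) (by rwa [symm_transition h])
  have h2 : transition J x₁ x₀ (transition J x₀ x₁ y) = y := by
    rw [transition_apply, symm_transition h, (extChartAt J x₀).right_inv hy]
  rw [(transition_eventuallyEq_id (target_mem_nhds (transition_mem_target h))).fderiv_eq, fderiv_id, h2] at h1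
  intro X
  exact ⟨fderiv ℝ (transition J x₁ x₀) (transition J x₀ x₁ y) X,
    (congrArg (fun A : V →L[ℝ] V => A X) h1).symm⟩

theorem frame_surjective (hy : y ∈ (extChartAt J x₀).target) :
    Function.Surjective (frame J x₀ y) := by
  rw [frame_eq_fderiv hy]
  exact fderiv_transition_surjective hy (mem_extChartAt_source _)

theorem frame_injective [FiniteDimensional ℝ V] (hy : y ∈ (extChartAt J x₀).target) :
    Function.Injective (frame J x₀ y) :=
  (LinearMap.injective_iff_surjective (f := (frame J x₀ y).toLinearMap)).2 (frame_surjective hy)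

theorem contDiffAt_comp_chart_symm {F : Type*} [NormedAddCommGroup F] [NormedSpace ℝ F]
    {u : N → F} (hu : ContMDiff J 𝓘(ℝ, F) ∞ u) (hy : y ∈ (extChartAt J x₀).target) :
    ContDiffAt ℝ ∞ (u ∘ (extChartAt J x₀).symm) y := by
  rw [← contMDiffAt_iff_contDiffAt]
  exact hu.contMDiffAt.comp y
    ((contMDiffOn_extChartAt_symm (I := J) (n := ∞) x₀).contMDiffAt (target_mem_nhds hy))

omit [IsManifold J ∞ N] [J.Boundaryless] in
theorem fderiv_eq_of_hasMFDerivAt {F : Type*} [NormedAddCommGroup F] [NormedSpace ℝ F]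
    {f : V → F} {D : V →L[ℝ] F} (h : HasMFDerivAt 𝓘(ℝ, V) 𝓘(ℝ, F) f y D) : fderiv ℝ f y = D := by
  have h1 : HasFDerivAt f D y := hasMFDerivAt_iff_hasFDerivAt.1 h
  exact h1.fderiv

/-- The differential of a map in coordinates. -/
theorem mfderiv_frame {V' : Type*} [NormedAddCommGroup V'] [NormedSpace ℝ V']
    {H' : Type*} [TopologicalSpace H'] {J' : ModelWithCorners ℝ V' H'} [J'.Boundaryless]
    {N' : Type*} [TopologicalSpace N'] [ChartedSpace H' N'] [IsManifold J' ∞ N']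
    {f : N → N'} {x₀' : N'} (hy : y ∈ (extChartAt J x₀).target)
    (hf : MDifferentiableAt J J' f ((extChartAt J x₀).symm y))
    (h : f ((extChartAt J x₀).symm y) ∈ (extChartAt J' x₀').source) (X : V) :
    (mfderiv J J' f ((extChartAt J x₀).symm y) : V →L[ℝ] V') (frame J x₀ y X) =
      frame J' x₀' (extChartAt J' x₀' (f ((extChartAt J x₀).symm y)))
        (fderiv ℝ (extChartAt J' x₀' ∘ f ∘ (extChartAt J x₀).symm) y X) := by
  have h1 := hf.hasMFDerivAt.comp y (mdifferentiableAt_chart_symm hy).hasMFDerivAt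
  have h2 : HasMFDerivAt J' 𝓘(ℝ, V') (extChartAt J' x₀') _ _ :=
    (((contMDiffOn_extChartAt (I := J') (n := ∞) (x := x₀')).contMDiffAt
      ((chartAt H' x₀').open_source.mem_nhds (by rwa [← extChartAt_source J']))).mdifferentiableAt
      (by simp)).hasMFDerivAt
  have h3 := h2.comp y h1
  have h5 : extChartAt J' x₀' (f ((extChartAt J x₀).symm y)) ∈ (extChartAt J' x₀').target :=
    (extChartAt J' x₀').map_source h
  have h6 := (mdifferentiableAt_chart_symm h5).hasMFDerivAt.comp y h3
  have h7 : (extChartAt J' x₀').symm ∘ extChartAt J' x₀' ∘ f ∘ (extChartAt J x₀).symm =ᶠ[𝓝 y]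
      f ∘ (extChartAt J x₀).symm := by
    filter_upwards [h1.continuousAt.eventually_mem
      ((isOpen_extChartAt_source (I := J') x₀').mem_nhds h)] with z hz
    exact (extChartAt J' x₀').left_inv hz
  have h8 := h1.congr_of_eventuallyEq h7
  have h9 := hasMFDerivAt_unique h8 h6
  rw [fderiv_eq_of_hasMFDerivAt h3]
  exact congrArg (fun A : V →L[ℝ] V' => A X) h9

theorem mfderiv_frame_fun {F : Type*} [NormedAddCommGroup F] [NormedSpace ℝ F]
    {u : N → F} (hy : y ∈ (extChartAt J x₀).target)
    (hu : MDifferentiableAt J 𝓘(ℝ, F) u ((extChartAt J x₀).symm y)) (X : V) :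
    (mfderiv J 𝓘(ℝ, F) u ((extChartAt J x₀).symm y) : V →L[ℝ] F) (frame J x₀ y X) =
      fderiv ℝ (u ∘ (extChartAt J x₀).symm) y X := by
  have h1 := hu.hasMFDerivAt.comp y (mdifferentiableAt_chart_symm hy).hasMFDerivAt
  exact (congrArg (fun A : V →L[ℝ] F => A X) (fderiv_eq_of_hasMFDerivAt h1)).symm

/-! ### Differential forms and exterior derivative in a fixed chart -/

section Forms

variable {F : Type*} [NormedAddCommGroup F] [NormedSpace ℝ F] {n : ℕ}

/-- The coordinate expression of a differential form in the preferred chart at `x₀`. -/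
def coordForm (η : Form J N n F) (x₀ : N) (y : V) : V [⋀^Fin n]→L[ℝ] F :=
  (η ((extChartAt J x₀).symm y)).compContinuousLinearMap (chartFrame J x₀ y)

omit [J.Boundaryless] [IsManifold J ∞ N] in
theorem coordForm_apply (η : Form J N n F) (X : Fin n → V) :
    coordForm η x₀ y X =
      (η ((extChartAt J x₀).symm y) : V [⋀^Fin n]→L[ℝ] F) (fun i => frame J x₀ y (X i)) :=
  rfl

omit [J.Boundaryless] [IsManifold J ∞ N] in
theorem form_congr (η : Form J N n F) {p q : N} (h : p = q) :
    (η p : V [⋀^Fin n]→L[ℝ] F) = (η q : V [⋀^Fin n]→L[ℝ] F) := by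
  subst h
  rfl

theorem coordForm_transition (η : Form J N n F) (hy : y ∈ (extChartAt J x₀).target)
    (h : (extChartAt J x₀).symm y ∈ (extChartAt J x₁).source) :
    coordForm η x₀ y = (coordForm η x₁ (transition J x₀ x₁ y)).compContinuousLinearMap
      (fderiv ℝ (transition J x₀ x₁) y) := by
  ext X
  rw [coordForm_apply, ContinuousAlternatingMap.compContinuousLinearMap_apply, coordForm_apply,
    frame_transition hy h, form_congr η (symm_transition h)]
  rfl

theorem coordForm_self (η : Form J N n F) (x : N) :
    coordForm η x (extChartAt J x x) = (η x : V [⋀^Fin n]→L[ℝ] F) := by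
  ext X
  rw [coordForm_apply, frame_self, form_congr η (extChartAt_to_inv x)]
  rfl

omit [J.Boundaryless] [IsManifold J ∞ N] in
theorem dForm_eq (η : Form J N n F) (x : N) :
    (dForm η x : V [⋀^Fin (n + 1)]→L[ℝ] F) = extDeriv (coordForm η x) (extChartAt J x x) :=
  rfl

/-- The exterior derivative can be computed in any preferred chart. -/
theorem coordForm_dForm (η : Form J N n F) (hy : y ∈ (extChartAt J x₀).target)
    (hη : ∀ x, DifferentiableAt ℝ (coordForm η x) (extChartAt J x x)) :
    coordForm (dForm η) x₀ y = extDeriv (coordForm η x₀) y := by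
  -- By definition `dForm η` at this point uses its own chart `x₁`; the comparison with the chart at
  -- `x₀` is the naturality of the exterior derivative under the transition map.
  set x₁ := (extChartAt J x₀).symm y with hx₁
  have h : (extChartAt J x₀).symm y ∈ (extChartAt J x₁).source := mem_extChartAt_source x₁
  have h1 : coordForm η x₀ =ᶠ[𝓝 y] fun z =>
      (coordForm η x₁ (transition J x₀ x₁ z)).compContinuousLinearMap
        (fderiv ℝ (transition J x₀ x₁) z) := by
    filter_upwards [eventually_mem_source hy h] with z hz
    exact coordForm_transition η hz.1 hz.2
  rw [h1.extDeriv_eq, extDeriv_pullback (f := transition J x₀ x₁) (hη x₁)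
    (contDiffAt_transition hy h) minSmoothness_two_le_infty]
  ext X
  rw [coordForm_apply, frame_eq_fderiv hy]
  rfl

end Forms

end Frames

/-! ### Kähler geometry in coordinates -/

section Complex

theorem fderiv_mulI {V V' : Type*} [NormedAddCommGroup V] [NormedSpace ℝ V] [NormedSpace ℂ V]
    [IsScalarTower ℝ ℂ V] [NormedAddCommGroup V'] [NormedSpace ℝ V'] [NormedSpace ℂ V']
    [IsScalarTower ℝ ℂ V'] {f : V → V'} {y : V} (hf : DifferentiableAt ℂ f y) (X : V) :
    fderiv ℝ f y (mulI V X) = mulI V' (fderiv ℝ f y X) := by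
  rw [hf.fderiv_restrictScalars ℝ]
  exact (fderiv ℂ f y).map_smul Complex.I X

theorem mulI_mulI {V : Type*} [NormedAddCommGroup V] [NormedSpace ℝ V] [NormedSpace ℂ V]
    [IsScalarTower ℝ ℂ V] (X : V) : mulI V (mulI V X) = -X := by
  change Complex.I • Complex.I • X = -X
  rw [smul_smul, Complex.I_mul_I, neg_one_smul]

variable {E : Type*} [NormedAddCommGroup E] [NormedSpace ℂ E] [FiniteDimensional ℂ E]

section LocalKahler

variable {G : E → E →L[ℝ] E →L[ℝ] ℝ} {U : Set E} {y : E}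

/-- The transformation `I R(I Z, Z)` of a metric on an open subset of `E`. -/
def localCurvOp (G : E → E →L[ℝ] E →L[ℝ] ℝ) (y Z : E) : E →L[ℝ] E :=
  mulI E ∘L localCurvature G y (mulI E Z) Z

/-- `G` is a Kähler metric on `U` (the Christoffel symbols are complex linear). -/
structure IsKahlerOn (G : E → E →L[ℝ] E →L[ℝ] ℝ) (U : Set E) : Prop extends IsMetricOn G U where
  hermitian : ∀ y ∈ U, ∀ X Y, G y (mulI E X) (mulI E Y) = G y X Y
  christoffel_mulI : ∀ y ∈ U, ∀ X Y,
    localChristoffel G y X (mulI E Y) = mulI E (localChristoffel G y X Y)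

omit [FiniteDimensional ℂ E] in
theorem hermitian_skew {B : E →L[ℝ] E →L[ℝ] ℝ}
    (hB : ∀ X Y, B (mulI E X) (mulI E Y) = B X Y) (X Y : E) : B (mulI E X) Y = -B X (mulI E Y) := by
  rw [← hB X (mulI E Y), mulI_mulI, map_neg, neg_neg]

namespace IsKahlerOn

variable (hG : IsKahlerOn G U) (hy : y ∈ U)
include hG hy

/-- The complex structure is parallel: complex linearity of `Γ` holds on an open set, so it passes
to the derivative of `Γ`. -/
theorem curvature_mulI (X Y Z : E) :
    localCurvature G y X Y (mulI E Z) = mulI E (localCurvature G y X Y Z) := by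
  have hd := hG.differentiableAt_christoffel hy
  have h1 (W X Z : E) : fderiv ℝ (localChristoffel G) y W X (mulI E Z) =
      mulI E (fderiv ℝ (localChristoffel G) y W X Z) := by
    have hX : DifferentiableAt ℝ (fun z => localChristoffel G z X) y :=
      hd.clm_apply (differentiableAt_const X)
    have := fderiv_commute hX (mulI E) (mulI E)
      (Filter.mem_of_superset (hG.isOpen.mem_nhds hy) fun z hz w => hG.christoffel_mulI z hz X w) W Z
    rwa [fderiv_clm_apply_const hd] at this
  have h2 := hG.christoffel_mulI y hy
  simp only [localCurvature, sub_apply, add_apply, ContinuousLinearMap.comp_apply, h1, h2, map_sub,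
    map_add]

/-- Pair symmetry moves `I` from the first pair of arguments to the second, where `curvature_mulI`
and orthogonality of `I` remove it. -/
theorem curvature_mulI_mulI (X Y Z : E) :
    localCurvature G y (mulI E X) (mulI E Y) Z = localCurvature G y X Y Z := by
  refine eq_of_forall_apply_eq (hG.pos y hy) fun W => ?_
  rw [hG.curvature_pair_symm hy, hG.curvature_mulI hy, hG.hermitian y hy,
    hG.curvature_pair_symm hy]

theorem curvOp_mulI (X Z : E) :
    localCurvOp G y Z (mulI E X) = mulI E (localCurvOp G y Z X) := by
  simp only [localCurvOp, ContinuousLinearMap.comp_apply, hG.curvature_mulI hy]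

theorem curvOp_isNonneg (hK : ∀ X Y, 0 ≤ G y (localCurvature G y X Y X) Y) (Z : E) :
    IsNonneg (G y) (localCurvOp G y Z) where
  symm := hG.symm y hy
  pos := hG.pos y hy
  selfAdjoint X Y := by
    simp only [localCurvOp, ContinuousLinearMap.comp_apply]
    rw [hermitian_skew (hG.hermitian y hy), hG.curvature_skew hy, hG.curvature_mulI hy, neg_neg]
  nonneg X := by
    -- With `I`-invariance, the Bianchi identity for `Z`, `I Z`, `X` expresses the quadratic form as
    -- `G(R(Z, I X) Z, I X) + G(R(Z, X) Z, X)`, two terms covered by `hK`.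
    have b := congrArg (fun V => G y V (mulI E X)) (hG.curvature_bianchi hy Z (mulI E Z) X)
    simp only [map_add, add_apply, map_zero, zero_apply] at b
    have h1 : G y (localCurvature G y (mulI E Z) X Z) (mulI E X) =
        -G y (localCurvature G y Z (mulI E X) Z) (mulI E X) := by
      rw [← hG.curvature_mulI_mulI hy (mulI E Z) X, mulI_mulI]
      simp only [localCurvature, map_neg,
        neg_apply, map_sub, map_add, sub_apply, add_apply, ContinuousLinearMap.comp_apply]
      ring
    have h2 : G y (localCurvature G y X Z (mulI E Z)) (mulI E X) =
        -G y (localCurvature G y Z X Z) X := by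
      rw [hG.curvature_mulI hy, hG.hermitian y hy, IsMetricOn.curvature_antisymm, map_neg,
        neg_apply]
    have h3 : G y (localCurvOp G y Z X) X = G y (localCurvature G y Z (mulI E Z) X) (mulI E X) := by
      simp only [localCurvOp, ContinuousLinearMap.comp_apply]
      rw [hermitian_skew (hG.hermitian y hy), IsMetricOn.curvature_antisymm, map_neg, neg_apply,
        neg_neg]
    rw [h3]
    linarith [hK Z (mulI E X), hK Z X]

omit [FiniteDimensional ℂ E] hG hy in
theorem curvature_add_left (X X' Y : E) :
    localCurvature G y (X + X') Y = localCurvature G y X Y + localCurvature G y X' Y := by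
  ext Z
  simp only [localCurvature, map_add, add_apply, sub_apply, ContinuousLinearMap.comp_apply]
  abel

omit [FiniteDimensional ℂ E] hG hy in
theorem curvature_smul_left (c : ℝ) (X Y : E) :
    localCurvature G y (c • X) Y = c • localCurvature G y X Y := by
  ext Z
  simp only [localCurvature, map_smul, add_apply, sub_apply, ContinuousLinearMap.comp_apply,
    smul_apply, smul_sub, smul_add]

end IsKahlerOn

omit [FiniteDimensional ℂ E] in
theorem curvature_swap (X Y : E) : localCurvature G y X Y = -localCurvature G y Y X := by
  ext Z
  exact IsMetricOn.curvature_antisymm X Y Z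

omit [FiniteDimensional ℂ E] in
theorem localCurvOp_smul_real (c : ℝ) (Z : E) :
    localCurvOp G y (c • Z) = c ^ 2 • localCurvOp G y Z := by
  have : localCurvature G y (mulI E (c • Z)) (c • Z) = c ^ 2 • localCurvature G y (mulI E Z) Z := by
    rw [map_smul, IsKahlerOn.curvature_smul_left, curvature_swap, IsKahlerOn.curvature_smul_left,
      curvature_swap Z]
    module
  rw [localCurvOp, this, localCurvOp]
  ext X
  simp

omit [FiniteDimensional ℂ E] in
/-- `I R(I Z, Z)` is invariant under the rotations of `Z`. -/
theorem localCurvOp_rotate {a b : ℝ} (hab : a ^ 2 + b ^ 2 = 1) (Z : E) :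
    localCurvOp G y (a • Z + b • mulI E Z) = localCurvOp G y Z := by
  have hself (X : E) : localCurvature G y X X = 0 := by
    rw [localCurvature]
    abel
  have hadd (X Y Y' : E) : localCurvature G y X (Y + Y') =
      localCurvature G y X Y + localCurvature G y X Y' := by
    rw [curvature_swap, IsKahlerOn.curvature_add_left, curvature_swap Y, curvature_swap Y']
    abel
  have hsmul (c : ℝ) (X Y : E) : localCurvature G y X (c • Y) = c • localCurvature G y X Y := by
    rw [curvature_swap, IsKahlerOn.curvature_smul_left, curvature_swap Y]
    module
  have : localCurvature G y (mulI E (a • Z + b • mulI E Z)) (a • Z + b • mulI E Z) =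
      localCurvature G y (mulI E Z) Z := by
    rw [map_add, map_smul, map_smul, mulI_mulI, smul_neg, ← neg_smul]
    simp only [IsKahlerOn.curvature_add_left, IsKahlerOn.curvature_smul_left, hadd, hsmul, hself]
    rw [curvature_swap Z (mulI E Z)]
    trans (a ^ 2 + b ^ 2) • localCurvature G y (mulI E Z) Z
    · module
    · rw [hab, one_smul]
  rw [localCurvOp, this, localCurvOp]

end LocalKahler

variable {M : Type*} [TopologicalSpace M] [ChartedSpace E M] [IsManifold 𝓘(ℂ, E) ω M]
  {x₀ x₁ : M} {y : E}

omit [FiniteDimensional ℂ E] in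
theorem contDiffAt_transition_complex (hy : y ∈ (extChartAt 𝓘(ℝ, E) x₀).target)
    (h : (extChartAt 𝓘(ℝ, E) x₀).symm y ∈ (extChartAt 𝓘(ℝ, E) x₁).source) :
    ContDiffAt ℂ ω (transition 𝓘(ℝ, E) x₀ x₁) y := by
  refine (contDiffOn_ext_coord_change (I := 𝓘(ℂ, E)) (n := ω) x₁ x₀).contDiffAt ?_
  filter_upwards [eventually_mem_source hy h] with z hz
  rw [PartialEquiv.trans_source, PartialEquiv.symm_source]
  exact hz

omit [FiniteDimensional ℂ E] in
theorem fderiv_transition_mulI (hy : y ∈ (extChartAt 𝓘(ℝ, E) x₀).target)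
    (h : (extChartAt 𝓘(ℝ, E) x₀).symm y ∈ (extChartAt 𝓘(ℝ, E) x₁).source) (X : E) :
    fderiv ℝ (transition 𝓘(ℝ, E) x₀ x₁) y (mulI E X) =
      mulI E (fderiv ℝ (transition 𝓘(ℝ, E) x₀ x₁) y X) :=
  fderiv_mulI ((contDiffAt_transition_complex hy h).differentiableAt (by simp)) X

omit [FiniteDimensional ℂ E] in
theorem frame_mulI (hy : y ∈ (extChartAt 𝓘(ℝ, E) x₀).target) (X : E) :
    frame 𝓘(ℝ, E) x₀ y (mulI E X) = mulI E (frame 𝓘(ℝ, E) x₀ y X) := by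
  rw [frame_eq_fderiv hy]
  exact fderiv_transition_mulI hy (mem_extChartAt_source _) X

omit [FiniteDimensional ℂ E] in
/-- The vector field `∂_X` of a chart is smooth. -/
theorem contMDiffAt_frame (hy : y ∈ (extChartAt 𝓘(ℝ, E) x₀).target) (X : E) :
    ContMDiffAt 𝓘(ℝ, E) (𝓘(ℝ, E).prod 𝓘(ℝ, E)) ∞
      (fun z => TotalSpace.mk' E (E := fun x : M => TangentSpace 𝓘(ℝ, E) x)
        ((extChartAt 𝓘(ℝ, E) x₀).symm z) (frame 𝓘(ℝ, E) x₀ z X)) y := by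
  rw [contMDiffAt_totalSpace]
  refine ⟨(contMDiffOn_extChartAt_symm (I := 𝓘(ℝ, E)) (n := ∞) x₀).contMDiffAt
    (target_mem_nhds hy), ?_⟩
  set x₁ := (extChartAt 𝓘(ℝ, E) x₀).symm y with hx₁
  have h : (extChartAt 𝓘(ℝ, E) x₀).symm y ∈ (extChartAt 𝓘(ℝ, E) x₁).source :=
    mem_extChartAt_source x₁
  have hs : ContDiffAt ℝ ∞ (fun z => fderiv ℝ (transition 𝓘(ℝ, E) x₀ x₁) z X) y :=
    (contDiffAt_fderiv_infty (contDiffAt_transition hy h)).clm_apply contDiffAt_const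
  refine hs.contMDiffAt.congr_of_eventuallyEq ?_
  filter_upwards [eventually_mem_source hy h] with z hz
  have e : fderiv ℝ (transition 𝓘(ℝ, E) x₀ x₁) z = _ :=
    fderiv_transition_comp (x₁ := (extChartAt 𝓘(ℝ, E) x₀).symm z) (x₂ := x₁) hz.1
      (mem_extChartAt_source _) hz.2
  rw [← frame_eq_fderiv hz.1] at e
  rw [e]
  change fderivWithin ℝ _ (range id) _ _ = _
  rw [range_id, fderivWithin_univ]
  rfl

namespace HermitianMetric

variable (g : HermitianMetric E M)

/-- The metric at a point, as a bilinear form on the model space. -/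
def met (p : M) : E →L[ℝ] E →L[ℝ] ℝ := g.inner p

omit [FiniteDimensional ℂ E] in
theorem coeff_apply (X Y : E) : g.coeff x₀ y X Y =
    g.met ((extChartAt 𝓘(ℝ, E) x₀).symm y) (frame 𝓘(ℝ, E) x₀ y X) (frame 𝓘(ℝ, E) x₀ y Y) := rfl

omit [FiniteDimensional ℂ E] in
theorem coeff_self (p : M) : g.coeff p (extChartAt 𝓘(ℝ, E) p p) = g.met p := by
  ext X Y
  rw [coeff_apply, frame_self, extChartAt_to_inv]
  rfl

omit [FiniteDimensional ℂ E] in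
theorem met_symm (p : M) (X Y : E) : g.met p X Y = g.met p Y X := g.symm p X Y

omit [FiniteDimensional ℂ E] in
theorem met_pos (p : M) (X : E) (hX : X ≠ 0) : 0 < g.met p X X := g.pos p X hX

omit [FiniteDimensional ℂ E] in
theorem met_hermitian (p : M) (X Y : E) : g.met p (mulI E X) (mulI E Y) = g.met p X Y :=
  g.hermitian p X Y

omit [FiniteDimensional ℂ E] in
theorem contMDiffAt_inner {b : E → M} {v w : (z : E) → TangentSpace 𝓘(ℝ, E) (b z)}
    (hb : ContMDiffAt 𝓘(ℝ, E) 𝓘(ℝ, E) ∞ b y)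
    (hv : ContMDiffAt 𝓘(ℝ, E) (𝓘(ℝ, E).prod 𝓘(ℝ, E)) ∞
      (fun z => TotalSpace.mk' E (E := fun x : M => TangentSpace 𝓘(ℝ, E) x) (b z) (v z)) y)
    (hw : ContMDiffAt 𝓘(ℝ, E) (𝓘(ℝ, E).prod 𝓘(ℝ, E)) ∞
      (fun z => TotalSpace.mk' E (E := fun x : M => TangentSpace 𝓘(ℝ, E) x) (b z) (w z)) y) :
    ContMDiffAt 𝓘(ℝ, E) 𝓘(ℝ, ℝ) ∞ (fun z => g.inner (b z) (v z) (w z)) y := by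
  have : ContMDiffAt 𝓘(ℝ, E) (𝓘(ℝ, E).prod 𝓘(ℝ, ℝ)) ∞
      (fun z => TotalSpace.mk' ℝ (E := Bundle.Trivial M ℝ) (b z) (g.inner (b z) (v z) (w z))) y := by
    apply ContMDiffAt.clm_bundle_apply₂ (F₁ := E) (F₂ := E)
    · exact ContMDiffAt.comp y g.contMDiff.contMDiffAt hb
    · exact hv
    · exact hw
  rw [contMDiffAt_totalSpace] at this
  exact this.2

/-- The metric is smooth as a section of a bundle; evaluating it on the smooth coordinate fields
gives smooth matrix entries, which suffices in finite dimension. -/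
theorem contDiffOn_coeff (x₀ : M) :
    ContDiffOn ℝ ∞ (g.coeff x₀) (extChartAt 𝓘(ℝ, E) x₀).target := by
  rw [contDiffOn_clm_apply]
  intro X
  rw [contDiffOn_clm_apply]
  intro Y y hy
  refine ContDiffAt.contDiffWithinAt ?_
  exact (g.contMDiffAt_inner ((contMDiffOn_extChartAt_symm (I := 𝓘(ℝ, E)) (n := ∞) x₀).contMDiffAt
    (target_mem_nhds hy)) (contMDiffAt_frame hy X) (contMDiffAt_frame hy Y)).contDiffAt

theorem isMetricOn_coeff (x₀ : M) :
    IsMetricOn (g.coeff x₀) (extChartAt 𝓘(ℝ, E) x₀).target where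
  isOpen := isOpen_extChartAt_target x₀
  symm y _ X Y := by
    rw [coeff_apply, coeff_apply]
    exact g.met_symm _ _ _
  pos y hy X hX := by
    rw [coeff_apply]
    exact g.met_pos _ _ fun h => hX (frame_injective hy (by rw [h, map_zero]))
  contDiffOn := g.contDiffOn_coeff x₀

end HermitianMetric

end Complex

/-! ### Hermitian symmetric spaces are Kähler -/

section Symmetric

variable {E : Type*} [NormedAddCommGroup E] [NormedSpace ℂ E] [FiniteDimensional ℂ E]
  {M : Type*} [TopologicalSpace M] [ChartedSpace E M] [IsManifold 𝓘(ℂ, E) ω M]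
  {x₀ x₁ : M} {y : E}

omit [FiniteDimensional ℂ E] in
theorem IsMetricOn.mono {G : E → E →L[ℝ] E →L[ℝ] ℝ} {U U' : Set E} (h : IsMetricOn G U)
    (hU' : IsOpen U') (hs : U' ⊆ U) : IsMetricOn G U' where
  isOpen := hU'
  contDiffOn := h.contDiffOn.mono hs
  symm y hy := h.symm y (hs hy)
  pos y hy := h.pos y (hs hy)

omit [FiniteDimensional ℂ E] [IsManifold 𝓘(ℂ, E) ω M] in
theorem contMDiffAt_real_of_complex {s : M → M} {q : M} (hs : ContMDiffAt 𝓘(ℂ, E) 𝓘(ℂ, E) ω s q) :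
    ContMDiffAt 𝓘(ℝ, E) 𝓘(ℝ, E) ∞ s q := by
  rw [contMDiffAt_iff] at hs ⊢
  exact ⟨hs.1, (hs.2.restrict_scalars ℝ).of_le le_top⟩

namespace HermitianMetric

variable (g : HermitianMetric E M)

/-- The curvature at a point, as a trilinear map on the model space. -/
def curv (p : M) (X Y : E) : E →L[ℝ] E := g.curvature p X Y

theorem curv_eq (p : M) (X Y : E) :
    g.curv p X Y = localCurvature (g.coeff p) (extChartAt 𝓘(ℝ, E) p p) X Y := by
  have hd := (g.isMetricOn_coeff p).differentiableAt_christoffel (mem_extChartAt_target p)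
  rw [localCurvature, ← fderiv_clm_apply_const hd, ← fderiv_clm_apply_const hd]
  rfl

omit [FiniteDimensional ℂ E] in
-- Makes `map_curvature` applicable to changes of charts, and so the curvature independent of the
-- chart.
theorem isIsometryOn_transition (x₀ x₁ : M) :
    IsIsometryOn (g.coeff x₀) (g.coeff x₁)
      ((extChartAt 𝓘(ℝ, E) x₀).target ∩
        (extChartAt 𝓘(ℝ, E) x₀).symm ⁻¹' (extChartAt 𝓘(ℝ, E) x₁).source)
      (extChartAt 𝓘(ℝ, E) x₁).target (transition 𝓘(ℝ, E) x₀ x₁) where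
  contDiffOn y hy := (contDiffAt_transition hy.1 hy.2).contDiffWithinAt
  mapsTo y hy := transition_mem_target hy.2
  surjective y hy := fderiv_transition_surjective hy.1 hy.2
  map_metric y hy X Y := by
    rw [coeff_apply, coeff_apply, frame_transition hy.1 hy.2, symm_transition hy.2]
    rfl

/-- The curvature can be computed in any preferred chart. -/
theorem curv_frame (hy : y ∈ (extChartAt 𝓘(ℝ, E) x₀).target) (X Y Z : E) :
    g.curv ((extChartAt 𝓘(ℝ, E) x₀).symm y) (frame 𝓘(ℝ, E) x₀ y X) (frame 𝓘(ℝ, E) x₀ y Y)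
      (frame 𝓘(ℝ, E) x₀ y Z) = frame 𝓘(ℝ, E) x₀ y (localCurvature (g.coeff x₀) y X Y Z) := by
  set p := (extChartAt 𝓘(ℝ, E) x₀).symm y
  have hG := (g.isMetricOn_coeff x₀).mono ((continuousOn_extChartAt_symm x₀).isOpen_inter_preimage
    (isOpen_extChartAt_target x₀) (isOpen_extChartAt_source (I := 𝓘(ℝ, E)) p)) inter_subset_left
  have h := (g.isIsometryOn_transition x₀ p).map_curvature hG (g.isMetricOn_coeff p)
    ⟨hy, mem_extChartAt_source p⟩ X Y Z
  rw [frame_eq_fderiv hy, h, curv_eq]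
  rfl

variable {g}

/-- The Christoffel symbols of a Hermitian symmetric space are complex bilinear in any
holomorphic chart: they are `-1/2` times the second differential of the symmetry. -/
theorem IsHermitianSymmetric.christoffel_mulI (hg : g.IsHermitianSymmetric)
    (hy : y ∈ (extChartAt 𝓘(ℝ, E) x₀).target) (X Y : E) :
    localChristoffel (g.coeff x₀) y X (mulI E Y) =
      mulI E (localChristoffel (g.coeff x₀) y X Y) := by
  obtain ⟨s, -, hs, hiso, hfix, -, hneg⟩ :=
    hg.exists_symmetry ((extChartAt 𝓘(ℝ, E) x₀).symm y)
  set φ := extChartAt 𝓘(ℝ, E) x₀ with hφ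
  set σ : E → E := φ ∘ s ∘ φ.symm with hσ
  have hsR (q) : ContMDiffAt 𝓘(ℝ, E) 𝓘(ℝ, E) ∞ s q := contMDiffAt_real_of_complex (hs q)
  have hsd (q) : MDifferentiableAt 𝓘(ℝ, E) 𝓘(ℝ, E) s q := (hsR q).mdifferentiableAt (by simp)
  have hcont : ContinuousOn (s ∘ φ.symm) φ.target :=
    hs.continuous.comp_continuousOn (continuousOn_extChartAt_symm x₀)
  let U := φ.target ∩ (s ∘ φ.symm) ⁻¹' φ.source
  have hUo : IsOpen U :=
    hcont.isOpen_inter_preimage (isOpen_extChartAt_target x₀) (isOpen_extChartAt_source x₀)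
  have hyU : y ∈ U := ⟨hy, by
    change s (φ.symm y) ∈ φ.source
    rw [hfix]
    exact φ.map_target hy⟩
  have hσC (z) (hz : z ∈ U) : ContDiffAt ℂ ω σ z := by
    rw [← contMDiffAt_iff_contDiffAt]
    have h1 := (contMDiffOn_extChartAt_symm (I := 𝓘(ℂ, E)) (n := ω) x₀).contMDiffAt
      (target_mem_nhds hz.1)
    have h2 := (contMDiffOn_extChartAt (I := 𝓘(ℂ, E)) (n := ω) (x := x₀)).contMDiffAt
      ((chartAt E x₀).open_source.mem_nhds (x := s (φ.symm z))
        (by rw [← extChartAt_source 𝓘(ℝ, E)]; exact hz.2))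
    exact h2.comp z ((hs (φ.symm z)).comp z h1)
  have hσR (z) (hz : z ∈ U) : ContDiffAt ℝ ∞ σ z := ((hσC z hz).restrict_scalars ℝ).of_le le_top
  have hmet : ∀ z ∈ U, ∀ X Y, g.coeff x₀ (σ z) (fderiv ℝ σ z X) (fderiv ℝ σ z Y) =
      g.coeff x₀ z X Y := by
    intro z hz X Y
    have e1 : φ.symm (σ z) = s (φ.symm z) := φ.left_inv hz.2
    rw [coeff_apply, coeff_apply, ← hφ, e1]
    have e2 := mfderiv_frame (x₀' := x₀) hz.1 (hsd _) hz.2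
    rw [← hφ] at e2
    change ∀ X, _ = frame 𝓘(ℝ, E) x₀ (σ z) (fderiv ℝ σ z X) at e2
    rw [← e2, ← e2]
    exact hiso (φ.symm z) (frame 𝓘(ℝ, E) x₀ z X) (frame 𝓘(ℝ, E) x₀ z Y)
  have hG := (g.isMetricOn_coeff x₀).mono hUo inter_subset_left
  have hI : IsIsometryOn (g.coeff x₀) (g.coeff x₀) U φ.target σ :=
    { contDiffOn := fun z hz => (hσR z hz).contDiffWithinAt
      mapsTo := fun z hz => φ.map_source hz.2
      surjective := fun z hz => by
        refine (LinearMap.injective_iff_surjective (f := (fderiv ℝ σ z).toLinearMap)).1 ?_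
        rw [injective_iff_map_eq_zero]
        intro X hX
        by_contra hne
        have h1 := hG.pos z hz X hne
        rw [← hmet z hz] at h1
        change fderiv ℝ σ z X = 0 at hX
        simp [hX] at h1
      map_metric := hmet }
  have hσy : σ y = y := by
    change φ (s (φ.symm y)) = y
    rw [hfix, φ.right_inv hy]
  have hDσ (X : E) : fderiv ℝ σ y X = -X := by
    apply frame_injective hy
    have e2 := mfderiv_frame (x₀' := x₀) hyU.1 (hsd _) hyU.2 X
    rw [← hφ] at e2
    change _ = frame 𝓘(ℝ, E) x₀ (σ y) (fderiv ℝ σ y X) at e2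
    rw [hσy] at e2
    rw [← e2, hneg, map_neg]
  -- At the fixed point the law `dσ Γ(X, Y) = Γ(dσ X, dσ Y) + D²σ(X, Y)` with `dσ = -1` reads `-Γ =
  -- Γ + D²σ`.
  have hΓ (X Y : E) : fderiv ℝ (fderiv ℝ σ) y X Y =
      -(2 : ℝ) • localChristoffel (g.coeff x₀) y X Y := by
    have h := hI.map_christoffel hG (g.isMetricOn_coeff x₀) hyU X Y
    rw [hσy, hDσ, hDσ, hDσ, map_neg, map_neg, neg_apply, neg_neg] at h
    rw [← sub_eq_iff_eq_add'] at h
    rw [← h]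
    module
  -- `σ` is holomorphic around `y`, so `dσ` commutes with `I` on a neighbourhood and `D²σ` commutes
  -- with it in its last argument.
  have hcomm := fderiv_commute (A := fderiv ℝ σ) (y := y)
    ((contDiffAt_fderiv_infty (hσR y hyU)).differentiableAt (by simp)) (mulI E) (mulI E)
    (Filter.mem_of_superset (hUo.mem_nhds hyU) fun z hz w =>
      fderiv_mulI ((hσC z hz).differentiableAt (by simp)) w) X Y
  rw [hΓ, hΓ, map_smul] at hcomm
  exact smul_right_injective E (by norm_num : -(2 : ℝ) ≠ 0) hcomm

theorem IsHermitianSymmetric.isKahlerOn (hg : g.IsHermitianSymmetric) (x₀ : M) :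
    IsKahlerOn (g.coeff x₀) (extChartAt 𝓘(ℝ, E) x₀).target where
  toIsMetricOn := g.isMetricOn_coeff x₀
  hermitian y hy X Y := by
    rw [coeff_apply, coeff_apply, frame_mulI hy, frame_mulI hy, met_hermitian]
  christoffel_mulI y hy X Y := hg.christoffel_mulI hy X Y

/-- `I R(I Z, Z)` at a point of the manifold. -/
theorem IsHermitianSymmetric.isNonneg (hg : g.IsHermitianSymmetric) (hK : g.NonnegCurvature)
    (p : M) (Z : E) : IsNonneg (g.met p) (mulI E ∘L g.curv p (mulI E Z) Z) := by
  have h := (hg.isKahlerOn p).curvOp_isNonneg (mem_extChartAt_target p) (fun X Y => by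
    rw [coeff_self, ← curv_eq]
    exact hK p X Y) Z
  rw [coeff_self] at h
  rw [curv_eq]
  exact h

end HermitianMetric

end Symmetric

/-! ### The charts of the cotangent bundle -/

section CotangentChart

variable {E : Type*} [NormedAddCommGroup E] [NormedSpace ℂ E] [FiniteDimensional ℂ E]
  {M : Type*} [TopologicalSpace M] [ChartedSpace E M] [IsManifold 𝓘(ℂ, E) ω M]

omit [FiniteDimensional ℂ E] in
instance realManifoldCotangent : IsManifold (cotR E) ∞ (Cotangent E M) := by
  apply isManifold_of_contDiffOn
  intro e e' he he'
  have h := (contDiffGroupoid ω (cotC E)).compatible he he'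
  rw [contDiffGroupoid, mem_groupoid_of_pregroupoid] at h
  have h2 : ContDiffOn ℂ ω (cotC E ∘ (e.symm.trans e') ∘ (cotC E).symm)
      ((cotC E).symm ⁻¹' (e.symm.trans e').source ∩ range (cotC E)) := h.1
  exact (h2.restrict_scalars ℝ).of_le le_top

instance boundarylessCotangent : (cotR E).Boundaryless := inferInstance

/-- The complex functional underlying a cotangent vector. -/
def functional (v : Cotangent E M) : E →L[ℂ] ℂ := v.2

variable {v₀ v₁ v : Cotangent E M} {c : E × (E →L[ℂ] ℂ)}

omit [FiniteDimensional ℂ E] in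
theorem cot_baseSet (x : M) : (trivializationAt (E →L[ℂ] ℂ)
    (fun x : M => TangentSpace 𝓘(ℂ, E) x →L[ℂ] Bundle.Trivial M ℂ x) x).baseSet =
      (chartAt E x).source := by
  rw [hom_trivializationAt_baseSet]
  simp

omit [FiniteDimensional ℂ E] in
theorem mem_cot_source : v ∈ (extChartAt (cotR E) v₀).source ↔
    v.1 ∈ (extChartAt 𝓘(ℝ, E) v₀.1).source := by
  rw [FiberBundle.extChartAt, PartialEquiv.trans_source]
  rw [Trivialization.source_eq, cot_baseSet]
  simp only [mfld_simps]
  constructor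
  · exact fun h => h.1
  · intro h
    refine ⟨h, ?_⟩
    rw [Trivialization.coe_fst']
    · exact h
    · rwa [cot_baseSet]

omit [FiniteDimensional ℂ E] in
theorem mem_cot_target : c ∈ (extChartAt (cotR E) v₀).target ↔
    c.1 ∈ (extChartAt 𝓘(ℝ, E) v₀.1).target := by
  rw [FiberBundle.extChartAt_target, cot_baseSet]
  constructor
  · exact fun h => h.1.1
  · intro h
    refine ⟨⟨h, ?_⟩, mem_univ _⟩
    have := (extChartAt 𝓘(ℝ, E) v₀.1).map_target h
    rwa [extChartAt_source] at this

omit [FiniteDimensional ℂ E] in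
theorem cot_chart_fst :
    (extChartAt (cotR E) v₀ v).1 = extChartAt 𝓘(ℝ, E) v₀.1 v.1 := by
  rw [FiberBundle.extChartAt]
  rfl

omit [FiniteDimensional ℂ E] in
-- The bundle chart of `T*M` is the canonical one: the fibre coordinate is the functional `v` on the
-- coordinate fields of the base chart. Hence the tautological form becomes `w dz`.
theorem cot_chart_snd (h : v ∈ (extChartAt (cotR E) v₀).source) (a : E) :
    (extChartAt (cotR E) v₀ v).2 a =
      functional v (frame 𝓘(ℝ, E) v₀.1 (extChartAt 𝓘(ℝ, E) v₀.1 v.1) a) := by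
  have h' := mem_cot_source.1 h
  have h'' : v.1 ∈ (chartAt E v₀.1).source := by rwa [extChartAt_source] at h'
  have e1 : (extChartAt (cotR E) v₀ v).2 = (v.2 : E →L[ℂ] ℂ) ∘L
    ((trivializationAt E (TangentSpace 𝓘(ℂ, E)) v₀.1).symmL ℂ v.1 : E →L[ℂ] E) := by
    rw [FiberBundle.extChartAt]
    change (trivializationAt (E →L[ℂ] ℂ)
      (fun x : M => TangentSpace 𝓘(ℂ, E) x →L[ℂ] Bundle.Trivial M ℂ x) v₀.1 v).2 = _
    rw [hom_trivializationAt_apply]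
    rw [ContinuousLinearMap.inCoordinates]
    ext a
    simp
  rw [e1]
  have e2 : ((trivializationAt E (TangentSpace 𝓘(ℂ, E)) v₀.1).symmL ℂ v.1 : E →L[ℂ] E) =
      fderiv ℂ (transition 𝓘(ℝ, E) v₀.1 v.1) (extChartAt 𝓘(ℝ, E) v₀.1 v.1) := by
    rw [TangentBundle.symmL_trivializationAt_eq_core h'']
    change fderivWithin ℂ _ (range id) _ = _
    rw [range_id, fderivWithin_univ]
    rfl
  have e3 := (extChartAt 𝓘(ℝ, E) v₀.1).left_inv h'
  have e4 := contDiffAt_transition_complex ((extChartAt 𝓘(ℝ, E) v₀.1).map_source h')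
    (mem_extChartAt_source (I := 𝓘(ℝ, E)) ((extChartAt 𝓘(ℝ, E) v₀.1).symm
      (extChartAt 𝓘(ℝ, E) v₀.1 v.1)))
  rw [e2, frame_eq_fderiv ((extChartAt 𝓘(ℝ, E) v₀.1).map_source h')]
  rw [e3] at e4 ⊢
  rw [(e4.differentiableAt (by simp)).fderiv_restrictScalars ℝ]
  rfl

omit [FiniteDimensional ℂ E] in
theorem cot_symm_fst (h : c ∈ (extChartAt (cotR E) v₀).target) :
    ((extChartAt (cotR E) v₀).symm c).1 = (extChartAt 𝓘(ℝ, E) v₀.1).symm c.1 := by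
  have h1 := mem_cot_source.1 ((extChartAt (cotR E) v₀).map_target h)
  rw [← (extChartAt 𝓘(ℝ, E) v₀.1).left_inv h1, ← cot_chart_fst,
    (extChartAt (cotR E) v₀).right_inv h]

omit [FiniteDimensional ℂ E] in
theorem functional_cot_symm (h : c ∈ (extChartAt (cotR E) v₀).target) (a : E) :
    functional ((extChartAt (cotR E) v₀).symm c) (frame 𝓘(ℝ, E) v₀.1 c.1 a) = c.2 a := by
  have h1 := cot_chart_snd ((extChartAt (cotR E) v₀).map_target h) a
  rw [← cot_chart_fst, (extChartAt (cotR E) v₀).right_inv h] at h1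
  exact h1.symm

omit [FiniteDimensional ℂ E] in
theorem cot_chart_self : extChartAt (cotR E) v₀ v₀ =
    (extChartAt 𝓘(ℝ, E) v₀.1 v₀.1, functional v₀) := by
  refine Prod.ext cot_chart_fst (ContinuousLinearMap.ext fun a => ?_)
  rw [cot_chart_snd (mem_extChartAt_source v₀), frame_self]
  rfl

/-- Multiplication by a complex number in the fibres. -/
def fiberSmul (t : ℂ) (v : Cotangent E M) : Cotangent E M := ⟨v.1, t • v.2⟩

omit [FiniteDimensional ℂ E] [IsManifold 𝓘(ℂ, E) ω M] in
theorem functional_fiberSmul (t : ℂ) : functional (fiberSmul t v) = t • functional v := rfl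

omit [FiniteDimensional ℂ E] [IsManifold 𝓘(ℂ, E) ω M] in
theorem fiberSmul_fst (t : ℂ) : (fiberSmul t v).1 = v.1 := rfl

omit [FiniteDimensional ℂ E] [IsManifold 𝓘(ℂ, E) ω M] in
theorem rotate_eq_fiberSmul (θ : ℝ) :
    rotate θ v = fiberSmul (Complex.exp (θ * Complex.I)) v := rfl

omit [FiniteDimensional ℂ E] in
theorem fiberSmul_mem_source (t : ℂ) (hv : v ∈ (extChartAt (cotR E) v₀).source) :
    fiberSmul t v ∈ (extChartAt (cotR E) v₀).source := by
  rw [mem_cot_source, fiberSmul_fst]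
  exact mem_cot_source.1 hv

omit [FiniteDimensional ℂ E] in
theorem cot_chart_smul (t : ℂ) (hv : v ∈ (extChartAt (cotR E) v₀).source) :
    extChartAt (cotR E) v₀ (fiberSmul t v) =
      ((extChartAt (cotR E) v₀ v).1, t • (extChartAt (cotR E) v₀ v).2) := by
  refine Prod.ext ?_ (ContinuousLinearMap.ext fun a => ?_)
  · rw [cot_chart_fst, cot_chart_fst, fiberSmul_fst]
  · rw [cot_chart_snd (fiberSmul_mem_source t hv), fiberSmul_fst, functional_fiberSmul,
      smul_apply, smul_apply, cot_chart_snd hv]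

omit [FiniteDimensional ℂ E] in
theorem cot_symm_smul (h : c ∈ (extChartAt (cotR E) v₀).target) (t : ℂ) :
    (extChartAt (cotR E) v₀).symm (c.1, t • c.2) =
      fiberSmul t ((extChartAt (cotR E) v₀).symm c) := by
  have hv := (extChartAt (cotR E) v₀).map_target h
  have h1 := cot_chart_smul t hv
  rw [(extChartAt (cotR E) v₀).right_inv h] at h1
  rw [← h1, (extChartAt (cotR E) v₀).left_inv (fiberSmul_mem_source t hv)]

omit [FiniteDimensional ℂ E] in
theorem fderiv_cot_transition_mulI (hc : c ∈ (extChartAt (cotR E) v₀).target)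
    (h : (extChartAt (cotR E) v₀).symm c ∈ (extChartAt (cotR E) v₁).source)
    (ξ : E × (E →L[ℂ] ℂ)) :
    fderiv ℝ (transition (cotR E) v₀ v₁) c (mulI _ ξ) =
      mulI _ (fderiv ℝ (transition (cotR E) v₀ v₁) c ξ) := by
  refine fderiv_mulI (ContDiffAt.differentiableAt (n := ω) ?_ (by simp)) ξ
  refine (contDiffOn_ext_coord_change (I := cotC E) (n := ω) v₁ v₀).contDiffAt ?_
  filter_upwards [eventually_mem_source hc h] with z hz
  rw [PartialEquiv.trans_source, PartialEquiv.symm_source]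
  exact hz

omit [FiniteDimensional ℂ E] in
theorem cot_frame_mulI (hc : c ∈ (extChartAt (cotR E) v₀).target) (ξ : E × (E →L[ℂ] ℂ)) :
    frame (cotR E) v₀ c (mulI _ ξ) = mulI _ (frame (cotR E) v₀ c ξ) := by
  rw [frame_eq_fderiv hc]
  exact fderiv_cot_transition_mulI hc (mem_extChartAt_source _) ξ

omit [FiniteDimensional ℂ E] in
theorem contMDiff_proj_cotangent :
    ContMDiff (cotR E) 𝓘(ℝ, E) ∞ (proj : Cotangent E M → M) :=
  contMDiff_proj _

omit [FiniteDimensional ℂ E] in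
theorem mfderiv_proj_frame (hc : c ∈ (extChartAt (cotR E) v₀).target) (ξ : E × (E →L[ℂ] ℂ)) :
    (mfderiv (cotR E) 𝓘(ℝ, E) proj ((extChartAt (cotR E) v₀).symm c) : E × (E →L[ℂ] ℂ) →L[ℝ] E)
      (frame (cotR E) v₀ c ξ) = frame 𝓘(ℝ, E) v₀.1 c.1 ξ.1 := by
  have e0 : proj ((extChartAt (cotR E) v₀).symm c) = (extChartAt 𝓘(ℝ, E) v₀.1).symm c.1 :=
    cot_symm_fst hc
  have hs := mem_cot_source.1 ((extChartAt (cotR E) v₀).map_target hc)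
  have h := mfderiv_frame (f := (proj : Cotangent E M → M)) (x₀' := v₀.1) hc
    ((contMDiff_proj_cotangent _).mdifferentiableAt (by simp)) hs ξ
  rw [h, e0, (extChartAt 𝓘(ℝ, E) v₀.1).right_inv (mem_cot_target.1 hc)]
  have e1 : extChartAt 𝓘(ℝ, E) v₀.1 ∘ proj ∘ (extChartAt (cotR E) v₀).symm =ᶠ[𝓝 c] Prod.fst := by
    filter_upwards [target_mem_nhds hc] with z hz
    change extChartAt 𝓘(ℝ, E) v₀.1 ((extChartAt (cotR E) v₀).symm z).1 = _
    rw [cot_symm_fst hz, (extChartAt 𝓘(ℝ, E) v₀.1).right_inv (mem_cot_target.1 hz)]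
  rw [e1.fderiv_eq, fderiv_fst]
  rfl

end CotangentChart

/-! ### Functions `(φ(I R(I v, v)) v, v)` on the cotangent bundle -/

section Quad

variable {E : Type*} [NormedAddCommGroup E] [NormedSpace ℂ E] [FiniteDimensional ℂ E]
  {M : Type*} [TopologicalSpace M] [ChartedSpace E M] [IsManifold 𝓘(ℂ, E) ω M]

/-- The real part of a complex functional. -/
def reDual (w : E →L[ℂ] ℂ) : E →L[ℝ] ℝ := Complex.reCLM ∘L w.restrictScalars ℝ

theorem contDiff_reDual : ContDiff ℝ ∞ (reDual : (E →L[ℂ] ℂ) → E →L[ℝ] ℝ) := by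
  rw [contDiff_clm_apply_iff]
  intro a
  exact (Complex.reCLM ∘L (ContinuousLinearMap.apply ℂ ℂ a).restrictScalars ℝ).contDiff

/-- The vector dual to the real part of `w` for the metric `G`. -/
def localSharp (G : E → E →L[ℝ] E →L[ℝ] ℝ) (c : E × (E →L[ℂ] ℂ)) : E :=
  (G c.1).inverse (reDual c.2)

variable {v₀ v : Cotangent E M} {c : E × (E →L[ℂ] ℂ)} {G : E → E →L[ℝ] E →L[ℝ] ℝ} {U : Set E}

theorem IsMetricOn.contDiffAt_localSharp (hG : IsMetricOn G U) (hc : c.1 ∈ U) :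
    ContDiffAt ℝ ∞ (localSharp G) c :=
  ContDiffAt.clm_apply
    (contDiffAt_clm_inverse ((hG.contDiffAt hc).comp c contDiffAt_fst)
      (isInvertible_of_pos (hG.pos _ hc)))
    (contDiff_reDual.contDiffAt.comp c contDiffAt_snd)

theorem IsMetricOn.contDiffAt_localCurvOp (hG : IsMetricOn G U) (hc : c.1 ∈ U) :
    ContDiffAt ℝ ∞ (fun c : E × (E →L[ℂ] ℂ) => localCurvOp G c.1 (localSharp G c)) c := by
  have h1 : ContDiffAt ℝ ∞ (fun c : E × (E →L[ℂ] ℂ) => localChristoffel G c.1) c :=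
    (hG.contDiffAt_christoffel hc).comp c contDiffAt_fst
  have h2 : ContDiffAt ℝ ∞ (fun c : E × (E →L[ℂ] ℂ) => fderiv ℝ (localChristoffel G) c.1) c :=
    (hG.contDiffAt_curvature hc).comp c contDiffAt_fst
  have h3 := hG.contDiffAt_localSharp hc
  have h4 : ContDiffAt ℝ ∞ (fun c => mulI E (localSharp G c)) c :=
    (mulI E).contDiff.contDiffAt.comp c h3
  exact contDiffAt_const.clm_comp (((((h2.clm_apply h3).clm_apply h4).sub
    ((h2.clm_apply h4).clm_apply h3)).add ((h1.clm_apply h3).clm_comp (h1.clm_apply h4))).sub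
    ((h1.clm_apply h4).clm_comp (h1.clm_apply h3)))

namespace HermitianMetric

variable (g : HermitianMetric E M)

/-- The dual vector of a cotangent vector, in the model space. -/
def dualVector (v : Cotangent E M) : E := g.sharp v

/-- The transformation `I R(I v, v)`, as an endomorphism of the model space. -/
def curvEnd (v : Cotangent E M) : E →L[ℝ] E :=
  mulI E ∘L g.curv v.1 (mulI E (g.dualVector v)) (g.dualVector v)

omit [FiniteDimensional ℂ E] in
theorem quad_eq (φ : ℝ → ℝ) (v : Cotangent E M) :
    g.quad φ v = g.met v.1 (funCalc φ (g.curvEnd v).toLinearMap (g.dualVector v))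
      (g.dualVector v) := rfl

theorem met_dualVector (v : Cotangent E M) (X : E) :
    g.met v.1 (g.dualVector v) X = (functional v X).re := by
  have h := apply_inverse_of_pos (g.met_pos v.1) (reDual (functional v))
  exact congrArg (fun α : E →L[ℝ] ℝ => α X) h

theorem dualVector_eq_iff {Z : E} :
    g.dualVector v = Z ↔ ∀ X, g.met v.1 Z X = (functional v X).re := by
  constructor
  · rintro rfl
    exact g.met_dualVector v
  · intro h
    exact eq_of_forall_apply_eq (g.met_pos v.1) fun X => by rw [met_dualVector, h]

theorem curvEnd_eq (v : Cotangent E M) : g.curvEnd v =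
    localCurvOp (g.coeff v.1) (extChartAt 𝓘(ℝ, E) v.1 v.1) (g.dualVector v) := by
  rw [curvEnd, curv_eq]
  rfl

theorem dualVector_cot_symm (hc : c ∈ (extChartAt (cotR E) v₀).target) :
    g.dualVector ((extChartAt (cotR E) v₀).symm c) =
      frame 𝓘(ℝ, E) v₀.1 c.1 (localSharp (g.coeff v₀.1) c) := by
  rw [dualVector_eq_iff]
  intro X
  obtain ⟨X, rfl⟩ := frame_surjective (mem_cot_target.1 hc) X
  rw [functional_cot_symm hc, cot_symm_fst hc, ← coeff_apply, localSharp,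
    apply_inverse_of_pos ((g.isMetricOn_coeff v₀.1).pos _ (mem_cot_target.1 hc))]
  rfl

theorem curvEnd_cot_symm (hc : c ∈ (extChartAt (cotR E) v₀).target) (X : E) :
    g.curvEnd ((extChartAt (cotR E) v₀).symm c) (frame 𝓘(ℝ, E) v₀.1 c.1 X) =
      frame 𝓘(ℝ, E) v₀.1 c.1
        (localCurvOp (g.coeff v₀.1) c.1 (localSharp (g.coeff v₀.1) c) X) := by
  have hc' := mem_cot_target.1 hc
  rw [curvEnd, dualVector_cot_symm _ hc, cot_symm_fst hc, ← frame_mulI hc',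
    ContinuousLinearMap.comp_apply, curv_frame _ hc', ← frame_mulI hc']
  rfl

variable {g} (hg : g.IsHermitianSymmetric) (hK : g.NonnegCurvature)
include hg hK

theorem isNonneg_curvEnd (v : Cotangent E M) : IsNonneg (g.met v.1) (g.curvEnd v) :=
  hg.isNonneg hK v.1 _

omit hK in
theorem curvEnd_mulI (v : Cotangent E M) (X : E) :
    g.curvEnd v (mulI E X) = mulI E (g.curvEnd v X) := by
  rw [curvEnd_eq, (hg.isKahlerOn v.1).curvOp_mulI (mem_extChartAt_target _)]

theorem curvOp_properties (v : Cotangent E M) (X Y : TangentSpace 𝓘(ℝ, E) (proj v)) :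
    g.curvOp v (cxI 𝓘(ℝ, E) (proj v) X) = cxI 𝓘(ℝ, E) (proj v) (g.curvOp v X) ∧
      g.inner (proj v) (g.curvOp v X) Y = g.inner (proj v) X (g.curvOp v Y) ∧
      0 ≤ g.inner (proj v) (g.curvOp v X) X :=
  ⟨curvEnd_mulI hg v X, (isNonneg_curvEnd hg hK v).selfAdjoint X Y,
    (isNonneg_curvEnd hg hK v).nonneg X⟩

theorem isNonneg_localCurvOp {x₀ : M} {y : E} (hy : y ∈ (extChartAt 𝓘(ℝ, E) x₀).target) (Z : E) :
    IsNonneg (g.coeff x₀ y) (localCurvOp (g.coeff x₀) y Z) := by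
  refine (hg.isKahlerOn x₀).curvOp_isNonneg hy (fun X Y => ?_) Z
  rw [coeff_apply, ← curv_frame _ hy]
  exact hK _ (frame 𝓘(ℝ, E) x₀ y X) (frame 𝓘(ℝ, E) x₀ y Y)

/-- Interpolation at the eigenvalues does not depend visibly smoothly on the operator. Near a given
covector it is replaced by the convergent power series `Ψ`; the two agree because they agree on
eigenvectors. -/
theorem contMDiff_quad {φ : ℝ → ℝ} (hφ : HasHolomorphicExtension φ) :
    ContMDiff (cotR E) 𝓘(ℝ, ℝ) ∞ (g.quad φ) := by
  intro v₀
  rw [contMDiffAt_iff_source, ModelWithCorners.Boundaryless.range_eq_univ, contMDiffWithinAt_univ,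
    contMDiffAt_iff_contDiffAt]
  set c₀ := extChartAt (cotR E) v₀ v₀ with hc₀
  have hc : c₀ ∈ (extChartAt (cotR E) v₀).target := mem_extChartAt_target v₀
  have hG := g.isMetricOn_coeff v₀.1
  have hA := hG.contDiffAt_localCurvOp (mem_cot_target.1 hc)
  have hZ := hG.contDiffAt_localSharp (mem_cot_target.1 hc)
  obtain ⟨Ψ, hΨ, hev⟩ := (isNonneg_localCurvOp hg hK (mem_cot_target.1 hc)
    (localSharp (g.coeff v₀.1) c₀)).exists_contDiffAt_calculus hφ
  have hsm : ContDiffAt ℝ ∞ (fun c => g.coeff v₀.1 c.1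
      (Ψ (localCurvOp (g.coeff v₀.1) c.1 (localSharp (g.coeff v₀.1) c))
        (localSharp (g.coeff v₀.1) c)) (localSharp (g.coeff v₀.1) c)) c₀ :=
    ((((hG.contDiffAt (mem_cot_target.1 hc)).comp c₀ contDiffAt_fst).clm_apply
      ((hΨ.comp c₀ hA).clm_apply hZ)).clm_apply hZ)
  refine hsm.congr_of_eventuallyEq ?_
  filter_upwards [target_mem_nhds hc, hA.continuousAt.eventually hev] with c hc hev
  have hc' := mem_cot_target.1 hc
  -- The frame intertwines the operator in coordinates with the one on the tangent space, hence
  -- carries eigenvectors to eigenvectors for the same eigenvalue.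
  have hS : (funCalc φ (g.curvEnd ((extChartAt (cotR E) v₀).symm c)).toLinearMap) ∘ₗ
      (frame 𝓘(ℝ, E) v₀.1 c.1).toLinearMap = (frame 𝓘(ℝ, E) v₀.1 c.1).toLinearMap ∘ₗ
        (Ψ (localCurvOp (g.coeff v₀.1) c.1 (localSharp (g.coeff v₀.1) c))).toLinearMap := by
    refine (isNonneg_localCurvOp hg hK hc' (localSharp (g.coeff v₀.1) c)).eq_of_eigenvectors
      fun l hl X hX => ?_
    rw [LinearMap.comp_apply, LinearMap.comp_apply]
    refine (funCalc_apply φ _ l _ ?_).trans ?_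
    · change g.curvEnd _ (frame 𝓘(ℝ, E) v₀.1 c.1 X) = l • frame 𝓘(ℝ, E) v₀.1 c.1 X
      rw [curvEnd_cot_symm _ hc, hX, map_smul]
    · change φ l • frame 𝓘(ℝ, E) v₀.1 c.1 X = frame 𝓘(ℝ, E) v₀.1 c.1 _
      rw [← map_smul]
      exact congrArg _ (hev l hl X hX).symm
  have hS' := LinearMap.congr_fun hS (localSharp (g.coeff v₀.1) c)
  rw [LinearMap.comp_apply, LinearMap.comp_apply] at hS'
  rw [Function.comp_apply, quad_eq, dualVector_cot_symm _ hc]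
  refine (congrArg (fun X => g.met _ X _) hS').trans ?_
  rw [cot_symm_fst hc]
  rfl

/-- All three quadratic functions are sums over the same non-negative spectrum, so a relation valid
for `u ≥ 0` is enough. -/
theorem quad_combination {φ φ' ψ : ℝ → ℝ} {a : ℝ} (h : ∀ u, 0 ≤ u → φ u + a * φ' u = ψ u)
    (v : Cotangent E M) : g.quad φ v + a * g.quad φ' v = g.quad ψ v := by
  obtain ⟨n, l, b, hl, hs⟩ :=
    (isNonneg_curvEnd hg hK v).exists_funCalc_eq_sum (g.dualVector v)
  have hs1 (φ : ℝ → ℝ) : g.quad φ v = ∑ i, φ (l i) * b i := by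
    have := hs φ 1
    simp only [one_smul, one_mul] at this
    rw [quad_eq, this]
  rw [hs1, hs1, hs1, Finset.mul_sum, ← Finset.sum_add_distrib]
  refine Finset.sum_congr rfl fun i _ => ?_
  rw [← h _ (hl i)]
  ring

omit hK hg in
-- The identification of covectors with vectors through `Re v` is conjugate linear, whence the sign
-- of the imaginary part.
theorem dualVector_fiberSmul (t : ℂ) (v : Cotangent E M) :
    g.dualVector (fiberSmul t v) = t.re • g.dualVector v + (-t.im) • mulI E (g.dualVector v) := by
  rw [dualVector_eq_iff]
  intro X
  rw [fiberSmul_fst, functional_fiberSmul, map_add, map_smul, map_smul, add_apply, smul_apply,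
    smul_apply, hermitian_skew (g.met_hermitian v.1), met_dualVector, met_dualVector]
  have : functional v (mulI E X) = Complex.I * functional v X := (functional v).map_smul _ _
  rw [this, smul_apply]
  simp
  ring

omit hg hK in
theorem curvEnd_fiberSmul_of_norm {t : ℂ} (ht : t.re ^ 2 + t.im ^ 2 = 1) (v : Cotangent E M) :
    g.curvEnd (fiberSmul t v) = g.curvEnd v := by
  rw [curvEnd_eq, curvEnd_eq, dualVector_fiberSmul, localCurvOp_rotate (by rw [neg_sq, ht])]
  rfl

theorem funCalc_mulI (φ : ℝ → ℝ) (v : Cotangent E M) (X : E) :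
    funCalc φ (g.curvEnd v).toLinearMap (mulI E X) =
      mulI E (funCalc φ (g.curvEnd v).toLinearMap X) := by
  have h : funCalc φ (g.curvEnd v).toLinearMap ∘ₗ (mulI E).toLinearMap =
      (mulI E).toLinearMap ∘ₗ funCalc φ (g.curvEnd v).toLinearMap := by
    refine (isNonneg_curvEnd hg hK v).eq_of_eigenvectors fun l _ X hX => ?_
    rw [LinearMap.comp_apply, LinearMap.comp_apply, funCalc_apply φ _ l X hX, map_smul]
    refine funCalc_apply φ _ l _ ?_
    change g.curvEnd v (mulI E X) = l • mulI E X
    rw [curvEnd_mulI hg, hX, map_smul]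
  exact LinearMap.congr_fun h X

/-- Invariance under the action of the circle. -/
theorem quad_fiberSmul_of_norm (φ : ℝ → ℝ) {t : ℂ} (ht : t.re ^ 2 + t.im ^ 2 = 1)
    (v : Cotangent E M) : g.quad φ (fiberSmul t v) = g.quad φ v := by
  rw [quad_eq, quad_eq, curvEnd_fiberSmul_of_norm ht, dualVector_fiberSmul, fiberSmul_fst]
  simp only [map_add, map_smul, add_apply, smul_apply, funCalc_mulI hg hK, smul_eq_mul]
  rw [met_hermitian, hermitian_skew (g.met_hermitian v.1)]
  linear_combination (g.met v.1 (funCalc φ (g.curvEnd v).toLinearMap (g.dualVector v))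
      (g.dualVector v)) * ht

/-- The dual vector scales by `t` and the operator by `t²`, with the same eigenvectors; the spectral
data do not depend on `t` or `φ`. -/
theorem quad_fiberSmul_real (v : Cotangent E M) :
    ∃ (n : ℕ) (l a : Fin n → ℝ), (∀ i, 0 ≤ l i) ∧ ∀ (φ : ℝ → ℝ) (t : ℝ),
      g.quad φ (fiberSmul t v) = t ^ 2 * ∑ i, φ (t ^ 2 * l i) * a i := by
  obtain ⟨n, l, a, hl, hs⟩ :=
    (isNonneg_curvEnd hg hK v).exists_funCalc_eq_sum (g.dualVector v)
  refine ⟨n, l, a, hl, fun φ t => ?_⟩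
  have h1 : g.dualVector (fiberSmul t v) = t • g.dualVector v := by
    rw [dualVector_fiberSmul]
    simp
  have h2 : g.curvEnd (fiberSmul t v) = t ^ 2 • g.curvEnd v := by
    rw [curvEnd_eq, h1, localCurvOp_smul_real, curvEnd_eq]
    rfl
  rw [← hs, quad_eq, h1, h2, fiberSmul_fst]
  simp only [map_smul, smul_apply, smul_eq_mul]
  ring

/-- Term by term in the spectral sum, this is `hasDerivAt_sq_mul_bgF`. It is what dictates the
formula for the moment map. -/
theorem hasDerivAt_potential_fiberSmul (v : Cotangent E M) :
    HasDerivAt (fun t : ℝ => g.potential (fiberSmul t v)) (-g.mu v) 1 := by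
  obtain ⟨n, l, a, hl, hs⟩ := quad_fiberSmul_real hg hK v
  have h1 : ∀ i, HasDerivAt (fun t : ℝ => t ^ 2 * bgF (t ^ 2 * l i) * a i)
      (2 * deriv (fun u => u * bgF u) (l i) * a i) 1 :=
    fun i => (hasDerivAt_sq_mul_bgF (hl i)).mul_const (a i)
  have h2 := HasDerivAt.fun_sum (u := Finset.univ) fun i _ => h1 i
  have h3 : g.quad (deriv fun u => u * bgF u) v =
      ∑ i, deriv (fun u => u * bgF u) (l i) * a i := by
    have := hs (deriv fun u => u * bgF u) 1
    simp only [one_pow, one_mul] at this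
    rw [← this]
    congr 1
    simp [fiberSmul]
  refine (h2.congr_deriv ?_).congr_of_eventuallyEq (Eventually.of_forall fun t => ?_)
  · rw [mu, h3, Finset.mul_sum, ← Finset.sum_neg_distrib]
    exact Finset.sum_congr rfl fun i _ => by ring
  · change g.quad bgF (fiberSmul t v) = _
    rw [hs, Finset.mul_sum]
    exact Finset.sum_congr rfl fun i _ => by ring

theorem potential_add_mu (v : Cotangent E M) : g.potential v + g.mu v = g.hypPotential v :=
  quad_combination hg hK (fun u hu => by rw [← bgF_sub_deriv hu]; ring) v

theorem contMDiff_potential : ContMDiff (cotR E) 𝓘(ℝ, ℝ) ∞ g.potential :=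
  contMDiff_quad hg hK hasHolomorphicExtension_bgF

theorem contMDiff_hypPotential : ContMDiff (cotR E) 𝓘(ℝ, ℝ) ∞ g.hypPotential :=
  contMDiff_quad hg hK hasHolomorphicExtension_bgG

/-- Obtained from `μ = k - h`, so no holomorphic extension of `(u f)'` has to be constructed. -/
theorem contMDiff_mu : ContMDiff (cotR E) 𝓘(ℝ, ℝ) ∞ g.mu := by
  have h := (contMDiff_hypPotential hg hK).sub (contMDiff_potential hg hK)
  refine h.congr fun v => ?_
  rw [← potential_add_mu hg hK]
  ring

end HermitianMetric

end Quad

/-! ### The form `dd^c u` in coordinates, and the moment map -/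

section LowDegree

variable {V : Type*} [NormedAddCommGroup V] [NormedSpace ℝ V]
  {F : Type*} [NormedAddCommGroup F] [NormedSpace ℝ F]

/-- A linear form as an alternating form of degree one. -/
def toAlt (V F : Type*) [NormedAddCommGroup V] [NormedSpace ℝ V] [NormedAddCommGroup F]
    [NormedSpace ℝ F] : (V →L[ℝ] F) →L[ℝ] (V [⋀^Fin 1]→L[ℝ] F) :=
  ((ContinuousAlternatingMap.ofSubsingletonLIE (𝕜 := ℝ) (E := V) (F := F)
      (0 : Fin 1)).toContinuousLinearEquiv : (V →L[ℝ] F) →L[ℝ] (V [⋀^Fin 1]→L[ℝ] F))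

theorem toAlt_apply (α : V →L[ℝ] F) (X : Fin 1 → V) : toAlt V F α X = α (X 0) := rfl

theorem extDeriv_toAlt {α : V → V →L[ℝ] F} {y : V} (hα : DifferentiableAt ℝ α y) (ξ ζ : V) :
    extDeriv (fun z => toAlt V F (α z)) y ![ξ, ζ] = fderiv ℝ α y ξ ζ - fderiv ℝ α y ζ ξ := by
  have h : fderiv ℝ (fun z => toAlt V F (α z)) y = toAlt V F ∘L fderiv ℝ α y :=
    ((toAlt V F).hasFDerivAt.comp y hα.hasFDerivAt).fderiv
  rw [extDeriv, h, ContinuousAlternatingMap.alternatizeUncurryFin_apply, Fin.sum_univ_two]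
  simp [toAlt_apply, Fin.removeNth, sub_eq_add_neg]

theorem extDeriv_two_apply (η : V → V [⋀^Fin 2]→L[ℝ] F) (y : V) (ξ ζ χ : V) :
    extDeriv η y ![ξ, ζ, χ] = fderiv ℝ η y ξ ![ζ, χ] - fderiv ℝ η y ζ ![ξ, χ] +
      fderiv ℝ η y χ ![ξ, ζ] := by
  have h0 : Fin.removeNth 0 ![ξ, ζ, χ] = ![ζ, χ] := by
    ext i; fin_cases i <;> rfl
  have h1 : Fin.removeNth 1 ![ξ, ζ, χ] = ![ξ, χ] := by
    ext i; fin_cases i <;> rfl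
  have h2 : Fin.removeNth 2 ![ξ, ζ, χ] = ![ξ, ζ] := by
    ext i; fin_cases i <;> rfl
  rw [extDeriv, ContinuousAlternatingMap.alternatizeUncurryFin_apply, Fin.sum_univ_three, h0, h1,
    h2]
  simp [sub_eq_add_neg]

end LowDegree

section Ddc

variable {E : Type*} [NormedAddCommGroup E] [NormedSpace ℂ E]
  {M : Type*} [TopologicalSpace M] [ChartedSpace E M] [IsManifold 𝓘(ℂ, E) ω M]
  {v₀ v : Cotangent E M} {c : E × (E →L[ℂ] ℂ)} {u u' : Cotangent E M → ℝ}

/-- The value of a form at a point, on the model space. -/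
def formAt {F : Type*} [NormedAddCommGroup F] [NormedSpace ℝ F] {n : ℕ}
    (η : Form (cotR E) (Cotangent E M) n F) (v : Cotangent E M) :
    (E × (E →L[ℂ] ℂ)) [⋀^Fin n]→L[ℝ] F := η v

/-- The differential of a function at a point, on the model space. -/
def dAt (u : Cotangent E M → ℝ) (v : Cotangent E M) : E × (E →L[ℂ] ℂ) →L[ℝ] ℝ :=
  mfderiv (cotR E) 𝓘(ℝ, ℝ) u v

theorem coordForm_dcFun (hc : c ∈ (extChartAt (cotR E) v₀).target)
    (hu : MDifferentiableAt (cotR E) 𝓘(ℝ, ℝ) u ((extChartAt (cotR E) v₀).symm c)) :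
    coordForm (oneForm (dcFun (cotR E) u)) v₀ c =
      toAlt _ _ (-(fderiv ℝ (u ∘ (extChartAt (cotR E) v₀).symm) c ∘L mulI (E × (E →L[ℂ] ℂ)))) := by
  ext X
  refine congrArg Neg.neg ?_
  change dAt u _ (mulI _ (frame (cotR E) v₀ c (X 0))) =
    fderiv ℝ (u ∘ (extChartAt (cotR E) v₀).symm) c (mulI _ (X 0))
  rw [← mfderiv_frame_fun hc hu, cot_frame_mulI hc]
  rfl

/-- The form `dd^c u` at the centre of a chart. -/
theorem ddc_eq_extDeriv (hu : ContMDiffAt (cotR E) 𝓘(ℝ, ℝ) ∞ u v) :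
    formAt (ddc (cotR E) u) v =
      extDeriv (fun c => toAlt _ _ (-(fderiv ℝ (u ∘ (extChartAt (cotR E) v).symm) c ∘L
        mulI (E × (E →L[ℂ] ℂ))))) (extChartAt (cotR E) v v) := by
  have hc := mem_extChartAt_target (I := cotR E) v
  rw [formAt, ddc, dForm_eq]
  refine Filter.EventuallyEq.extDeriv_eq ?_
  have h1 : ∀ᶠ w in 𝓝 v, MDifferentiableAt (cotR E) 𝓘(ℝ, ℝ) u w :=
    ((contMDiffAt_iff_contMDiffAt_nhds (n := 1) (by simp)).1 (hu.of_le (by simp))).mono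
      fun w hw => hw.mdifferentiableAt (by simp)
  have h2 := (continuousOn_extChartAt_symm (I := cotR E) v).continuousAt (target_mem_nhds hc)
  rw [ContinuousAt, extChartAt_to_inv] at h2
  filter_upwards [target_mem_nhds hc, h2.eventually h1] with c hc hu
  exact coordForm_dcFun hc hu

theorem contDiffAt_comp_chart_symm_self (hu : ContMDiffAt (cotR E) 𝓘(ℝ, ℝ) ∞ u v) :
    ContDiffAt ℝ ∞ (u ∘ (extChartAt (cotR E) v).symm) (extChartAt (cotR E) v v) := by
  rw [contMDiffAt_iff_source, ModelWithCorners.Boundaryless.range_eq_univ, contMDiffWithinAt_univ,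
    contMDiffAt_iff_contDiffAt] at hu
  exact hu

theorem hasFDerivAt_dc {f : E × (E →L[ℂ] ℂ) → ℝ} (hf : ContDiffAt ℝ ∞ f c) :
    HasFDerivAt (fun c => -(fderiv ℝ f c ∘L mulI (E × (E →L[ℂ] ℂ))))
      (-((ContinuousLinearMap.compL ℝ _ _ _).flip (mulI (E × (E →L[ℂ] ℂ))) ∘L
        fderiv ℝ (fderiv ℝ f) c)) c := by
  have h := (contDiffAt_fderiv_infty hf).differentiableAt (by simp)
  exact (((ContinuousLinearMap.compL ℝ _ _ _).flip
    (mulI (E × (E →L[ℂ] ℂ)))).hasFDerivAt.comp c h.hasFDerivAt).neg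

theorem extDeriv_dc {f : E × (E →L[ℂ] ℂ) → ℝ} (hf : ContDiffAt ℝ ∞ f c)
    (ξ ζ : E × (E →L[ℂ] ℂ)) :
    extDeriv (fun c => toAlt _ _ (-(fderiv ℝ f c ∘L mulI (E × (E →L[ℂ] ℂ))))) c ![ξ, ζ] =
      fderiv ℝ (fderiv ℝ f) c ζ (mulI _ ξ) - fderiv ℝ (fderiv ℝ f) c ξ (mulI _ ζ) := by
  have h := hasFDerivAt_dc hf
  rw [extDeriv_toAlt h.differentiableAt, h.fderiv]
  change -(fderiv ℝ (fderiv ℝ f) c ξ (mulI _ ζ)) - -(fderiv ℝ (fderiv ℝ f) c ζ (mulI _ ξ)) = _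
  ring

theorem ddc_apply (hu : ContMDiffAt (cotR E) 𝓘(ℝ, ℝ) ∞ u v) (ξ ζ : E × (E →L[ℂ] ℂ)) :
    formAt (ddc (cotR E) u) v ![ξ, ζ] =
      fderiv ℝ (fderiv ℝ (u ∘ (extChartAt (cotR E) v).symm)) (extChartAt (cotR E) v v) ζ
        (mulI _ ξ) -
      fderiv ℝ (fderiv ℝ (u ∘ (extChartAt (cotR E) v).symm)) (extChartAt (cotR E) v v) ξ
        (mulI _ ζ) := by
  rw [ddc_eq_extDeriv hu]
  exact extDeriv_dc (contDiffAt_comp_chart_symm_self hu) ξ ζ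

theorem contDiffAt_dc {f : E × (E →L[ℂ] ℂ) → ℝ} (hf : ContDiffAt ℝ ∞ f c) :
    ContDiffAt ℝ ∞ (fun c => toAlt _ _ (-(fderiv ℝ f c ∘L mulI (E × (E →L[ℂ] ℂ))))) c :=
  (toAlt (E × (E →L[ℂ] ℂ)) ℝ).contDiff.contDiffAt.comp c
    ((contDiffAt_fderiv_infty hf).clm_comp contDiffAt_const).neg

theorem contDiffAt_extDeriv {V F : Type*} [NormedAddCommGroup V] [NormedSpace ℝ V]
    [NormedAddCommGroup F] [NormedSpace ℝ F] {n : ℕ} {η : V → V [⋀^Fin n]→L[ℝ] F} {y : V}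
    (hη : ContDiffAt ℝ ∞ η y) : ContDiffAt ℝ ∞ (extDeriv η) y :=
  (ContinuousAlternatingMap.alternatizeUncurryFinCLM ℝ V F).contDiff.contDiffAt.comp y
    (contDiffAt_fderiv_infty hη)

theorem coordForm_dcFun_eventuallyEq (hu : ContMDiff (cotR E) 𝓘(ℝ, ℝ) ∞ u)
    (hc : c ∈ (extChartAt (cotR E) v₀).target) :
    coordForm (oneForm (dcFun (cotR E) u)) v₀ =ᶠ[𝓝 c] fun c =>
      toAlt _ _ (-(fderiv ℝ (u ∘ (extChartAt (cotR E) v₀).symm) c ∘L mulI (E × (E →L[ℂ] ℂ)))) := by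
  filter_upwards [target_mem_nhds hc] with c hc
  exact coordForm_dcFun hc ((hu _).mdifferentiableAt (by simp))

theorem coordForm_ddc (hu : ContMDiff (cotR E) 𝓘(ℝ, ℝ) ∞ u)
    (hc : c ∈ (extChartAt (cotR E) v₀).target) :
    coordForm (ddc (cotR E) u) v₀ c = extDeriv (fun c =>
      toAlt _ _ (-(fderiv ℝ (u ∘ (extChartAt (cotR E) v₀).symm) c ∘L
        mulI (E × (E →L[ℂ] ℂ))))) c := by
  rw [ddc, coordForm_dForm _ hc fun x => ?_]
  · exact (coordForm_dcFun_eventuallyEq hu hc).extDeriv_eq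
  · have hx := mem_extChartAt_target (I := cotR E) x
    exact ((contDiffAt_dc (contDiffAt_comp_chart_symm hu hx)).differentiableAt
      (by simp)).congr_of_eventuallyEq (coordForm_dcFun_eventuallyEq hu hx)

theorem contDiffAt_coordForm_ddc (hu : ContMDiff (cotR E) 𝓘(ℝ, ℝ) ∞ u)
    (hc : c ∈ (extChartAt (cotR E) v₀).target) :
    ContDiffAt ℝ ∞ (coordForm (ddc (cotR E) u) v₀) c := by
  refine (contDiffAt_extDeriv (contDiffAt_dc (contDiffAt_comp_chart_symm hu hc))).congr_of_eventuallyEq ?_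
  filter_upwards [target_mem_nhds hc] with c hc
  exact coordForm_ddc hu hc

/-- Two forms of degree two which agree on all pairs of vectors are equal. -/
theorem alt_two_ext {V F : Type*} [NormedAddCommGroup V] [NormedSpace ℝ V]
    [NormedAddCommGroup F] [NormedSpace ℝ F] {η η' : V [⋀^Fin 2]→L[ℝ] F}
    (h : ∀ ξ ζ : V, η ![ξ, ζ] = η' ![ξ, ζ]) : η = η' := by
  ext X
  have : X = ![X 0, X 1] := by ext i; fin_cases i <;> rfl
  rw [this, h]

theorem fderiv_two_add {f f' : E × (E →L[ℂ] ℂ) → ℝ} (hf : ContDiffAt ℝ ∞ f c)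
    (hf' : ContDiffAt ℝ ∞ f' c) : fderiv ℝ (fderiv ℝ (f + f')) c =
      fderiv ℝ (fderiv ℝ f) c + fderiv ℝ (fderiv ℝ f') c := by
  have h1 : fderiv ℝ (f + f') =ᶠ[𝓝 c] fderiv ℝ f + fderiv ℝ f' := by
    filter_upwards [(hf.of_le (m := 1) (by simp)).eventually (by simp),
      (hf'.of_le (m := 1) (by simp)).eventually (by simp)] with c hf hf'
    exact fderiv_add (hf.differentiableAt (by simp)) (hf'.differentiableAt (by simp))
  rw [h1.fderiv_eq, fderiv_add ((contDiffAt_fderiv_infty hf).differentiableAt (by simp))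
    ((contDiffAt_fderiv_infty hf').differentiableAt (by simp))]

theorem ddc_add (hu : ContMDiffAt (cotR E) 𝓘(ℝ, ℝ) ∞ u v)
    (hu' : ContMDiffAt (cotR E) 𝓘(ℝ, ℝ) ∞ u' v) :
    formAt (ddc (cotR E) (u + u')) v =
      formAt (ddc (cotR E) u) v +
      formAt (ddc (cotR E) u') v := by
  refine alt_two_ext fun ξ ζ => ?_
  have h := fderiv_two_add (contDiffAt_comp_chart_symm_self hu)
    (contDiffAt_comp_chart_symm_self hu')
  rw [ddc_apply (hu.add hu'), ContinuousAlternatingMap.add_apply, ddc_apply hu, ddc_apply hu']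
  rw [show (u + u') ∘ (extChartAt (cotR E) v).symm = u ∘ (extChartAt (cotR E) v).symm +
    u' ∘ (extChartAt (cotR E) v).symm from rfl, h]
  simp only [add_apply]
  ring

theorem ddc_congr (h : u =ᶠ[𝓝 v] u') (hu : ContMDiffAt (cotR E) 𝓘(ℝ, ℝ) ∞ u v) :
    formAt (ddc (cotR E) u) v = formAt (ddc (cotR E) u') v := by
  have hc := mem_extChartAt_target (I := cotR E) v
  have h2 := (continuousOn_extChartAt_symm (I := cotR E) v).continuousAt (target_mem_nhds hc)
  rw [ContinuousAt, extChartAt_to_inv] at h2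
  have h3 : u ∘ (extChartAt (cotR E) v).symm =ᶠ[𝓝 (extChartAt (cotR E) v v)]
    u' ∘ (extChartAt (cotR E) v).symm := h2.eventually h
  refine alt_two_ext fun ξ ζ => ?_
  rw [ddc_apply hu, ddc_apply (hu.congr_of_eventuallyEq h.symm), h3.fderiv.fderiv_eq]

/-- `dd^c u` sees `u` only through `du`; this removes the dependence on the choice of a moment map.
-/
theorem ddc_eq_of_dFun_eq (h : ∀ v, dFun (cotR E) u v = dFun (cotR E) u' v) :
    ddc (cotR E) u = ddc (cotR E) u' := by
  have : dcFun (cotR E) u = dcFun (cotR E) u' := by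
    funext v
    rw [dcFun, dcFun, h]
  rw [ddc, this, ddc]

theorem ddc_smul_two (hu : ContMDiffAt (cotR E) 𝓘(ℝ, ℝ) ∞ u v) :
    formAt (ddc (cotR E) (fun y => 2 * u y)) v =
      (2 : ℝ) • formAt (ddc (cotR E) u) v := by
  have : (fun y => 2 * u y) = u + u := by
    funext y
    rw [Pi.add_apply, two_mul]
  rw [this, ddc_add hu hu, two_smul]

end Ddc

/-! ### The moment map of the circle action -/

section MomentMap

variable {E : Type*} [NormedAddCommGroup E] [NormedSpace ℂ E]
  {M : Type*} [TopologicalSpace M] [ChartedSpace E M] [IsManifold 𝓘(ℂ, E) ω M]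
  {v₀ v : Cotangent E M} {c : E × (E →L[ℂ] ℂ)} {u e : Cotangent E M → ℝ}

theorem _root_.HasFDerivAt.comp_curve {V : Type*} [NormedAddCommGroup V] [NormedSpace ℝ V]
    {f : V → ℝ} {A : V →L[ℝ] ℝ} {γ : ℝ → V} {γ' x : V} {t : ℝ} (hf : HasFDerivAt f A x)
    (hγ : HasDerivAt γ γ' t) (hx : γ t = x) : HasDerivAt (fun s => f (γ s)) (A γ') t := by
  subst hx
  exact hf.comp_hasDerivAt t hγ

theorem coordForm_pair {F : Type*} [NormedAddCommGroup F] [NormedSpace ℝ F]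
    (η : Form (cotR E) (Cotangent E M) 2 F) (ξ ζ : E × (E →L[ℂ] ℂ)) :
    coordForm η v₀ c ![ξ, ζ] = formAt η ((extChartAt (cotR E) v₀).symm c)
      ![frame (cotR E) v₀ c ξ, frame (cotR E) v₀ c ζ] := by
  rw [coordForm_apply]
  refine congrArg (formAt η _) ?_
  ext i : 1
  fin_cases i <;> rfl

theorem dAt_eq (hu : MDifferentiableAt (cotR E) 𝓘(ℝ, ℝ) u v) (ζ : E × (E →L[ℂ] ℂ)) :
    dAt u v ζ =
      fderiv ℝ (u ∘ (extChartAt (cotR E) v).symm) (extChartAt (cotR E) v v) ζ := by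
  have h := extChartAt_to_inv (I := cotR E) v
  have h1 := mfderiv_frame_fun (mem_extChartAt_target (I := cotR E) v) (by rwa [h]) ζ (u := u)
  rw [frame_self] at h1
  rw [← h1]
  change dAt u v ζ = dAt u _ ζ
  rw [h]

variable (E) in
/-- The vertical vector field `(y, w) ↦ (0, w)` in coordinates. -/
def eulerMap : E × (E →L[ℂ] ℂ) →L[ℝ] E × (E →L[ℂ] ℂ) :=
  ContinuousLinearMap.inr ℝ E (E →L[ℂ] ℂ) ∘L ContinuousLinearMap.snd ℝ E (E →L[ℂ] ℂ)

omit [IsManifold 𝓘(ℂ, E) ω M] in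
theorem eulerMap_apply (c : E × (E →L[ℂ] ℂ)) : eulerMap E c = (0, c.2) := rfl

omit [IsManifold 𝓘(ℂ, E) ω M] in
theorem eulerMap_mulI (c : E × (E →L[ℂ] ℂ)) :
    eulerMap E (mulI _ c) = mulI _ (eulerMap E c) := by
  refine Prod.ext ?_ rfl
  exact (smul_zero Complex.I).symm

/-- The generator of the circle action, as a vector of the model space. -/
def circleVec (v : Cotangent E M) : E × (E →L[ℂ] ℂ) := circleField v

omit [IsManifold 𝓘(ℂ, E) ω M] in
theorem hasDerivAt_rotate_model (c : E × (E →L[ℂ] ℂ)) :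
    HasDerivAt (fun θ : ℝ => ((c.1, Complex.exp (θ * Complex.I) • c.2) : E × (E →L[ℂ] ℂ)))
      (mulI _ (eulerMap E c)) 0 := by
  have h1 : HasDerivAt (fun θ : ℝ => Complex.exp (θ * Complex.I)) Complex.I 0 := by
    have h := ((hasDerivAt_id (0 : ℝ)).ofReal_comp.mul_const Complex.I).cexp
    simpa using h
  refine ((hasDerivAt_const (0 : ℝ) c.1).prodMk (h1.smul_const c.2)).congr_deriv ?_
  exact Prod.ext (smul_zero Complex.I).symm rfl

theorem circleVec_cot_symm (hc : c ∈ (extChartAt (cotR E) v₀).target) :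
    circleVec ((extChartAt (cotR E) v₀).symm c) =
      frame (cotR E) v₀ c (mulI _ (eulerMap E c)) := by
  set γ : ℝ → E × (E →L[ℂ] ℂ) := fun θ => (c.1, Complex.exp (θ * Complex.I) • c.2) with hγ
  have h0 : γ 0 = c := by simp [hγ]
  have h1 : HasMFDerivAt 𝓘(ℝ, ℝ) 𝓘(ℝ, E × (E →L[ℂ] ℂ)) γ 0
      (show ℝ →L[ℝ] E × (E →L[ℂ] ℂ) from
        ContinuousLinearMap.toSpanSingleton ℝ (mulI _ (eulerMap E c))) :=
    hasMFDerivAt_iff_hasFDerivAt.2 (hasDerivAt_rotate_model c).hasFDerivAt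
  have hc' : γ 0 ∈ (extChartAt (cotR E) v₀).target := by rwa [h0]
  have h2 := (mdifferentiableAt_chart_symm hc').hasMFDerivAt.comp 0 h1
  have h3 : (extChartAt (cotR E) v₀).symm ∘ γ =
      fun θ : ℝ => rotate θ ((extChartAt (cotR E) v₀).symm c) :=
    funext fun θ => cot_symm_smul hc _
  rw [h3] at h2
  have h4 : circleVec ((extChartAt (cotR E) v₀).symm c) = frame (cotR E) v₀ (γ 0)
      (ContinuousLinearMap.toSpanSingleton ℝ (mulI _ (eulerMap E c)) (1 : ℝ)) :=
    congrArg (fun A : ℝ →L[ℝ] E × (E →L[ℂ] ℂ) => A 1) h2.mfderiv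
  rw [h4, h0, ContinuousLinearMap.toSpanSingleton_apply, one_smul]

theorem circleVec_eq (v : Cotangent E M) :
    circleVec v = mulI _ (eulerMap E (extChartAt (cotR E) v v)) := by
  have h := circleVec_cot_symm (mem_extChartAt_target (I := cotR E) v)
  rwa [frame_self, extChartAt_to_inv] at h

/-- The contraction of `dd^c u` with the generator of the circle action, for an invariant function
`u` with radial derivative `e`. -/
theorem ddc_circleVec (hu : ContMDiff (cotR E) 𝓘(ℝ, ℝ) ∞ u) (he : ContMDiff (cotR E) 𝓘(ℝ, ℝ) ∞ e)
    (hinv : ∀ (θ : ℝ) v, u (rotate θ v) = u v)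
    (hrad : ∀ v, HasDerivAt (fun t : ℝ => u (fiberSmul t v)) (e v) 1) (v : Cotangent E M)
    (ζ : E × (E →L[ℂ] ℂ)) : formAt (ddc (cotR E) u) v ![circleVec v, ζ] = -dAt e v ζ := by
  rw [ddc_apply hu.contMDiffAt, dAt_eq ((he v).mdifferentiableAt (by simp)), circleVec_eq]
  have hc := mem_extChartAt_target (I := cotR E) v
  have hsm := contDiffAt_comp_chart_symm hu hc
  generalize extChartAt (cotR E) v v = c₀ at hc hsm ⊢
  have hf : ∀ c ∈ (extChartAt (cotR E) v).target, HasFDerivAt (u ∘ (extChartAt (cotR E) v).symm)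
      (fderiv ℝ (u ∘ (extChartAt (cotR E) v).symm) c) c := fun c hc =>
    ((contDiffAt_comp_chart_symm hu hc).differentiableAt (by simp)).hasFDerivAt
  -- Near `c₀`, invariance says that `du` vanishes on `I` times the Euler field, and `h2` below says
  -- that `du` of the Euler field is `e`.
  have h1 : (fun c => fderiv ℝ (u ∘ (extChartAt (cotR E) v).symm) c (mulI _ (eulerMap E c)))
      =ᶠ[𝓝 c₀] fun _ => 0 := by
    filter_upwards [target_mem_nhds hc] with c hc
    have h2 := (hasDerivAt_rotate_model c)
    have h4 := (hf c hc).comp_curve h2 (by simp)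
    refine h4.unique ((hasDerivAt_const (0 : ℝ)
      (u ((extChartAt (cotR E) v).symm c))).congr_of_eventuallyEq
      (Eventually.of_forall fun θ => ?_))
    exact (congrArg u (cot_symm_smul hc _)).trans (hinv θ _)
  have h2 : (fun c => fderiv ℝ (u ∘ (extChartAt (cotR E) v).symm) c (eulerMap E c))
      =ᶠ[𝓝 c₀] e ∘ (extChartAt (cotR E) v).symm := by
    filter_upwards [target_mem_nhds hc] with c hc
    have h2 : HasDerivAt (fun t : ℝ => ((c.1, (t : ℂ) • c.2) : E × (E →L[ℂ] ℂ)))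
        (eulerMap E c) 1 := by
      refine ((hasDerivAt_const (1 : ℝ) c.1).prodMk
        ((hasDerivAt_id (1 : ℝ)).ofReal_comp.smul_const c.2)).congr_deriv ?_
      simp [eulerMap_apply]
    have h4 := (hf c hc).comp_curve h2 (by simp)
    refine h4.unique ((hrad _).congr_of_eventuallyEq (Eventually.of_forall fun t => ?_))
    exact congrArg u (cot_symm_smul hc _)
  generalize u ∘ (extChartAt (cotR E) v).symm = f at *
  have hd := ((contDiffAt_fderiv_infty hsm).differentiableAt (by simp)).hasFDerivAt
  have h3 := hd.clm_apply (mulI _ ∘L eulerMap E).hasFDerivAt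
  have h4 := hd.clm_apply (eulerMap E).hasFDerivAt
  -- Cartan's formula by hand: the first relation is differentiated along `I ζ`, the second along
  -- `ζ`. After exchanging the arguments of the Hessian, the two combine to the claim.
  have h5 := (h3.congr_of_eventuallyEq h1.symm).unique (hasFDerivAt_const (0 : ℝ) c₀)
  have h6 := (h4.congr_of_eventuallyEq h2.symm).fderiv
  have h7 : fderiv ℝ f c₀ (mulI _ (eulerMap E (mulI _ ζ))) +
      fderiv ℝ (fderiv ℝ f) c₀ (mulI _ ζ) (mulI _ (eulerMap E c₀)) = 0 :=
    congrArg (fun A : E × (E →L[ℂ] ℂ) →L[ℝ] ℝ => A (mulI _ ζ)) h5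
  have h8 : fderiv ℝ (e ∘ (extChartAt (cotR E) v).symm) c₀ ζ = fderiv ℝ f c₀ (eulerMap E ζ) +
      fderiv ℝ (fderiv ℝ f) c₀ ζ (eulerMap E c₀) :=
    congrArg (fun A : E × (E →L[ℂ] ℂ) →L[ℝ] ℝ => A ζ) h6
  rw [eulerMap_mulI, mulI_mulI, map_neg] at h7
  rw [h8, mulI_mulI, map_neg, (hsm.isSymmSndFDerivAt minSmoothness_two_le_infty).eq (mulI _ (eulerMap E c₀)) (mulI _ ζ)]
  linarith

namespace HermitianMetric

variable (g : HermitianMetric E M)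

theorem formAt_pullForm (v : Cotangent E M) (ξ ζ : E × (E →L[ℂ] ℂ)) :
    formAt (pullForm (cotR E) 𝓘(ℝ, E) proj g.kahlerForm) v ![ξ, ζ] =
      g.met v.1 (mulI E ξ.1) ζ.1 := by
  have h := fun ξ => mfderiv_proj_frame (mem_extChartAt_target (I := cotR E) v) ξ
  have h2 : ∀ ξ : E × (E →L[ℂ] ℂ), (mfderiv (cotR E) 𝓘(ℝ, E) proj v :
      E × (E →L[ℂ] ℂ) →L[ℝ] E) ξ = ξ.1 := by
    intro ξ
    have h := h ξ
    rw [frame_self, cot_chart_self, frame_self, ← cot_chart_self] at h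
    refine Eq.trans ?_ h
    rw [extChartAt_to_inv]
    rfl
  rw [← h2 ξ, ← h2 ζ]
  refine Eq.trans ?_ (g.kahlerForm_apply (proj v) (mfderiv (cotR E) 𝓘(ℝ, E) proj v ξ)
    (mfderiv (cotR E) 𝓘(ℝ, E) proj v ζ))
  refine congrArg (g.kahlerForm (proj v)) ?_
  ext i : 1
  fin_cases i <;> rfl

theorem formAt_bgForm (v : Cotangent E M) : formAt g.bgForm v =
    formAt (pullForm (cotR E) 𝓘(ℝ, E) proj g.kahlerForm) v + formAt (ddc (cotR E) g.potential) v :=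
  rfl

variable {g} [FiniteDimensional ℂ E] (hg : g.IsHermitianSymmetric) (hK : g.NonnegCurvature)
include hg hK

/-- The generator is vertical, so `p^*ω` contributes nothing; `h` is invariant with radial
derivative `-μ`, so `ddc_circleVec` gives `dμ`. -/
theorem isMomentMap_mu : g.IsMomentMap g.mu where
  smooth := contMDiff_mu hg hK
  contract v := by
    suffices h : ∀ ξ, formAt g.bgForm v ![circleVec v, ξ] = dAt g.mu v ξ from h
    intro ξ
    have h1 := ddc_circleVec (contMDiff_potential hg hK) (contMDiff_mu hg hK).neg
      (fun θ v => ?_) (hasDerivAt_potential_fiberSmul hg hK) v ξ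
    · have h2 : dAt (fun v => -g.mu v) v = -dAt g.mu v := mfderiv_neg
      rw [formAt_bgForm, ContinuousAlternatingMap.add_apply, h1, h2, formAt_pullForm, circleVec_eq]
      have h3 : mulI E (mulI (E × (E →L[ℂ] ℂ)) (eulerMap E (extChartAt (cotR E) v v))).1 = 0 := by
        change mulI E (mulI E 0) = 0
        rw [map_zero, map_zero]
      rw [h3, map_zero, zero_apply, neg_apply]
      ring
    · rw [rotate_eq_fiberSmul]
      refine quad_fiberSmul_of_norm hg hK _ ?_ v
      rw [Complex.exp_ofReal_mul_I_re, Complex.exp_ofReal_mul_I_im, Real.cos_sq_add_sin_sq]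

theorem IsMomentMap.ddc_eq {μ : Cotangent E M → ℝ} (hμ : g.IsMomentMap μ) :
    ddc (cotR E) μ = ddc (cotR E) g.mu := by
  refine ddc_eq_of_dFun_eq fun v => ?_
  ext ξ
  rw [← hμ.contract v ξ, ← (isMomentMap_mu hg hK).contract v ξ]

theorem IsMomentMap.bgForm_add_ddc {μ : Cotangent E M → ℝ} (hμ : g.IsMomentMap μ)
    (v : Cotangent E M) : formAt g.bgForm v + formAt (ddc (cotR E) μ) v =
      formAt g.explicitCurvature v := by
  have h : g.hypPotential = g.potential + g.mu :=
    funext fun v => (potential_add_mu hg hK v).symm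
  rw [hμ.ddc_eq hg hK, formAt_bgForm, add_assoc,
    ← ddc_add (contMDiff_potential hg hK).contMDiffAt (contMDiff_mu hg hK).contMDiffAt, ← h]
  rfl

end HermitianMetric

end MomentMap

/-! ### Rescaled metrics of line bundles -/

section RescaledMetric

variable {E : Type*} [NormedAddCommGroup E] [NormedSpace ℂ E]
  {M : Type*} [TopologicalSpace M] [ChartedSpace E M] [IsManifold 𝓘(ℂ, E) ω M]
  {L : Cotangent E M → Type*}
  [∀ v, AddCommGroup (L v)] [∀ v, Module ℂ (L v)] [∀ v, TopologicalSpace (L v)]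
  [TopologicalSpace (TotalSpace ℂ L)] [FiberBundle ℂ L]

omit [∀ v, AddCommGroup (L v)] [∀ v, Module ℂ (L v)] in
theorem contMDiffAt_real_section {s : Cotangent E M → TotalSpace ℂ L} {v : Cotangent E M}
    (hs : ContMDiffAt (cotC E) ((cotC E).prod 𝓘(ℂ, ℂ)) ω s v) :
    ContMDiffAt (cotR E) ((cotR E).prod 𝓘(ℝ, ℂ)) ∞ s v := by
  rw [contMDiffAt_iff] at hs ⊢
  exact ⟨hs.1, (hs.2.restrict_scalars ℝ).of_le le_top⟩

theorem LineMetric.contMDiffAt_log_normSq (m : LineMetric L) {U : Set (Cotangent E M)}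
    (hU : IsOpen U) {s : (v : Cotangent E M) → L v}
    (hs : ContMDiffOn (cotC E) ((cotC E).prod 𝓘(ℂ, ℂ)) ω (fun v => TotalSpace.mk' ℂ v (s v)) U)
    {v : Cotangent E M} (hv : v ∈ U) (h0 : s v ≠ 0) :
    ContMDiffAt (cotR E) 𝓘(ℝ, ℝ) ∞ (fun y => Real.log (m.normSq y (s y))) v := by
  have h1 := contMDiffAt_real_section (hs.contMDiffAt (hU.mem_nhds hv))
  have h2 : ContMDiffAt (cotR E) 𝓘(ℝ, ℝ) ∞ (fun y => m.normSq y (s y)) v :=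
    (m.smooth _).comp v h1
  have h3 : ContDiffAt ℝ ∞ Real.log (m.normSq v (s v)) :=
    Real.contDiffAt_log.2 (m.normSq_pos v _ h0).ne'
  exact h3.contMDiffAt.comp v h2

/-- The rescaling adds `2 μ` to `log ‖s‖²`, and half of its `dd^c` is `dd^c μ`. -/
theorem LineMetric.HasCurvature.rescale {m : LineMetric L}
    {F F' : Form (cotR E) (Cotangent E M) 2 ℝ} (hm : m.HasCurvature F) {μ : Cotangent E M → ℝ}
    (hμ : ContMDiff (cotR E) 𝓘(ℝ, ℝ) ∞ μ)
    (h : ∀ v, formAt F v + formAt (ddc (cotR E) μ) v = formAt F' v) :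
    (m.rescale μ hμ).HasCurvature F' := by
  intro U s hU hs h0 v hv
  have h1 := m.contMDiffAt_log_normSq hU hs hv (h0 v hv)
  have h2 : ContMDiffAt (cotR E) 𝓘(ℝ, ℝ) ∞ (fun y => 2 * μ y) v :=
    contMDiffAt_const.mul hμ.contMDiffAt
  have h3 : (fun y => 2 * μ y) + (fun y => Real.log (m.normSq y (s y))) =ᶠ[𝓝 v]
      fun y => Real.log ((m.rescale μ hμ).normSq y (s y)) := by
    filter_upwards [hU.mem_nhds hv] with y hy
    change _ = Real.log (Real.exp (2 * μ y) * m.normSq y (s y))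
    rw [Real.log_mul (Real.exp_ne_zero _) (m.normSq_pos y _ (h0 y hy)).ne', Real.log_exp]
    rfl
  have h4 : formAt F v = (1 / 2 : ℝ) •
    formAt (ddc (cotR E) (fun y => Real.log (m.normSq y (s y)))) v := hm U s hU hs h0 v hv
  have h5 := ddc_congr h3 (h2.add h1)
  rw [ddc_add h2 h1, ddc_smul_two hμ.contMDiffAt] at h5
  change formAt F' v = (1 / 2 : ℝ) •
    formAt (ddc (cotR E) (fun y => Real.log ((m.rescale μ hμ).normSq y (s y)))) v
  rw [← h5, ← h, h4, smul_add, smul_smul, add_comm]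
  norm_num

end RescaledMetric

/-! ### The curvature form is of type `(1,1)` for the whole sphere of complex structures -/

section LocalType

variable {V : Type*} [NormedAddCommGroup V] [NormedSpace ℝ V]

variable (V) in
/-- Alternating forms of degree two as bilinear forms. -/
def toBilin (F : Type*) [NormedAddCommGroup F] [NormedSpace ℝ F] :
    (V [⋀^Fin 2]→L[ℝ] F) →L[ℝ] V →L[ℝ] V →L[ℝ] F :=
  ContinuousLinearMap.compL ℝ V _ _
      ((continuousMultilinearCurryFin1 ℝ V F).toContinuousLinearEquiv :
        ContinuousMultilinearMap ℝ (fun _ : Fin 1 => V) F →L[ℝ] V →L[ℝ] F) ∘L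
    ((continuousMultilinearCurryLeftEquiv ℝ (fun _ : Fin 2 => V) F).toContinuousLinearEquiv :
      ContinuousMultilinearMap ℝ (fun _ : Fin 2 => V) F →L[ℝ]
        V →L[ℝ] ContinuousMultilinearMap ℝ (fun _ : Fin 1 => V) F) ∘L
    ContinuousAlternatingMap.toContinuousMultilinearMapCLM ℝ

theorem toBilin_apply {F : Type*} [NormedAddCommGroup F] [NormedSpace ℝ F]
    (η : V [⋀^Fin 2]→L[ℝ] F) (ξ ζ : V) : toBilin V F η ξ ζ = η ![ξ, ζ] := by
  refine congrArg η ?_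
  ext i
  fin_cases i <;> rfl

theorem alt_two_swap {F : Type*} [NormedAddCommGroup F] [NormedSpace ℝ F]
    (η : V [⋀^Fin 2]→L[ℝ] F) (ξ ζ : V) : η ![ξ, ζ] = -η ![ζ, ξ] := by
  refine Eq.trans ?_ (η.map_swap ![ζ, ξ] (i := 0) (j := 1) (by decide))
  refine congrArg η ?_
  ext i
  fin_cases i <;> rfl

/-- Let `J` be an almost complex structure and `A` a closed `2`-form for which `A(J·,·)` is a
constant `2`-form, the differential of `-γ`, where `γ = i_{JZ} A(J·,·)`. Then the form
`A - d(γ ∘ J)` is invariant under `J`. -/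
theorem sub_fderiv_comp_invariant {A : V → V →L[ℝ] V →L[ℝ] ℝ} {J : V → V →L[ℝ] V}
    {γ : V → V →L[ℝ] ℝ} {c Z : V} {Ω : V → V → ℝ}
    (hA : DifferentiableAt ℝ A c) (hJ : DifferentiableAt ℝ J c) (hγ : DifferentiableAt ℝ γ c)
    (hskew : ∀ z ξ ζ, A z ξ ζ = -A z ζ ξ) (hsq : ∀ᶠ z in 𝓝 c, ∀ ξ, J z (J z ξ) = -ξ)
    (hΩ : ∀ᶠ z in 𝓝 c, ∀ ξ ζ, A z (J z ξ) ζ = Ω ξ ζ)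
    (hdγ : ∀ ξ ζ, Ω ξ ζ = fderiv ℝ γ c ζ ξ - fderiv ℝ γ c ξ ζ)
    (hclosed : ∀ ξ ζ χ, fderiv ℝ A c ξ ζ χ - fderiv ℝ A c ζ ξ χ + fderiv ℝ A c χ ξ ζ = 0)
    (hZ : ∀ χ, γ c χ = -A c χ Z) {F : V → V → ℝ}
    (hF : ∀ ξ ζ, F ξ ζ = A c ξ ζ + (fderiv ℝ (fun z => -(γ z ∘L J z)) c ξ ζ -
      fderiv ℝ (fun z => -(γ z ∘L J z)) c ζ ξ)) (ξ ζ : V) :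
    F (J c ξ) (J c ζ) = F ξ ζ := by
  have hsqc := hsq.self_of_nhds
  have hΩc := hΩ.self_of_nhds
  have hβ : ∀ ξ ζ, fderiv ℝ (fun z => -(γ z ∘L J z)) c ξ ζ =
      -(fderiv ℝ γ c ξ (J c ζ) + γ c (fderiv ℝ J c ξ ζ)) := by
    intro ξ ζ
    have h : HasFDerivAt (fun z => -(γ z ∘L J z)) _ c :=
      (hγ.hasFDerivAt.clm_comp hJ.hasFDerivAt).neg
    rw [h.fderiv]
    change -(γ c (fderiv ℝ J c ξ ζ) + fderiv ℝ γ c ξ (J c ζ)) = _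
    ring
  -- `Ω` does not depend on the point. Differentiating `A(J·,·) = Ω` therefore trades derivatives of
  -- `J`, which is not assumed parallel, for derivatives of `A`.
  have hAJ : ∀ X ξ ζ, fderiv ℝ A c X (J c ξ) ζ + A c (fderiv ℝ J c X ξ) ζ = 0 := by
    intro X ξ ζ
    have h1 := (hA.hasFDerivAt.clm_apply
      (hJ.hasFDerivAt.clm_apply (hasFDerivAt_const ξ c))).clm_apply (hasFDerivAt_const ζ c)
    have h2 : (fun z => A z (J z ξ) ζ) =ᶠ[𝓝 c] fun _ => Ω ξ ζ := hΩ.mono fun z hz => hz ξ ζ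
    have h3 := (h1.congr_of_eventuallyEq h2.symm).unique (hasFDerivAt_const (Ω ξ ζ) c)
    have h4 := congrArg (fun B : V →L[ℝ] ℝ => B X) h3
    simp at h4
    linarith
  have hN : ∀ X ξ, fderiv ℝ J c X (J c ξ) = -J c (fderiv ℝ J c X ξ) := by
    intro X ξ
    have h1 := hJ.hasFDerivAt.clm_apply (hJ.hasFDerivAt.clm_apply (hasFDerivAt_const ξ c))
    have h2 : (fun z => J z (J z ξ)) =ᶠ[𝓝 c] fun _ => -ξ := hsq.mono fun z hz => hz ξ
    have h3 := (h1.congr_of_eventuallyEq h2.symm).unique (hasFDerivAt_const (-ξ) c)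
    have h4 := congrArg (fun B : V →L[ℝ] V => B X) h3
    simp at h4
    exact eq_neg_of_add_eq_zero_right h4
  have hDskew : ∀ X ξ ζ, fderiv ℝ A c X ξ ζ = -fderiv ℝ A c X ζ ξ := by
    intro X ξ ζ
    have h1 := (hA.hasFDerivAt.clm_apply (hasFDerivAt_const ξ c)).clm_apply
      (hasFDerivAt_const ζ c)
    have h2 := (hA.hasFDerivAt.clm_apply (hasFDerivAt_const ζ c)).clm_apply
      (hasFDerivAt_const ξ c)
    have h3 : (fun z => A z ξ ζ) = fun z => -A z ζ ξ := funext fun z => hskew z ξ ζ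
    rw [h3] at h1
    have h4 := congrArg (fun B : V →L[ℝ] ℝ => B X) (h1.unique h2.neg)
    simpa using h4
  -- the contribution of the derivatives of `J`
  have hT : ∀ ξ ζ, γ c (fderiv ℝ J c ξ ζ) = fderiv ℝ A c ξ (J c ζ) Z := fun ξ ζ => by
    rw [hZ]
    linarith [hAJ ξ ζ Z]
  -- `Ω` is skew because it is an exterior derivative up to sign; as `A` is skew too, `J` moves
  -- across `A` without a sign and `J² = -1` gives the result.
  have hanti : ∀ ξ ζ, A c (J c ξ) (J c ζ) = -A c ξ ζ := by
    intro ξ ζ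
    have h1 := hΩc (J c ζ) ξ
    rw [hsqc, map_neg, neg_apply] at h1
    rw [hΩc, hskew c ξ ζ]
    linarith [hdγ ξ (J c ζ), hdγ (J c ζ) ξ]
  -- Both terms are `±A((D_Z J) ξ, ζ)`, because `D_Z J` anticommutes with `J`.
  have hZ1 : fderiv ℝ A c Z ξ (J c ζ) + fderiv ℝ A c Z (J c ξ) ζ = 0 := by
    have h1 := hAJ Z ξ ζ
    have h2 := hAJ Z (J c ξ) (J c ζ)
    rw [hsqc, hN, map_neg, map_neg, neg_apply, neg_apply, hΩc] at h2
    rw [← hΩc, hanti] at h2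
    linarith
  -- Closedness on `(ξ, Jζ, Z)` and `(Jξ, ζ, Z)` reduces all contributions of `DJ` to the sum in
  -- `hZ1`, which is zero. What remains is `-2 A(ξ, ζ)` from `A` and `-Ω(ξ, Jζ) - Ω(Jξ, ζ) = 2 A(ξ,
  -- ζ)` from `dγ`.
  have h1 := hclosed ξ (J c ζ) Z
  have h2 := hclosed (J c ξ) ζ Z
  have h3 := hdγ ξ (J c ζ)
  have h4 := hdγ (J c ξ) ζ
  have h5 := hΩc ξ (J c ζ)
  have h6 := hΩc (J c ξ) ζ
  have h7 := hanti ξ ζ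
  rw [hsqc, map_neg, neg_apply] at h6
  rw [hF, hF, hβ, hβ, hβ, hβ, hT, hT, hT, hT, hsqc, hsqc]
  simp only [map_neg, neg_apply]
  linarith

end LocalType

/-! ### The hyperkähler structure in canonical coordinates -/

section HyperkahlerType

variable {E : Type*} [NormedAddCommGroup E] [NormedSpace ℂ E]
  {M : Type*} [TopologicalSpace M] [ChartedSpace E M] [IsManifold 𝓘(ℂ, E) ω M]
  {v₀ v : Cotangent E M} {c : E × (E →L[ℂ] ℂ)}

variable (E) in
/-- The pairing `((a, b), (a', b')) ↦ b(a')`. -/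
def pairing : E × (E →L[ℂ] ℂ) →L[ℝ] E × (E →L[ℂ] ℂ) →L[ℝ] ℂ :=
  (ContinuousLinearMap.restrictScalarsL ℂ E ℂ ℝ ℝ).bilinearComp
    (ContinuousLinearMap.snd ℝ E (E →L[ℂ] ℂ)) (ContinuousLinearMap.fst ℝ E (E →L[ℂ] ℂ))

omit [IsManifold 𝓘(ℂ, E) ω M] in
theorem pairing_apply (ξ ζ : E × (E →L[ℂ] ℂ)) : pairing E ξ ζ = ξ.2 ζ.1 := rfl

theorem coordForm_tautForm (hc : c ∈ (extChartAt (cotR E) v₀).target) :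
    coordForm (tautForm (E := E) (M := M)) v₀ c = toAlt _ _ (pairing E c) := by
  ext X
  rw [toAlt_apply, pairing_apply, ← functional_cot_symm hc, ← mfderiv_proj_frame hc]
  rfl

/-- The bundle charts are Darboux charts: the coefficients are constant, which supplies the constant
`Ω` of `sub_fderiv_comp_invariant`. -/
theorem coordForm_canonicalForm (hc : c ∈ (extChartAt (cotR E) v₀).target)
    (ξ ζ : E × (E →L[ℂ] ℂ)) :
    coordForm (canonicalForm (E := E) (M := M)) v₀ c ![ξ, ζ] =
      pairing E ζ ξ - pairing E ξ ζ := by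
  have h1 : ∀ {v₀ : Cotangent E M} {c}, c ∈ (extChartAt (cotR E) v₀).target →
      coordForm (tautForm (E := E) (M := M)) v₀ =ᶠ[𝓝 c] fun c => toAlt _ _ (pairing E c) := by
    intro v₀ c hc
    filter_upwards [target_mem_nhds hc] with c hc
    exact coordForm_tautForm hc
  have h2 : coordForm (canonicalForm (E := E) (M := M)) v₀ c ![ξ, ζ] =
      -coordForm (dForm (tautForm (E := E) (M := M))) v₀ c ![ξ, ζ] := rfl
  rw [h2, coordForm_dForm _ hc fun v => ?_]
  · rw [(h1 hc).extDeriv_eq, extDeriv_toAlt (pairing E).differentiableAt,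
      ContinuousLinearMap.fderiv, neg_sub]
  · exact ((toAlt _ ℂ ∘L pairing E).differentiableAt).congr_of_eventuallyEq
      (h1 (mem_extChartAt_target v))

/-- The bilinear form `(ξ, ζ) ↦ η(ξ, Iζ)`. -/
def hermitianForm (η : (E × (E →L[ℂ] ℂ)) [⋀^Fin 2]→L[ℝ] ℝ) :
    E × (E →L[ℂ] ℂ) →L[ℝ] E × (E →L[ℂ] ℂ) →L[ℝ] ℝ :=
  (ContinuousLinearMap.compL ℝ _ _ ℝ).flip (mulI (E × (E →L[ℂ] ℂ))) ∘L toBilin _ ℝ η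

omit [IsManifold 𝓘(ℂ, E) ω M] in
theorem hermitianForm_apply (η : (E × (E →L[ℂ] ℂ)) [⋀^Fin 2]→L[ℝ] ℝ) (ξ ζ : E × (E →L[ℂ] ℂ)) :
    hermitianForm η ξ ζ = η ![ξ, mulI _ ζ] := toBilin_apply _ _ _

theorem hermitianForm_coordForm (η : Form (cotR E) (Cotangent E M) 2 ℝ)
    (hc : c ∈ (extChartAt (cotR E) v₀).target) (ξ ζ : E × (E →L[ℂ] ℂ)) :
    hermitianForm (coordForm η v₀ c) ξ ζ =
      hermitianForm (formAt η ((extChartAt (cotR E) v₀).symm c))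
        (frame (cotR E) v₀ c ξ) (frame (cotR E) v₀ c ζ) := by
  rw [hermitianForm_apply, hermitianForm_apply, coordForm_pair, cot_frame_mulI hc]

variable (E) in
/-- The real part of the canonical symplectic form in coordinates. -/
def canonicalRe : E × (E →L[ℂ] ℂ) →L[ℝ] E × (E →L[ℂ] ℂ) →L[ℝ] ℝ :=
  ContinuousLinearMap.compL ℝ _ _ _ Complex.reCLM ∘L ((pairing E).flip - pairing E)

omit [IsManifold 𝓘(ℂ, E) ω M] in
theorem canonicalRe_apply (ξ ζ : E × (E →L[ℂ] ℂ)) :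
    canonicalRe E ξ ζ = (pairing E ζ ξ - pairing E ξ ζ).re := rfl

variable (E) in
/-- The imaginary part of the tautological form in coordinates. -/
def tautIm : E × (E →L[ℂ] ℂ) →L[ℝ] E × (E →L[ℂ] ℂ) →L[ℝ] ℝ :=
  ContinuousLinearMap.compL ℝ _ _ _ Complex.imCLM ∘L pairing E

omit [IsManifold 𝓘(ℂ, E) ω M] in
theorem tautIm_apply (ξ ζ : E × (E →L[ℂ] ℂ)) : tautIm E ξ ζ = (pairing E ξ ζ).im := rfl

omit [IsManifold 𝓘(ℂ, E) ω M] in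
-- The Euler field contracts the canonical form to `-θ`, so its multiple by `I` gives `-i θ`, of
-- real part `Im θ`.
theorem canonicalRe_circle (c ζ : E × (E →L[ℂ] ℂ)) :
    canonicalRe E (mulI _ (eulerMap E c)) ζ = tautIm E c ζ := by
  rw [canonicalRe_apply, tautIm_apply, pairing_apply, pairing_apply, pairing_apply]
  change (ζ.2 (Complex.I • (0 : E)) - Complex.I * c.2 ζ.1).re = (c.2 ζ.1).im
  rw [smul_zero, map_zero]
  simp

/-- An endomorphism field at a point, on the model space. -/
def endAt (J : (v : Cotangent E M) → TangentSpace (cotR E) v →L[ℝ] TangentSpace (cotR E) v)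
    (v : Cotangent E M) : E × (E →L[ℂ] ℂ) →L[ℝ] E × (E →L[ℂ] ℂ) := J v

namespace HermitianMetric

variable (g : HermitianMetric E M)

theorem coordForm_pullForm (hc : c ∈ (extChartAt (cotR E) v₀).target) (ξ ζ : E × (E →L[ℂ] ℂ)) :
    coordForm (pullForm (cotR E) 𝓘(ℝ, E) proj g.kahlerForm) v₀ c ![ξ, ζ] =
      g.coeff v₀.1 c.1 (mulI E ξ.1) ζ.1 := by
  have hc' := mem_cot_target.1 hc
  rw [coordForm_pair, coeff_apply, frame_mulI hc', ← mfderiv_proj_frame hc,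
    ← mfderiv_proj_frame hc, ← cot_symm_fst hc]
  refine Eq.trans ?_ (g.kahlerForm_apply (proj ((extChartAt (cotR E) v₀).symm c))
    (mfderiv (cotR E) 𝓘(ℝ, E) proj _ (frame (cotR E) v₀ c ξ))
    (mfderiv (cotR E) 𝓘(ℝ, E) proj _ (frame (cotR E) v₀ c ζ)))
  refine congrArg (g.kahlerForm (proj ((extChartAt (cotR E) v₀).symm c))) ?_
  ext i : 1
  fin_cases i <;> rfl

theorem contDiffAt_coordForm_pullForm [FiniteDimensional ℂ E]
    (hc : c ∈ (extChartAt (cotR E) v₀).target) :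
    ContDiffAt ℝ ∞ (coordForm (pullForm (cotR E) 𝓘(ℝ, E) proj g.kahlerForm) v₀) c := by
  have h1 : ContDiffAt ℝ ∞ (fun c : E × (E →L[ℂ] ℂ) => g.coeff v₀.1 c.1) c :=
    ((g.isMetricOn_coeff v₀.1).contDiffAt (mem_cot_target.1 hc)).comp c contDiffAt_fst
  have h2 : ContDiffAt ℝ ∞ (fun c : E × (E →L[ℂ] ℂ) =>
      (ContinuousLinearMap.compL ℝ _ _ ℝ).flip (ContinuousLinearMap.fst ℝ E (E →L[ℂ] ℂ)) ∘L
        (g.coeff v₀.1 c.1 ∘L (mulI E ∘L ContinuousLinearMap.fst ℝ E (E →L[ℂ] ℂ)))) c :=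
    contDiffAt_const.clm_comp (h1.clm_comp contDiffAt_const)
  have h3 : ContDiffAt ℝ ∞ (fun c : E × (E →L[ℂ] ℂ) => altBilin
      ((ContinuousLinearMap.compL ℝ _ _ ℝ).flip (ContinuousLinearMap.fst ℝ E (E →L[ℂ] ℂ)) ∘L
        (g.coeff v₀.1 c.1 ∘L (mulI E ∘L ContinuousLinearMap.fst ℝ E (E →L[ℂ] ℂ))))) c :=
    ((ContinuousAlternatingMap.alternatizeUncurryFinCLM ℝ (E × (E →L[ℂ] ℂ))
      ℝ).contDiff.contDiffAt.comp c (contDiffAt_const.clm_comp h2)).const_smul (1 / 2 : ℝ)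
  refine h3.congr_of_eventuallyEq ?_
  filter_upwards [target_mem_nhds hc] with c hc
  refine alt_two_ext fun ξ ζ => ?_
  rw [altBilin_apply]
  have h4 := alt_two_swap
    (coordForm (pullForm (cotR E) 𝓘(ℝ, E) proj g.kahlerForm) v₀ c) ξ ζ
  rw [coordForm_pullForm g hc, coordForm_pullForm g hc] at h4
  rw [coordForm_pullForm g hc]
  change _ = (g.coeff v₀.1 c.1 (mulI E ξ.1) ζ.1 - g.coeff v₀.1 c.1 (mulI E ζ.1) ξ.1) / 2
  linarith

/-- The metric is Hermitian, and `dd^c` of a smooth function is of type `(1,1)` because its Hessian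
is symmetric. -/
theorem explicitCurvature_mulI (hk : ContMDiff (cotR E) 𝓘(ℝ, ℝ) ∞ g.hypPotential)
    (v : Cotangent E M) (ξ ζ : E × (E →L[ℂ] ℂ)) :
    formAt g.explicitCurvature v ![mulI _ ξ, mulI _ ζ] =
      formAt g.explicitCurvature v ![ξ, ζ] := by
  have h : formAt g.explicitCurvature v =
    formAt (pullForm (cotR E) 𝓘(ℝ, E) proj g.kahlerForm) v +
      formAt (ddc (cotR E) g.hypPotential) v := rfl
  have hs := (contDiffAt_comp_chart_symm_self
    hk.contMDiffAt (v := v)).isSymmSndFDerivAt minSmoothness_two_le_infty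
  rw [h, ContinuousAlternatingMap.add_apply, ContinuousAlternatingMap.add_apply, formAt_pullForm,
    formAt_pullForm, ddc_apply hk.contMDiffAt, ddc_apply hk.contMDiffAt]
  have h1 : ∀ ξ : E × (E →L[ℂ] ℂ), (mulI _ ξ).1 = mulI E ξ.1 := fun _ => rfl
  rw [h1, h1, met_hermitian, mulI_mulI, mulI_mulI, map_neg, map_neg, hs.eq (mulI _ ζ) ξ,
    hs.eq (mulI _ ξ) ζ]
  ring

variable {g}
variable {J : (v : Cotangent E M) → TangentSpace (cotR E) v →L[ℝ] TangentSpace (cotR E) v}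

/-- The complex structure `J`, in the chart at `v₀`. -/
def localJ (g : HermitianMetric E M) (v₀ : Cotangent E M) (c : E × (E →L[ℂ] ℂ)) :
    E × (E →L[ℂ] ℂ) →L[ℝ] E × (E →L[ℂ] ℂ) :=
  (hermitianForm (coordForm g.bgForm v₀ c)).inverse ∘L canonicalRe E

variable [FiniteDimensional ℂ E]

namespace IsHyperkahler

variable (hJ : g.IsHyperkahler J)
include hJ

omit [FiniteDimensional ℂ E] in
theorem hermitianForm_pos (v : Cotangent E M) (ξ : E × (E →L[ℂ] ℂ)) (hξ : ξ ≠ 0) :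
    0 < hermitianForm (formAt g.bgForm v) ξ ξ := by
  rw [hermitianForm_apply]
  exact hJ.pos v ξ hξ

theorem hermitianForm_coordForm_pos (hc : c ∈ (extChartAt (cotR E) v₀).target)
    (ξ : E × (E →L[ℂ] ℂ)) (hξ : ξ ≠ 0) : 0 < hermitianForm (coordForm g.bgForm v₀ c) ξ ξ := by
  rw [hermitianForm_coordForm _ hc]
  refine hJ.hermitianForm_pos _ _ fun h => hξ (frame_injective hc ?_)
  rw [h, map_zero]

omit [FiniteDimensional ℂ E] in
theorem hermitianForm_symm (hc : c ∈ (extChartAt (cotR E) v₀).target) (ξ ζ : E × (E →L[ℂ] ℂ)) :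
    hermitianForm (coordForm g.bgForm v₀ c) ξ ζ =
      hermitianForm (coordForm g.bgForm v₀ c) ζ ξ := by
  rw [hermitianForm_coordForm _ hc, hermitianForm_coordForm _ hc, hermitianForm_apply,
    hermitianForm_apply]
  exact hJ.symm _ _ _

theorem hermitianForm_localJ (hc : c ∈ (extChartAt (cotR E) v₀).target) (ξ : E × (E →L[ℂ] ℂ)) :
    hermitianForm (coordForm g.bgForm v₀ c) (localJ g v₀ c ξ) = canonicalRe E ξ :=
  apply_inverse_of_pos (hJ.hermitianForm_coordForm_pos hc) _

theorem frame_localJ (hc : c ∈ (extChartAt (cotR E) v₀).target) (ξ : E × (E →L[ℂ] ℂ)) :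
    frame (cotR E) v₀ c (localJ g v₀ c ξ) =
      endAt J ((extChartAt (cotR E) v₀).symm c) (frame (cotR E) v₀ c ξ) := by
  refine eq_of_forall_apply_eq (hJ.hermitianForm_pos ((extChartAt (cotR E) v₀).symm c))
    fun ζ => ?_
  obtain ⟨ζ, rfl⟩ := frame_surjective hc ζ
  rw [← hermitianForm_coordForm _ hc, hJ.hermitianForm_localJ hc, canonicalRe_apply,
    ← coordForm_canonicalForm hc (M := M), coordForm_pair, hermitianForm_apply]
  exact hJ.omega_two _ _ _

theorem localJ_localJ (hc : c ∈ (extChartAt (cotR E) v₀).target) (ξ : E × (E →L[ℂ] ℂ)) :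
    localJ g v₀ c (localJ g v₀ c ξ) = -ξ := by
  refine frame_injective hc ?_
  rw [hJ.frame_localJ hc, hJ.frame_localJ hc, map_neg]
  exact hJ.sq _ _

theorem hermitianForm_localJ_localJ (hc : c ∈ (extChartAt (cotR E) v₀).target)
    (ξ ζ : E × (E →L[ℂ] ℂ)) :
    hermitianForm (coordForm g.bgForm v₀ c) (localJ g v₀ c ξ) (localJ g v₀ c ζ) =
      hermitianForm (coordForm g.bgForm v₀ c) ξ ζ := by
  rw [hermitianForm_coordForm _ hc, hermitianForm_coordForm _ hc, hermitianForm_apply,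
    hermitianForm_apply, hJ.frame_localJ hc, hJ.frame_localJ hc]
  exact hJ.orthogonal_J _ _ _

theorem bgForm_localJ (hc : c ∈ (extChartAt (cotR E) v₀).target) (ξ ζ : E × (E →L[ℂ] ℂ)) :
    toBilin _ ℝ (coordForm g.bgForm v₀ c) (localJ g v₀ c ξ) ζ = tautIm E ζ ξ - tautIm E ξ ζ := by
  rw [toBilin_apply, coordForm_pair, hJ.frame_localJ hc, tautIm_apply, tautIm_apply,
    ← Complex.sub_im, ← coordForm_canonicalForm hc (M := M), coordForm_pair]
  exact ((hJ.omega_three _ _ _).trans (hJ.orthogonal_I _ _ _)).symm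

/-- Smoothness is not part of the definition of `J`; it follows because `J` is determined by `ω₂`
and the metric, both smooth. -/
theorem contDiffAt_localJ (hc : c ∈ (extChartAt (cotR E) v₀).target)
    (hs : ContDiffAt ℝ ∞ (coordForm g.bgForm v₀) c) : ContDiffAt ℝ ∞ (localJ g v₀) c := by
  refine ContDiffAt.clm_comp (contDiffAt_clm_inverse ?_
    (isInvertible_of_pos (hJ.hermitianForm_coordForm_pos hc))) contDiffAt_const
  exact contDiffAt_const.clm_comp ((toBilin (E × (E →L[ℂ] ℂ)) ℝ).contDiff.contDiffAt.comp c hs)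

/-- With `G` the metric, `dμ(Iζ) = G(X, ζ) = G(J X, J ζ) = ω₂(X, J ζ)`, and the contraction of `ω₂`
with `X` is `Im θ`. Thus `d^c μ = -Im θ ∘ J`. -/
theorem fderiv_momentMap {μ : Cotangent E M → ℝ} (hμ : g.IsMomentMap μ)
    (hc : c ∈ (extChartAt (cotR E) v₀).target) :
    fderiv ℝ (μ ∘ (extChartAt (cotR E) v₀).symm) c ∘L mulI (E × (E →L[ℂ] ℂ)) =
      tautIm E c ∘L localJ g v₀ c := by
  refine ContinuousLinearMap.ext fun ζ => ?_
  have h1 := hμ.contract ((extChartAt (cotR E) v₀).symm c) (frame (cotR E) v₀ c (mulI _ ζ))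
  have h2 : formAt g.bgForm ((extChartAt (cotR E) v₀).symm c)
      ![circleVec ((extChartAt (cotR E) v₀).symm c), frame (cotR E) v₀ c (mulI _ ζ)] =
      fderiv ℝ (μ ∘ (extChartAt (cotR E) v₀).symm) c (mulI _ ζ) :=
    h1.trans (mfderiv_frame_fun hc ((hμ.smooth _).mdifferentiableAt (by simp)) (mulI _ ζ))
  rw [circleVec_cot_symm hc, ← coordForm_pair, ← hermitianForm_apply] at h2
  rw [ContinuousLinearMap.comp_apply, ContinuousLinearMap.comp_apply, ← h2,
    ← hJ.hermitianForm_localJ_localJ hc, hJ.hermitianForm_localJ hc, canonicalRe_circle]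

end IsHyperkahler

variable (hg : g.IsHermitianSymmetric) (hK : g.NonnegCurvature)
include hg hK

theorem contDiffAt_coordForm_bgForm (hc : c ∈ (extChartAt (cotR E) v₀).target) :
    ContDiffAt ℝ ∞ (coordForm g.bgForm v₀) c :=
  (g.contDiffAt_coordForm_pullForm hc).add
    (contDiffAt_coordForm_ddc (contMDiff_potential hg hK) hc)

/-- By uniqueness of `dd^c μ` the form is `ω₁ + dd^c μ = ω₁ - d(Im θ ∘ J)`, the shape treated by
`sub_fderiv_comp_invariant`. -/
theorem IsHyperkahler.explicitCurvature_invariant (hJ : g.IsHyperkahler J) (v : Cotangent E M)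
    (ξ ζ : E × (E →L[ℂ] ℂ)) : formAt g.explicitCurvature v ![endAt J v ξ, endAt J v ζ] =
      formAt g.explicitCurvature v ![ξ, ζ] := by
  have hc := mem_extChartAt_target (I := cotR E) v
  have hμ := isMomentMap_mu hg hK
  have hs := contDiffAt_coordForm_bgForm hg hK hc
  have hd := hs.differentiableAt (by simp)
  have hA : HasFDerivAt (fun c => toBilin _ ℝ (coordForm g.bgForm v c))
      (toBilin _ ℝ ∘L fderiv ℝ (coordForm g.bgForm v) (extChartAt (cotR E) v v))
      (extChartAt (cotR E) v v) :=
    (toBilin (E × (E →L[ℂ] ℂ)) ℝ).hasFDerivAt.comp _ hd.hasFDerivAt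
  have hJd := (hJ.contDiffAt_localJ hc hs).differentiableAt (by simp)
  have hJv : localJ g v (extChartAt (cotR E) v v) = endAt J v := by
    refine ContinuousLinearMap.ext fun ξ => ?_
    have h := hJ.frame_localJ hc ξ
    rwa [frame_self, extChartAt_to_inv] at h
  rw [← hJv]
  refine sub_fderiv_comp_invariant (A := fun c => toBilin _ ℝ (coordForm g.bgForm v c))
    (γ := tautIm E) (Ω := fun ξ ζ => tautIm E ζ ξ - tautIm E ξ ζ)
    -- From `Im θ = G(J X, ·)` with `X` equal to `I` times the Euler vector, one gets `Im θ(χ) =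
    -- G(χ, J X) = ω₁(χ, I J X)`, so `Z = -I J X`.
    (Z := -mulI _ (localJ g v (extChartAt (cotR E) v v)
      (mulI _ (eulerMap E (extChartAt (cotR E) v v)))))
    (F := fun ξ ζ => formAt g.explicitCurvature v ![ξ, ζ])
    hA.differentiableAt hJd (tautIm E).differentiableAt ?_ ?_ ?_ ?_ ?_ ?_ ?_ ξ ζ
  · intro z ξ ζ
    rw [toBilin_apply, toBilin_apply, alt_two_swap]
  · filter_upwards [target_mem_nhds hc] with c hc
    exact hJ.localJ_localJ hc
  · filter_upwards [target_mem_nhds hc] with c hc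
    exact hJ.bgForm_localJ hc
  · intro ξ ζ
    rw [ContinuousLinearMap.fderiv]
  · intro ξ ζ χ
    have h1 : extDeriv (coordForm g.bgForm v) (extChartAt (cotR E) v v) = 0 := hJ.closed_one v
    have h2 := extDeriv_two_apply (coordForm g.bgForm v) (extChartAt (cotR E) v v) ξ ζ χ
    rw [h1] at h2
    rw [hA.fderiv]
    simp only [ContinuousLinearMap.comp_apply, toBilin_apply]
    exact h2.symm
  · intro χ
    rw [← canonicalRe_circle, ← hJ.hermitianForm_localJ hc, hJ.hermitianForm_symm hc, map_neg,
      neg_neg, hermitianForm_apply, toBilin_apply]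
  · intro ξ ζ
    have h1 : (fun c => toAlt _ _ (-(fderiv ℝ (g.mu ∘ (extChartAt (cotR E) v).symm) c ∘L
        mulI (E × (E →L[ℂ] ℂ))))) =ᶠ[𝓝 (extChartAt (cotR E) v v)]
        fun c => toAlt _ _ (-(tautIm E c ∘L localJ g v c)) := by
      filter_upwards [target_mem_nhds hc] with c hc
      rw [hJ.fderiv_momentMap hμ hc]
    have h2 : DifferentiableAt ℝ (fun c => -(tautIm E c ∘L localJ g v c))
        (extChartAt (cotR E) v v) :=
      ((tautIm E).differentiableAt.clm_comp hJd).neg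
    rw [← hμ.bgForm_add_ddc hg hK, ContinuousAlternatingMap.add_apply,
      ddc_eq_extDeriv hμ.smooth.contMDiffAt, h1.extDeriv_eq, extDeriv_toAlt h2, toBilin_apply,
      coordForm_self]
    rfl

end HermitianMetric

end HyperkahlerType

end HyperHol

end

theorem mainTheorem3
    {E : Type*} [NormedAddCommGroup E] [NormedSpace ℂ E] [FiniteDimensional ℂ E]
    {M : Type*} [TopologicalSpace M] [T2Space M] [SecondCountableTopology M] [ConnectedSpace M]
    [ChartedSpace E M] [IsManifold 𝓘(ℂ, E) ω M]
    (g : HermitianMetric E M) (hg : g.IsHermitianSymmetric) (hK : g.NonnegCurvature) :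
    -- `I R(I v, v)` is a non-negative Hermitian transformation
    (∀ (v : Cotangent E M) (X Y : TangentSpace 𝓘(ℝ, E) (proj v)),
      g.curvOp v (cxI 𝓘(ℝ, E) (proj v) X) = cxI 𝓘(ℝ, E) (proj v) (g.curvOp v X) ∧
      g.inner (proj v) (g.curvOp v X) Y = g.inner (proj v) X (g.curvOp v Y) ∧
      0 ≤ g.inner (proj v) (g.curvOp v X) X) ∧
    -- the functions `h`, `k` are smooth
    ContMDiff (cotR E) 𝓘(ℝ, ℝ) ∞ g.potential ∧
    ContMDiff (cotR E) 𝓘(ℝ, ℝ) ∞ g.hypPotential ∧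
    -- the moment map is `μ(v) = -2 ((u f(u))' v, v)`
    g.IsMomentMap g.mu ∧
    -- the curvature `ω₁ + dd^c μ` is `p^*ω + dd^c k`, whatever the choice of the moment map
    (∀ μ : Cotangent E M → ℝ, g.IsMomentMap μ → ∀ v : Cotangent E M,
      g.bgForm v + ddc (cotR E) μ v = g.explicitCurvature v) ∧
    -- it is the curvature of the hyperholomorphic line bundle, i.e. of the prequantum line bundle
    -- of `ω₁` with its metric rescaled by `e^{2μ}`
    (∀ (L : Cotangent E M → Type*) [∀ v, AddCommGroup (L v)] [∀ v, Module ℂ (L v)]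
      [∀ v, TopologicalSpace (L v)] [TopologicalSpace (TotalSpace ℂ L)] [FiberBundle ℂ L]
      [VectorBundle ℂ ℂ L] [ContMDiffVectorBundle ω ℂ L (cotC E)] (m : LineMetric L),
      m.HasCurvature g.bgForm → ∀ (μ : Cotangent E M → ℝ) (hμ : g.IsMomentMap μ),
      (m.rescale μ hμ.smooth).HasCurvature g.explicitCurvature) ∧
    -- it is of type `(1,1)` for the complex structures `I, J, K` of the hyperkähler structure
    (∀ J : (v : Cotangent E M) → TangentSpace (cotR E) v →L[ℝ] TangentSpace (cotR E) v,
      g.IsHyperkahler J →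
      IsType11 (cxI (cotR E)) g.explicitCurvature ∧ IsType11 J g.explicitCurvature ∧
        IsType11 (fun v => cxI (cotR E) v ∘L J v) g.explicitCurvature) := by
  refine ⟨fun v X Y => ?_, HermitianMetric.contMDiff_potential hg hK,
    HermitianMetric.contMDiff_hypPotential hg hK, HermitianMetric.isMomentMap_mu hg hK,
    fun μ hμ v => HermitianMetric.IsMomentMap.bgForm_add_ddc hg hK hμ v,
    fun L _ _ _ _ _ _ _ m hm μ hμ =>
      LineMetric.HasCurvature.rescale hm hμ.smooth
        (HermitianMetric.IsMomentMap.bgForm_add_ddc hg hK hμ),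
    fun J hJ => ?_⟩
  · exact HermitianMetric.curvOp_properties hg hK v X Y
  · have hI := g.explicitCurvature_mulI (HermitianMetric.contMDiff_hypPotential hg hK)
    have hJ' := hJ.explicitCurvature_invariant hg hK
    -- Invariance under `K = I J` is the composite of the other two.
    exact ⟨hI, hJ', fun v ξ ζ => (hI v _ _).trans (hJ' v ξ ζ)⟩
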